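/- Let $M$ be a connected smooth $3$-manifold with an almost Kenmotsu structure $(\varphi,\xi,\eta,g)$: $\varphi$ is a $(1,1)$-tensor field, $\xi$ a vector field, $\eta$ a $1$-form and $g$ a Riemannian metric, all smooth, with $\varphi^2=-I+\eta\otimes\xi$, $\eta(\xi)=1$, $g(\varphi X,\varphi Y)=g(X,Y)-\eta(X)\eta(Y)$, $d\eta=0$ and $d\Phi=2\,\eta\wedge\Phi$, where $\Phi(X,Y)=g(X,\varphi Y)$. Put $h=\tfrac12\mathcal L_\xi\varphi$ and $h'=h\circ\varphi$, and let $R_{XY}Z=\nabla_X\nabla_YZ-\nabla_Y\nabla_XZ-\nabla_{[X,Y]}Z$ be the curvature of the Levi-Civita connection of $g$. Assume that $h$ does not vanish identically, and let $k,\mu$ be smooth functions on $M$ such that $dk\wedge\eta=0$ and $\mu$ is not identically $-2$. Then the following two statements are equivalent. (a) $M$ is an almost Kenmotsu generalized $(k,\mu)'$-space, i.e. for all smooth vector fields $X,Y$ $$R_{XY}\xi=k\big(\eta(Y)X-\eta(X)Y\big)+\mu\big(\eta(Y)h'X-\eta(X)h'Y\big).$$ (b) Every point $p\in M$ has an open neighbourhood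 $U$ with smooth coordinates $x^1,x^2,t$ in which $\mu$ depends only on $t$ and, for some antiderivative $f=\int(\mu+2)\,dt$, $k=-1-e^{-2f}$ on $U$. Moreover, on $U$, $$\varphi=\sum_{i,j=1}^2\varphi^i_j\,dx^j\otimes\frac{\partial}{\partial x^i},\quad \xi=\frac{\partial}{\partial t},\quad \eta=dt,\quad g=dt\otimes dt+\sum_{i,j=1}^2g_{ij}\,dx^i\otimes dx^j,$$ $$h=\sum_{i,j=1}^2h^i_j\,dx^j\otimes\frac{\partial}{\partial x^i},\quad h'=\sum_{i,j=1}^2B^i_j\,dx^j\otimes\frac{\partial}{\partial x^i},$$ where $\varphi^i_j,g_{ij},h^i_j,B^i_j$ are functions of $t$ only; up to skew-symmetry the only non-zero component of $\Phi$ is $\Phi_{12}=\Phi(\partial/\partial x^1,\partial/\partial x^2)=e^{2t}$; $\sum_sB^i_sB^s_j=e^{-2f}\delta^i_j$; and, with $\lambda=e^{-f}$, $$\frac{d\varphi^i_j}{dt}=2h^i_j,\qquad \frac{dB^i_j}{dt}=-(\mu+2)B^i_j,\qquad \frac{dh^i_j}{dt}=2\lambda^2\varphi^i_j-(\mu+2)h^i_j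 .$$ -/

import Mathlib

open Set Filter Topology Bundle VectorField
open scoped Manifold ContDiff

noncomputable section

namespace AlmostKenmotsu

variable {E : Type*} [NormedAddCommGroup E] [NormedSpace ℝ E]
  {M : Type*} [TopologicalSpace M] [ChartedSpace E M]

section LeviCivita

variable [IsManifold 𝓘(ℝ, E) ∞ M]

/-- The right-hand side of the Koszul formula at the point `p`:
`X(g(Y,Z)) + Y(g(X,Z)) - Z(g(X,Y)) + g([X,Y],Z) - g([X,Z],Y) - g([Y,Z],X)`. -/
def koszul
    (g : ContMDiffRiemannianMetric 𝓘(ℝ, E) ∞ E (fun p : M => TangentSpace 𝓘(ℝ, E) p))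
    (X Y Z : ∀ p : M, TangentSpace 𝓘(ℝ, E) p) (p : M) : ℝ :=
  mvfderiv 𝓘(ℝ, E) (fun q => g.inner q (Y q) (Z q)) p (X p)
    + mvfderiv 𝓘(ℝ, E) (fun q => g.inner q (X q) (Z q)) p (Y p)
    - mvfderiv 𝓘(ℝ, E) (fun q => g.inner q (X q) (Y q)) p (Z p)
    + g.inner p (mlieBracket 𝓘(ℝ, E) X Y p) (Z p)
    - g.inner p (mlieBracket 𝓘(ℝ, E) X Z p) (Y p)
    - g.inner p (mlieBracket 𝓘(ℝ, E) Y Z p) (X p)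

variable (g : ContMDiffRiemannianMetric 𝓘(ℝ, E) ∞ E (fun p : M => TangentSpace 𝓘(ℝ, E) p))

theorem mdiffAt_inner {X Y : ∀ p : M, TangentSpace 𝓘(ℝ, E) p} {p : M}
    (hX : MDiffAt (T% X) p) (hY : MDiffAt (T% Y) p) :
    MDiffAt (fun q => g.inner q (X q) (Y q)) p := by
  have hg := g.contMDiff.mdifferentiableAt (x := p) (by simp)
  have := MDifferentiableAt.clm_bundle_apply₂ (F₁ := E) (F₂ := E) (F₃ := ℝ)
    (E₁ := fun p : M => TangentSpace 𝓘(ℝ, E) p) (E₂ := fun p : M => TangentSpace 𝓘(ℝ, E) p)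
    (E₃ := Bundle.Trivial M ℝ) hg hX hY
  simp only [mdifferentiableAt_totalSpace] at this
  exact this.2

variable [FiniteDimensional ℝ E]

theorem koszul_add_left {X X' Y Z : ∀ p : M, TangentSpace 𝓘(ℝ, E) p} {p : M}
    (hX : MDiffAt (T% X) p) (hX' : MDiffAt (T% X') p) (hY : MDiffAt (T% Y) p)
    (hZ : MDiffAt (T% Z) p) :
    koszul g (X + X') Y Z p = koszul g X Y Z p + koszul g X' Y Z p := by
  have e1 : (fun q => g.inner q ((X + X') q) (Z q))
      = (fun q => g.inner q (X q) (Z q)) + (fun q => g.inner q (X' q) (Z q)) := by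
    ext q; simp
  have e2 : (fun q => g.inner q ((X + X') q) (Y q))
      = (fun q => g.inner q (X q) (Y q)) + (fun q => g.inner q (X' q) (Y q)) := by
    ext q; simp
  rw [koszul, e1, e2, mvfderiv_add (mdiffAt_inner g hX hZ) (mdiffAt_inner g hX' hZ),
    mvfderiv_add (mdiffAt_inner g hX hY) (mdiffAt_inner g hX' hY),
    mlieBracket_add_left hX hX', mlieBracket_add_left hX hX']
  simp [koszul]
  ring

theorem koszul_smul_left {f : M → ℝ} {X Y Z : ∀ p : M, TangentSpace 𝓘(ℝ, E) p} {p : M}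
    (hf : MDiffAt f p) (hX : MDiffAt (T% X) p) (hY : MDiffAt (T% Y) p)
    (hZ : MDiffAt (T% Z) p) :
    koszul g (f • X) Y Z p = f p * koszul g X Y Z p := by
  have e1 : (fun q => g.inner q ((f • X) q) (Z q))
      = f * (fun q => g.inner q (X q) (Z q)) := by
    ext q; simp
  have e2 : (fun q => g.inner q ((f • X) q) (Y q))
      = f * (fun q => g.inner q (X q) (Y q)) := by
    ext q; simp
  rw [koszul, e1, e2, mvfderiv_mul hf (mdiffAt_inner g hX hZ),
    mvfderiv_mul hf (mdiffAt_inner g hX hY),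
    mlieBracket_smul_left hf hX, mlieBracket_smul_left hf hX]
  simp [koszul]
  ring

theorem koszul_add_right {X Y Z Z' : ∀ p : M, TangentSpace 𝓘(ℝ, E) p} {p : M}
    (hX : MDiffAt (T% X) p) (hY : MDiffAt (T% Y) p)
    (hZ : MDiffAt (T% Z) p) (hZ' : MDiffAt (T% Z') p) :
    koszul g X Y (Z + Z') p = koszul g X Y Z p + koszul g X Y Z' p := by
  have e1 : (fun q => g.inner q (X q) ((Z + Z') q))
      = (fun q => g.inner q (X q) (Z q)) + (fun q => g.inner q (X q) (Z' q)) := by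
    ext q; simp
  have e2 : (fun q => g.inner q (Y q) ((Z + Z') q))
      = (fun q => g.inner q (Y q) (Z q)) + (fun q => g.inner q (Y q) (Z' q)) := by
    ext q; simp
  rw [koszul, e1, e2, mvfderiv_add (mdiffAt_inner g hX hZ) (mdiffAt_inner g hX hZ'),
    mvfderiv_add (mdiffAt_inner g hY hZ) (mdiffAt_inner g hY hZ'),
    mlieBracket_add_right hZ hZ', mlieBracket_add_right hZ hZ']
  simp [koszul]
  ring

theorem koszul_smul_right {f : M → ℝ} {X Y Z : ∀ p : M, TangentSpace 𝓘(ℝ, E) p} {p : M}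
    (hf : MDiffAt f p) (hX : MDiffAt (T% X) p) (hY : MDiffAt (T% Y) p)
    (hZ : MDiffAt (T% Z) p) :
    koszul g X Y (f • Z) p = f p * koszul g X Y Z p := by
  have e1 : (fun q => g.inner q (X q) ((f • Z) q))
      = f * (fun q => g.inner q (X q) (Z q)) := by
    ext q; simp
  have e2 : (fun q => g.inner q (Y q) ((f • Z) q))
      = f * (fun q => g.inner q (Y q) (Z q)) := by
    ext q; simp
  rw [koszul, e1, e2, mvfderiv_mul hf (mdiffAt_inner g hX hZ),
    mvfderiv_mul hf (mdiffAt_inner g hY hZ),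
    mlieBracket_smul_right hf hZ, mlieBracket_smul_right hf hZ]
  simp [koszul, g.symm p (Z p)]
  ring

theorem koszul_add_mid {X Y Y' Z : ∀ p : M, TangentSpace 𝓘(ℝ, E) p} {p : M}
    (hX : MDiffAt (T% X) p) (hY : MDiffAt (T% Y) p) (hY' : MDiffAt (T% Y') p)
    (hZ : MDiffAt (T% Z) p) :
    koszul g X (Y + Y') Z p = koszul g X Y Z p + koszul g X Y' Z p := by
  have e1 : (fun q => g.inner q ((Y + Y') q) (Z q))
      = (fun q => g.inner q (Y q) (Z q)) + (fun q => g.inner q (Y' q) (Z q)) := by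
    ext q; simp
  have e2 : (fun q => g.inner q (X q) ((Y + Y') q))
      = (fun q => g.inner q (X q) (Y q)) + (fun q => g.inner q (X q) (Y' q)) := by
    ext q; simp
  rw [koszul, e1, e2, mvfderiv_add (mdiffAt_inner g hY hZ) (mdiffAt_inner g hY' hZ),
    mvfderiv_add (mdiffAt_inner g hX hY) (mdiffAt_inner g hX hY'),
    mlieBracket_add_right hY hY', mlieBracket_add_left hY hY']
  simp [koszul]
  ring

theorem koszul_smul_mid {f : M → ℝ} {X Y Z : ∀ p : M, TangentSpace 𝓘(ℝ, E) p} {p : M}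
    (hf : MDiffAt f p) (hX : MDiffAt (T% X) p) (hY : MDiffAt (T% Y) p)
    (hZ : MDiffAt (T% Z) p) :
    koszul g X (f • Y) Z p = f p * koszul g X Y Z p
      + 2 * (mvfderiv 𝓘(ℝ, E) f p (X p) * g.inner p (Y p) (Z p)) := by
  have e1 : (fun q => g.inner q ((f • Y) q) (Z q))
      = f * (fun q => g.inner q (Y q) (Z q)) := by
    ext q; simp
  have e2 : (fun q => g.inner q (X q) ((f • Y) q))
      = f * (fun q => g.inner q (X q) (Y q)) := by
    ext q; simp
  rw [koszul, e1, e2, mvfderiv_mul hf (mdiffAt_inner g hY hZ),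
    mvfderiv_mul hf (mdiffAt_inner g hX hY),
    mlieBracket_smul_right hf hY, mlieBracket_smul_left hf hY]
  simp [koszul, g.symm p (Y p) (X p)]
  ring

/-- The Koszul formula for a vector field `Y` differentiable at `p`, as a bilinear form in the
values of `X` and `Z` at `p`. -/
def koszulForm (Y : ∀ p : M, TangentSpace 𝓘(ℝ, E) p) (p : M) (hY : MDiffAt (T% Y) p) :
    TangentSpace 𝓘(ℝ, E) p →L[ℝ] TangentSpace 𝓘(ℝ, E) p →L[ℝ] ℝ :=
  TensorialAt.mkHom₂ (I := 𝓘(ℝ, E)) (F := E) (F' := E) (fun X Z => koszul g X Y Z p) p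
    (fun _ hZ => ⟨fun hf hX => koszul_smul_left g hf hX hY hZ,
      fun hX hX' => koszul_add_left g hX hX' hY hZ⟩)
    (fun _ hX => ⟨fun hf hZ => koszul_smul_right g hf hX hY hZ,
      fun hZ hZ' => koszul_add_right g hX hY hZ hZ'⟩)

theorem inner_isInvertible (p : M) : (g.inner p).IsInvertible := by
  have h1 : FiniteDimensional ℝ (TangentSpace 𝓘(ℝ, E) p) :=
    inferInstanceAs (FiniteDimensional ℝ E)
  have h2 : T2Space (TangentSpace 𝓘(ℝ, E) p) := inferInstanceAs (T2Space E)
  have hinj : Function.Injective (g.inner p) := by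
    rw [injective_iff_map_eq_zero]
    intro v hv
    by_contra hne
    have := g.pos p v hne
    rw [hv] at this
    simp at this
  have hfd : FiniteDimensional ℝ (TangentSpace 𝓘(ℝ, E) p →L[ℝ] ℝ) :=
    LinearMap.toContinuousLinearMap.finiteDimensional
  have hrank : Module.finrank ℝ (TangentSpace 𝓘(ℝ, E) p)
      = Module.finrank ℝ (TangentSpace 𝓘(ℝ, E) p →L[ℝ] ℝ) := by
    rw [← (LinearMap.toContinuousLinearMap
      (𝕜 := ℝ) (E := TangentSpace 𝓘(ℝ, E) p) (F' := ℝ)).finrank_eq]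
    exact (Subspace.dual_finrank_eq (K := ℝ) (V := TangentSpace 𝓘(ℝ, E) p)).symm
  let e := LinearEquiv.ofInjectiveOfFinrankEq (g.inner p).toLinearMap hinj hrank
  exact ⟨e.toContinuousLinearEquiv, by ext v; rfl⟩

open scoped Classical in
/-- The Levi-Civita connection of `g`: `∇_X Y` at `p` is the tangent vector `w` with
`2 g(w, Z) = koszul g X Y Z p` for all `Z` (see `leviCivita_koszul`). As for every
`CovariantDerivative`, the value `∇_X Y` at `p` is written `leviCivita g Y p (X p)`; it is set to
zero if `Y` is not differentiable at `p`. -/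
def leviCivita : CovariantDerivative 𝓘(ℝ, E) E (fun p : M => TangentSpace 𝓘(ℝ, E) p) where
  toFun Y p := if hY : MDiffAt (T% Y) p then
      (1 / 2 : ℝ) • (g.inner p).inverse.comp (koszulForm g Y p hY)
    else 0
  isCovariantDerivativeOnUniv := by
    have key : ∀ (Y : ∀ p : M, TangentSpace 𝓘(ℝ, E) p) (p : M) (hY : MDiffAt (T% Y) p)
        (X Z : ∀ p : M, TangentSpace 𝓘(ℝ, E) p), MDiffAt (T% X) p → MDiffAt (T% Z) p →
        2 * g.inner p (((1 / 2 : ℝ) • (g.inner p).inverse.comp (koszulForm g Y p hY)) (X p)) (Z p)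
          = koszul g X Y Z p := by
      intro Y p hY X Z hX hZ
      have h1 : koszulForm g Y p hY (X p) (Z p) = koszul g X Y Z p :=
        TensorialAt.mkHom₂_apply _ _ hX hZ
      have h2 : g.inner p ((g.inner p).inverse (koszulForm g Y p hY (X p)))
          = koszulForm g Y p hY (X p) :=
        (inner_isInvertible g p).self_apply_inverse _
      rw [← h1]
      simp [h2]
    have ext_inner : ∀ (p : M) (v w : TangentSpace 𝓘(ℝ, E) p),
        (∀ u, 2 * g.inner p v u = 2 * g.inner p w u) → v = w := by
      intro p v w h
      obtain ⟨e, he⟩ := inner_isInvertible g p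
      apply e.injective
      have : g.inner p v = g.inner p w := by ext u; linarith [h u]
      rw [← he] at this
      exact this
    constructor
    · intro Y Y' p hY hY' _
      have hYY' : MDiffAt (T% (Y + Y')) p := mdifferentiableAt_add_section hY hY'
      simp only [hY, hY', hYY', dite_true]
      ext v
      apply ext_inner
      intro u
      have hX := FiberBundle.mdifferentiableAt_extend 𝓘(ℝ, E) E v
      have hZ := FiberBundle.mdifferentiableAt_extend 𝓘(ℝ, E) E u
      have k1 := key _ p hYY' _ _ hX hZ
      have k2 := key _ p hY _ _ hX hZ
      have k3 := key _ p hY' _ _ hX hZ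
      rw [koszul_add_mid g hX hY hY' hZ, ← k2, ← k3] at k1
      simp only [FiberBundle.extend_apply_self] at k1
      rw [k1, add_apply, map_add, add_apply]
      ring
    · intro Y f p hY hf _
      have hfY : MDiffAt (T% (f • Y)) p := hf.smul_section hY
      simp only [hY, hfY, dite_true]
      ext v
      apply ext_inner
      intro u
      have hX := FiberBundle.mdifferentiableAt_extend 𝓘(ℝ, E) E v
      have hZ := FiberBundle.mdifferentiableAt_extend 𝓘(ℝ, E) E u
      have k1 := key _ p hfY _ _ hX hZ
      have k2 := key _ p hY _ _ hX hZ
      rw [koszul_smul_mid g hf hX hY hZ, ← k2] at k1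
      simp only [FiberBundle.extend_apply_self] at k1
      rw [k1]
      generalize (1 / 2 : ℝ) • (g.inner p).inverse.comp (koszulForm g Y p hY) = A
      simp
      ring

/-- The Koszul formula, which characterizes the Levi-Civita connection. -/
theorem leviCivita_koszul {X Y Z : ∀ p : M, TangentSpace 𝓘(ℝ, E) p} {p : M}
    (hX : MDiffAt (T% X) p) (hY : MDiffAt (T% Y) p) (hZ : MDiffAt (T% Z) p) :
    2 * g.inner p (leviCivita g Y p (X p)) (Z p) = koszul g X Y Z p := by
  have h1 : koszulForm g Y p hY (X p) (Z p) = koszul g X Y Z p :=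
    TensorialAt.mkHom₂_apply _ _ hX hZ
  have h2 : g.inner p ((g.inner p).inverse (koszulForm g Y p hY (X p)))
      = koszulForm g Y p hY (X p) :=
    (inner_isInvertible g p).self_apply_inverse _
  rw [← h1]
  simp [leviCivita, hY, h2]

theorem leviCivita_torsion_free {X Y : ∀ p : M, TangentSpace 𝓘(ℝ, E) p} {p : M}
    (hX : MDiffAt (T% X) p) (hY : MDiffAt (T% Y) p) :
    leviCivita g Y p (X p) - leviCivita g X p (Y p) = mlieBracket 𝓘(ℝ, E) X Y p := by
  obtain ⟨e, he⟩ := inner_isInvertible g p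
  apply e.injective
  have : g.inner p (leviCivita g Y p (X p) - leviCivita g X p (Y p))
      = g.inner p (mlieBracket 𝓘(ℝ, E) X Y p) := by
    ext u
    have hZ := FiberBundle.mdifferentiableAt_extend 𝓘(ℝ, E) E u
    have k1 := leviCivita_koszul g hX hY hZ
    have k2 := leviCivita_koszul g hY hX hZ
    have e1 : (fun q => g.inner q (Y q) (X q)) = fun q => g.inner q (X q) (Y q) := by
      ext q; exact g.symm q _ _
    rw [koszul, FiberBundle.extend_apply_self] at k1 k2
    rw [e1, mlieBracket_swap_apply (V := Y) (W := X), g.symm p (-_),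
      (g.inner p u).map_neg, g.symm p u] at k2
    rw [map_sub, sub_apply]
    linarith
  rw [← he] at this
  exact this

theorem leviCivita_metric {X Y Z : ∀ p : M, TangentSpace 𝓘(ℝ, E) p} {p : M}
    (hX : MDiffAt (T% X) p) (hY : MDiffAt (T% Y) p) (hZ : MDiffAt (T% Z) p) :
    mvfderiv 𝓘(ℝ, E) (fun q => g.inner q (Y q) (Z q)) p (X p)
      = g.inner p (leviCivita g Y p (X p)) (Z p) + g.inner p (Y p) (leviCivita g Z p (X p)) := by
  have k1 := leviCivita_koszul g hX hY hZ
  have k2 := leviCivita_koszul g hX hZ hY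
  have e1 : (fun q => g.inner q (Z q) (Y q)) = fun q => g.inner q (Y q) (Z q) := by
    ext q; exact g.symm q _ _
  rw [koszul] at k1 k2
  rw [e1, mlieBracket_swap_apply (V := Z) (W := Y), g.symm p (-_),
    (g.inner p (X p)).map_neg, g.symm p (X p)] at k2
  rw [g.symm p (Y p)]
  linarith

/-- The Riemannian curvature `R_{XY}Z = ∇_X ∇_Y Z - ∇_Y ∇_X Z - ∇_{[X,Y]} Z`. -/
def curvature (X Y Z : ∀ p : M, TangentSpace 𝓘(ℝ, E) p) (p : M) : TangentSpace 𝓘(ℝ, E) p :=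
  leviCivita g (fun q => leviCivita g Z q (Y q)) p (X p)
    - leviCivita g (fun q => leviCivita g Z q (X q)) p (Y p)
    - leviCivita g Z p (mlieBracket 𝓘(ℝ, E) X Y p)

end LeviCivita

/-- `X` is a smooth vector field on `M`. -/
def IsSmoothField [IsManifold 𝓘(ℝ, E) ∞ M] (X : ∀ p : M, TangentSpace 𝓘(ℝ, E) p) : Prop :=
  ContMDiff 𝓘(ℝ, E) 𝓘(ℝ, E).tangent ∞ (fun p => TotalSpace.mk' E p (X p))

/-- The exterior derivative of a `1`-form, evaluated on two vector fields:
`dη(X,Y) = X(η(Y)) - Y(η(X)) - η([X,Y])`. -/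
def extDerivOne (η : ∀ p : M, TangentSpace 𝓘(ℝ, E) p →L[ℝ] ℝ)
    (X Y : ∀ p : M, TangentSpace 𝓘(ℝ, E) p) (p : M) : ℝ :=
  mvfderiv 𝓘(ℝ, E) (fun q => η q (Y q)) p (X p)
    - mvfderiv 𝓘(ℝ, E) (fun q => η q (X q)) p (Y p)
    - η p (mlieBracket 𝓘(ℝ, E) X Y p)

/-- The exterior derivative of a `2`-form, evaluated on three vector fields:
`dΨ(X,Y,Z) = X(Ψ(Y,Z)) - Y(Ψ(X,Z)) + Z(Ψ(X,Y)) - Ψ([X,Y],Z) + Ψ([X,Z],Y) - Ψ([Y,Z],X)`. -/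
def extDerivTwo (Ψ : ∀ p : M, TangentSpace 𝓘(ℝ, E) p → TangentSpace 𝓘(ℝ, E) p → ℝ)
    (X Y Z : ∀ p : M, TangentSpace 𝓘(ℝ, E) p) (p : M) : ℝ :=
  mvfderiv 𝓘(ℝ, E) (fun q => Ψ q (Y q) (Z q)) p (X p)
    - mvfderiv 𝓘(ℝ, E) (fun q => Ψ q (X q) (Z q)) p (Y p)
    + mvfderiv 𝓘(ℝ, E) (fun q => Ψ q (X q) (Y q)) p (Z p)
    - Ψ p (mlieBracket 𝓘(ℝ, E) X Y p) (Z p)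
    + Ψ p (mlieBracket 𝓘(ℝ, E) X Z p) (Y p)
    - Ψ p (mlieBracket 𝓘(ℝ, E) Y Z p) (X p)

variable (E M) in
/-- An almost contact metric structure `(φ, ξ, η, g)` on the smooth manifold `M`. -/
structure AlmostContactMetric [IsManifold 𝓘(ℝ, E) ∞ M] where
  /-- the `(1,1)`-tensor field -/
  φ : ∀ p : M, TangentSpace 𝓘(ℝ, E) p →L[ℝ] TangentSpace 𝓘(ℝ, E) p
  /-- the characteristic vector field -/
  ξ : ∀ p : M, TangentSpace 𝓘(ℝ, E) p
  /-- the `1`-form -/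
  η : ∀ p : M, TangentSpace 𝓘(ℝ, E) p →L[ℝ] ℝ
  /-- the Riemannian metric -/
  g : ContMDiffRiemannianMetric 𝓘(ℝ, E) ∞ E (fun p : M => TangentSpace 𝓘(ℝ, E) p)
  contMDiff_φ : ContMDiff 𝓘(ℝ, E) (𝓘(ℝ, E).prod 𝓘(ℝ, E →L[ℝ] E)) ∞
    (fun p => (TotalSpace.mk' (E →L[ℝ] E) p (φ p) : TotalSpace (E →L[ℝ] E)
      (fun p : M => TangentSpace 𝓘(ℝ, E) p →L[ℝ] TangentSpace 𝓘(ℝ, E) p)))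
  contMDiff_ξ : IsSmoothField ξ
  contMDiff_η : ContMDiff 𝓘(ℝ, E) (𝓘(ℝ, E).prod 𝓘(ℝ, E →L[ℝ] ℝ)) ∞
    (fun p => (TotalSpace.mk' (E →L[ℝ] ℝ) p (η p) : TotalSpace (E →L[ℝ] ℝ)
      (fun p : M => TangentSpace 𝓘(ℝ, E) p →L[ℝ] Bundle.Trivial M ℝ p)))
  φ_sq : ∀ (p : M) (v : TangentSpace 𝓘(ℝ, E) p), φ p (φ p v) = -v + η p v • ξ p
  η_ξ : ∀ p : M, η p (ξ p) = 1
  compatible : ∀ (p : M) (v w : TangentSpace 𝓘(ℝ, E) p),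
    g.inner p (φ p v) (φ p w) = g.inner p v w - η p v * η p w

namespace AlmostContactMetric

variable [IsManifold 𝓘(ℝ, E) ∞ M] (S : AlmostContactMetric E M)

/-- The fundamental `2`-form `Φ(v, w) = g(v, φ w)`. -/
def Φ (p : M) (v w : TangentSpace 𝓘(ℝ, E) p) : ℝ := S.g.inner p v (S.φ p w)

/-- An almost Kenmotsu structure: `dη = 0` and `dΦ = 2 η ∧ Φ`, where
`(η ∧ Φ)(X,Y,Z) = η(X)Φ(Y,Z) + η(Y)Φ(Z,X) + η(Z)Φ(X,Y)`. -/
def IsAlmostKenmotsu : Prop :=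
  (∀ X Y : ∀ p : M, TangentSpace 𝓘(ℝ, E) p, IsSmoothField X → IsSmoothField Y →
    ∀ p, extDerivOne S.η X Y p = 0) ∧
  (∀ X Y Z : ∀ p : M, TangentSpace 𝓘(ℝ, E) p,
    IsSmoothField X → IsSmoothField Y → IsSmoothField Z →
    ∀ p, extDerivTwo S.Φ X Y Z p =
      2 * (S.η p (X p) * S.Φ p (Y p) (Z p) + S.η p (Y p) * S.Φ p (Z p) (X p)
        + S.η p (Z p) * S.Φ p (X p) (Y p)))

theorem mdiffAt_φ {X : ∀ p : M, TangentSpace 𝓘(ℝ, E) p} {p : M} (hX : MDiffAt (T% X) p) :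
    MDiffAt (T% (fun q => S.φ q (X q))) p :=
  MDifferentiableAt.clm_bundle_apply (F₁ := E) (F₂ := E)
    (E₁ := fun p : M => TangentSpace 𝓘(ℝ, E) p) (E₂ := fun p : M => TangentSpace 𝓘(ℝ, E) p)
    (S.contMDiff_φ.mdifferentiableAt (x := p) (by simp)) hX

theorem tensorial_h [CompleteSpace E] (p : M) :
    TensorialAt 𝓘(ℝ, E) E (fun X : ∀ p : M, TangentSpace 𝓘(ℝ, E) p => (1 / 2 : ℝ) •
      (mlieBracket 𝓘(ℝ, E) S.ξ (fun q => S.φ q (X q)) p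
        - S.φ p (mlieBracket 𝓘(ℝ, E) S.ξ X p))) p where
  smul {f X} hf hX := by
    have e : (fun q => S.φ q ((f • X) q)) = f • (fun q => S.φ q (X q)) := by
      ext q; simp
    rw [e, mlieBracket_smul_right hf (S.mdiffAt_φ hX), mlieBracket_smul_right hf hX, map_add,
      map_smul, map_smul]
    module
  add {X X'} hX hX' := by
    have e : (fun q => S.φ q ((X + X') q)) = (fun q => S.φ q (X q)) + fun q => S.φ q (X' q) := by
      ext q; simp
    rw [e, mlieBracket_add_right (S.mdiffAt_φ hX) (S.mdiffAt_φ hX'),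
      mlieBracket_add_right hX hX', map_add]
    module

variable [FiniteDimensional ℝ E]

/-- The `(1,1)`-tensor field `h = ½ 𝓛_ξ φ`, i.e. `h X = ½ ([ξ, φ X] - φ [ξ, X])`. -/
def h (p : M) : TangentSpace 𝓘(ℝ, E) p →L[ℝ] TangentSpace 𝓘(ℝ, E) p :=
  haveI : CompleteSpace E := FiniteDimensional.complete ℝ E
  TensorialAt.mkHom (I := 𝓘(ℝ, E)) (F := E)
    (fun X : ∀ p : M, TangentSpace 𝓘(ℝ, E) p => (1 / 2 : ℝ) •
      (mlieBracket 𝓘(ℝ, E) S.ξ (fun q => S.φ q (X q)) p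
        - S.φ p (mlieBracket 𝓘(ℝ, E) S.ξ X p))) p (S.tensorial_h p)

theorem h_apply {X : ∀ p : M, TangentSpace 𝓘(ℝ, E) p} {p : M} (hX : MDiffAt (T% X) p) :
    S.h p (X p) = (1 / 2 : ℝ) • (mlieBracket 𝓘(ℝ, E) S.ξ (fun q => S.φ q (X q)) p
      - S.φ p (mlieBracket 𝓘(ℝ, E) S.ξ X p)) :=
  haveI : CompleteSpace E := FiniteDimensional.complete ℝ E
  TensorialAt.mkHom_apply (S.tensorial_h p) hX

/-- The `(1,1)`-tensor field `h' = h ∘ φ`. -/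
def h' (p : M) : TangentSpace 𝓘(ℝ, E) p →L[ℝ] TangentSpace 𝓘(ℝ, E) p :=
  (S.h p).comp (S.φ p)

/-- `ξ` belongs to the generalized `(k, μ)'`-nullity distribution:
`R_{XY}ξ = k (η(Y)X - η(X)Y) + μ (η(Y)h'X - η(X)h'Y)` for all vector fields `X, Y`. -/
def GeneralizedNullity' (k μ : M → ℝ) : Prop :=
  ∀ X Y : ∀ p : M, TangentSpace 𝓘(ℝ, E) p, IsSmoothField X → IsSmoothField Y → ∀ p,
    curvature S.g X Y S.ξ p
      = k p • (S.η p (Y p) • X p - S.η p (X p) • Y p)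
        + μ p • (S.η p (Y p) • S.h' p (X p) - S.η p (X p) • S.h' p (Y p))

end AlmostContactMetric

section Coordinates

variable {M : Type*} [TopologicalSpace M] [ChartedSpace (EuclideanSpace ℝ (Fin 3)) M]

/-- The coordinate vector field `∂/∂xⁱ` of the chart `e` (meaningful on `e.source`): the vector
that the differential of `e` maps to the `i`-th standard basis vector. -/
def coordVec (e : OpenPartialHomeomorph M (EuclideanSpace ℝ (Fin 3))) (i : Fin 3) (p : M) :
    TangentSpace 𝓘(ℝ, EuclideanSpace ℝ (Fin 3)) p :=
  mpullback 𝓘(ℝ, EuclideanSpace ℝ (Fin 3)) 𝓘(ℝ, EuclideanSpace ℝ (Fin 3)) e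
    (fun _ => (EuclideanSpace.single i (1 : ℝ) : EuclideanSpace ℝ (Fin 3))) p

/-- The coordinate differential `dxⁱ` of the chart `e` (meaningful on `e.source`). -/
def coordDiff (e : OpenPartialHomeomorph M (EuclideanSpace ℝ (Fin 3))) (i : Fin 3) (p : M) :
    TangentSpace 𝓘(ℝ, EuclideanSpace ℝ (Fin 3)) p →L[ℝ] ℝ :=
  mvfderiv 𝓘(ℝ, EuclideanSpace ℝ (Fin 3)) (fun q => e q i) p

/-- The `(1,1)`-tensor `∑_{i,j=1}^{2} Aⁱ_j dxʲ ⊗ ∂/∂xⁱ` at `p`, applied to `v`. The coordinates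
`x¹, x²` of the chart are those with index `0, 1` in `Fin 3`. -/
def coordEndo (e : OpenPartialHomeomorph M (EuclideanSpace ℝ (Fin 3)))
    (A : Matrix (Fin 2) (Fin 2) ℝ) (p : M) (v : TangentSpace 𝓘(ℝ, EuclideanSpace ℝ (Fin 3)) p) :
    TangentSpace 𝓘(ℝ, EuclideanSpace ℝ (Fin 3)) p :=
  ∑ i : Fin 2, ∑ j : Fin 2, (A i j * coordDiff e j.castSucc p v) • coordVec e i.castSucc p

end Coordinates

end AlmostKenmotsu

end

/-! On an almost Kenmotsu manifold `∇ξ = I - η ⊗ ξ + h'` (`leviCivita_ξ`), so `R_{XY}ξ` involves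
derivatives only through the skew part of `∇h'`, and the nullity condition becomes a Codazzi-type
equation for `h'` (`generalizedNullity'_iff`).

From (a) to (b): with `ξ` as one argument, this equation splits into parts that commute and
anticommute with `φ`, because `∇_ξ φ = 0`. The result is `h'² = -(k+1)(I - η ⊗ ξ)` and `∇_ξ h' =
-(μ+2)h'`. Differentiating the first along `ξ` and using `dk ∧ η = 0` gives `dk = -2(μ+2)(k+1)η`.
This linear equation and `h ≠ 0` force `k + 1 < 0` on the connected manifold, so `F = -½
log(-(k+1))` is a global potential of `(μ+2)η` (`exists_potential`). With `λ = exp(-F)`, `h'` has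
eigenvalues `±λ` on `ker η`. The equation on `ker η` then determines the connection on a unit
eigenframe: `∇X = -(1+λ) g(X,·) ξ` and `∇(φX) = -(1-λ) g(φX,·) ξ` (`leviCivita_eigenField`). Hence,
if `dt = η` and `du = (1+λ)η`, the forms `e^{-u} g(X,·)` and `e^{u-2t} g(φX,·)` are closed. Their
primitives and `t` are the coordinates (`exists_adapted_chart`), and all components are explicit in
`t`, `u(t)` and `f(t)` (`isNormalFormIn`).

From (b) to (a): as the metric coefficients depend on `t` only, `∇_{∂i}∂j` is the multiple `-g(∂j,
∂i + h'∂i)` of `ξ`, and `∇_ξ ∂i = ∂i + h'∂i`. With `B² = λ²` and `B' = -(μ+2)B`, the Codazzi-type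
equation can be checked on the coordinate frame (`generalizedNullity'_of_isNormalFormIn`). -/

noncomputable section

namespace AlmostKenmotsu

/-! ### Extension of vectors to smooth fields, and covariant derivatives of endomorphism fields. -/

section Tensors

variable {E : Type*} [NormedAddCommGroup E] [NormedSpace ℝ E]
  {M : Type*} [TopologicalSpace M] [ChartedSpace E M] [IsManifold 𝓘(ℝ, E) ∞ M]

theorem IsSmoothField.contMDiffAt {X : ∀ p : M, TangentSpace 𝓘(ℝ, E) p}
    (hX : IsSmoothField X) (p : M) : CMDiffAt ∞ (T% X) p := ContMDiff.contMDiffAt hX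

theorem IsSmoothField.mdiffAt {X : ∀ p : M, TangentSpace 𝓘(ℝ, E) p}
    (hX : IsSmoothField X) (p : M) : MDiffAt (T% X) p :=
  (hX.contMDiffAt p).mdifferentiableAt (by simp)

/-- The structure equations are stated for global smooth fields; this lets pointwise tensor
identities be proved with them. A bump function cuts off a local extension of `v`. -/
theorem exists_isSmoothField [FiniteDimensional ℝ E] [T2Space M] (p : M)
    (v : TangentSpace 𝓘(ℝ, E) p) :
    ∃ X : ∀ p : M, TangentSpace 𝓘(ℝ, E) p, IsSmoothField X ∧ X p = v := by
  obtain ⟨s, hs, hsmooth⟩ := FiberBundle.exists_contMDiffOn_extend (k := ∞) 𝓘(ℝ, E) E v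
  obtain ⟨u, hus, huo, hpu⟩ := mem_nhds_iff.1 hs
  obtain ⟨ψ, hψ⟩ := ((SmoothBumpFunction.nhds_basis_tsupport (I := 𝓘(ℝ, E)) p).mem_iff.1
    (huo.mem_nhds hpu))
  refine ⟨(ψ : M → ℝ) • FiberBundle.extend E v, ?_, by simp⟩
  exact ContMDiffOn.smul_section_of_tsupport ψ.contMDiff.contMDiffOn huo hψ.2
    (hsmooth.mono hus)

theorem contMDiffAt_inner
    (g : ContMDiffRiemannianMetric 𝓘(ℝ, E) ∞ E (fun p : M => TangentSpace 𝓘(ℝ, E) p))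
    {X Y : ∀ p : M, TangentSpace 𝓘(ℝ, E) p} {p : M}
    (hX : CMDiffAt ∞ (T% X) p) (hY : CMDiffAt ∞ (T% Y) p) :
    CMDiffAt ∞ (fun q => g.inner q (X q) (Y q)) p := by
  have hg := g.contMDiff.contMDiffAt (x := p)
  have := ContMDiffAt.clm_bundle_apply₂ (F₁ := E) (F₂ := E) (F₃ := ℝ)
    (E₁ := fun p : M => TangentSpace 𝓘(ℝ, E) p) (E₂ := fun p : M => TangentSpace 𝓘(ℝ, E) p)
    (E₃ := Bundle.Trivial M ℝ) hg hX hY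
  simp only [contMDiffAt_totalSpace] at this
  exact this.2

variable (g : ContMDiffRiemannianMetric 𝓘(ℝ, E) ∞ E (fun p : M => TangentSpace 𝓘(ℝ, E) p))

theorem eq_of_forall_inner {p : M} {v w : TangentSpace 𝓘(ℝ, E) p}
    (h : ∀ u, g.inner p v u = g.inner p w u) : v = w := by
  by_contra hne
  have h0 := g.pos p (v - w) (sub_ne_zero.2 hne)
  have e : g.inner p (v - w) = 0 := by ext u; simp [h]
  simp [e] at h0

variable [FiniteDimensional ℝ E]

theorem leviCivita_add {X Y : ∀ p : M, TangentSpace 𝓘(ℝ, E) p} {p : M}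
    (hX : MDiffAt (T% X) p) (hY : MDiffAt (T% Y) p) :
    leviCivita g (X + Y) p = leviCivita g X p + leviCivita g Y p :=
  (leviCivita g).isCovariantDerivativeOnUniv.add hX hY

theorem leviCivita_smul {f : M → ℝ} {X : ∀ p : M, TangentSpace 𝓘(ℝ, E) p} {p : M}
    (hf : MDiffAt f p) (hX : MDiffAt (T% X) p) (v : TangentSpace 𝓘(ℝ, E) p) :
    leviCivita g (f • X) p v = f p • leviCivita g X p v + mvfderiv 𝓘(ℝ, E) f p v • X p := by
  have := (leviCivita g).isCovariantDerivativeOnUniv.leibniz hX hf (Set.mem_univ p)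
  rw [this]
  rfl

theorem leviCivita_congr {X Y : ∀ p : M, TangentSpace 𝓘(ℝ, E) p} {p : M}
    (hX : MDiffAt (T% X) p) (hY : MDiffAt (T% Y) p) (h : ∀ᶠ q in 𝓝 p, X q = Y q) :
    leviCivita g X p = leviCivita g Y p :=
  (leviCivita g).isCovariantDerivativeOnUniv.congr_of_eventuallyEq hX hY univ_mem h

theorem mlieBracket_eq_leviCivita {X Y : ∀ p : M, TangentSpace 𝓘(ℝ, E) p} {p : M}
    (hX : MDiffAt (T% X) p) (hY : MDiffAt (T% Y) p) :
    mlieBracket 𝓘(ℝ, E) X Y p = leviCivita g Y p (X p) - leviCivita g X p (Y p) :=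
  (leviCivita_torsion_free g hX hY).symm

/-- The metric derivative formula with a tangent vector as direction. -/
theorem mvfderiv_inner {X Y : ∀ p : M, TangentSpace 𝓘(ℝ, E) p} {p : M}
    (hX : MDiffAt (T% X) p) (hY : MDiffAt (T% Y) p) (v : TangentSpace 𝓘(ℝ, E) p) :
    mvfderiv 𝓘(ℝ, E) (fun q => g.inner q (X q) (Y q)) p v
      = g.inner p (leviCivita g X p v) (Y p) + g.inner p (X p) (leviCivita g Y p v) := by
  have := leviCivita_metric g (FiberBundle.mdifferentiableAt_extend 𝓘(ℝ, E) E v) hX hY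
  rwa [FiberBundle.extend_apply_self] at this

/-- A field of endomorphisms of the tangent spaces that maps differentiable vector fields to
differentiable vector fields. -/
def IsDiffEndo (A : ∀ p : M, TangentSpace 𝓘(ℝ, E) p →L[ℝ] TangentSpace 𝓘(ℝ, E) p) : Prop :=
  ∀ ⦃X : ∀ p : M, TangentSpace 𝓘(ℝ, E) p⦄ ⦃p : M⦄, MDiffAt (T% X) p →
    MDiffAt (T% (fun q => A q (X q))) p

/-- It is enough to test the differentiability of a field of endomorphisms on smooth vector
fields defined near a point. -/
theorem isDiffEndo_of_contMDiffAt
    {A : ∀ p : M, TangentSpace 𝓘(ℝ, E) p →L[ℝ] TangentSpace 𝓘(ℝ, E) p}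
    (hA : ∀ (X : ∀ p : M, TangentSpace 𝓘(ℝ, E) p) (p : M), CMDiffAt ∞ (T% X) p →
      MDiffAt (T% (fun q => A q (X q))) p) : IsDiffEndo A := by
  intro X p hX
  let t := trivializationAt E (fun p : M => TangentSpace 𝓘(ℝ, E) p) p
  have hp : p ∈ t.baseSet := FiberBundle.mem_baseSet_trivializationAt' p
  let b := Module.finBasis ℝ E
  -- In a smooth local frame the coefficients of `X` are differentiable and `A` acts only on the
  -- frame fields, so a formula for `A` that loses a derivative does no harm.
  have hev : ∀ᶠ q in 𝓝 p, A q (X q)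
      = ∑ i, t.localFrameCoeff 𝓘(ℝ, E) b i q (X q) • A q (t.localFrame b i q) := by
    filter_upwards [t.eventually_eq_localFrame_sum_coeff_smul (I := 𝓘(ℝ, E)) b hp (s := X)]
      with q hq
    conv_lhs => rw [hq]
    simp
  have hsum : MDiffAt (T% (fun q => ∑ i, t.localFrameCoeff 𝓘(ℝ, E) b i q (X q) •
      A q (t.localFrame b i q))) p := by
    refine MDifferentiableAt.sum_section fun i _ => ?_
    exact (mdifferentiableAt_localFrameCoeff b hp hX i).smul_section
      (hA _ _ (contMDiffAt_localFrame_of_mem ∞ _ b i hp))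
  refine hsum.congr_of_eventuallyEq ?_
  filter_upwards [hev] with q hq
  rw [hq]

variable {g} in
-- Under `Y ↦ fY` the two Leibniz terms `df · A Y` cancel.
theorem tensorial_covDerivEndo
    {A : ∀ p : M, TangentSpace 𝓘(ℝ, E) p →L[ℝ] TangentSpace 𝓘(ℝ, E) p} (hA : IsDiffEndo A)
    (p : M) :
    TensorialAt 𝓘(ℝ, E) E (fun Y : ∀ p : M, TangentSpace 𝓘(ℝ, E) p =>
      leviCivita g (fun q => A q (Y q)) p - (A p).comp (leviCivita g Y p)) p where
  smul {f Y} hf hY := by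
    have e : (fun q => A q ((f • Y) q)) = f • fun q => A q (Y q) := by ext q; simp
    ext v
    rw [e]
    simp only [sub_apply, smul_apply,
      ContinuousLinearMap.comp_apply, leviCivita_smul g hf hY, leviCivita_smul g hf (hA hY),
      map_add, map_smul]
    module
  add {Y Y'} hY hY' := by
    have e : (fun q => A q ((Y + Y') q)) = (fun q => A q (Y q)) + fun q => A q (Y' q) := by
      ext q; simp
    rw [e, leviCivita_add g hY hY', leviCivita_add g (hA hY) (hA hY')]
    ext v
    simp only [sub_apply, add_apply,
      ContinuousLinearMap.comp_apply, map_add]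
    module

/-- The covariant derivative `(∇_v A) w` of a differentiable field of endomorphisms, written
`covDerivEndo g hA p w v`. -/
def covDerivEndo {A : ∀ p : M, TangentSpace 𝓘(ℝ, E) p →L[ℝ] TangentSpace 𝓘(ℝ, E) p}
    (hA : IsDiffEndo A) (p : M) :
    TangentSpace 𝓘(ℝ, E) p →L[ℝ] TangentSpace 𝓘(ℝ, E) p →L[ℝ] TangentSpace 𝓘(ℝ, E) p :=
  TensorialAt.mkHom (I := 𝓘(ℝ, E)) (F := E) (fun Y : ∀ p : M, TangentSpace 𝓘(ℝ, E) p =>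
    leviCivita g (fun q => A q (Y q)) p - (A p).comp (leviCivita g Y p)) p
    (tensorial_covDerivEndo hA p)

theorem covDerivEndo_apply
    {A : ∀ p : M, TangentSpace 𝓘(ℝ, E) p →L[ℝ] TangentSpace 𝓘(ℝ, E) p} (hA : IsDiffEndo A)
    {Y : ∀ p : M, TangentSpace 𝓘(ℝ, E) p} {p : M} (hY : MDiffAt (T% Y) p)
    (v : TangentSpace 𝓘(ℝ, E) p) :
    covDerivEndo g hA p (Y p) v
      = leviCivita g (fun q => A q (Y q)) p v - A p (leviCivita g Y p v) := by
  rw [covDerivEndo, TensorialAt.mkHom_apply (tensorial_covDerivEndo hA p) hY]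
  rfl

end Tensors

/-! ### Algebra of almost contact metric structures, the tensors `h` and `h'`, and the formula for
`∇ξ`. -/

namespace AlmostContactMetric

variable {E : Type*} [NormedAddCommGroup E] [NormedSpace ℝ E]
  {M : Type*} [TopologicalSpace M] [ChartedSpace E M] [IsManifold 𝓘(ℝ, E) ∞ M]
  (S : AlmostContactMetric E M)

theorem ξ_ne_zero (p : M) : S.ξ p ≠ 0 := by
  intro h
  have := S.η_ξ p
  simp [h] at this

/-- Since `φ²ξ = 0`, the identity for `φ²` at `φξ` gives `φξ = cξ` with `c = η(φξ)`; then `0 = φ²ξ =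
c²ξ`. -/
theorem φ_ξ (p : M) : S.φ p (S.ξ p) = 0 := by
  have h1 : S.φ p (S.φ p (S.ξ p)) = 0 := by simp [S.φ_sq, S.η_ξ]
  have h2 := S.φ_sq p (S.φ p (S.ξ p))
  rw [h1, map_zero] at h2
  have h3 : S.φ p (S.ξ p) = S.η p (S.φ p (S.ξ p)) • S.ξ p := by
    rw [eq_comm, neg_add_eq_zero] at h2
    exact h2
  have h1 : S.η p (S.φ p (S.ξ p)) * S.η p (S.φ p (S.ξ p)) = 0 := by
    rw [h3, map_smul, h3, smul_smul, smul_eq_zero] at h1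
    have := h1.resolve_right (S.ξ_ne_zero p)
    rwa [← h3] at this
  have h4 : S.η p (S.φ p (S.ξ p)) = 0 :=
    mul_self_eq_zero.1 h1
  rw [h3, h4, zero_smul]

/-- Compare `φ(φ²v)` with `φ²(φv)`. -/
theorem η_φ (p : M) (v : TangentSpace 𝓘(ℝ, E) p) : S.η p (S.φ p v) = 0 := by
  have h1 := S.φ_sq p (S.φ p v)
  rw [S.φ_sq p v, map_add, map_neg, map_smul, S.φ_ξ, smul_zero, add_zero, left_eq_add] at h1
  exact (smul_eq_zero.1 h1).resolve_right (S.ξ_ne_zero p)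

theorem inner_ξ_left (p : M) (v : TangentSpace 𝓘(ℝ, E) p) : S.g.inner p (S.ξ p) v = S.η p v := by
  have := S.compatible p (S.ξ p) v
  rw [S.φ_ξ, S.η_ξ] at this
  simp at this
  linarith

theorem inner_ξ_right (p : M) (v : TangentSpace 𝓘(ℝ, E) p) :
    S.g.inner p v (S.ξ p) = S.η p v := by
  rw [S.g.symm, S.inner_ξ_left]

theorem inner_φ_left (p : M) (v w : TangentSpace 𝓘(ℝ, E) p) :
    S.g.inner p (S.φ p v) w = - S.g.inner p v (S.φ p w) := by
  have := S.compatible p v (S.φ p w)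
  rw [S.φ_sq, S.η_φ, map_add, map_neg, map_smul, S.inner_ξ_right, S.η_φ] at this
  simp at this
  linarith

theorem contMDiffAt_φ {X : ∀ p : M, TangentSpace 𝓘(ℝ, E) p} {p : M}
    (hX : CMDiffAt ∞ (T% X) p) : CMDiffAt ∞ (T% (fun q => S.φ q (X q))) p :=
  ContMDiffAt.clm_bundle_apply (F₁ := E) (F₂ := E)
    (E₁ := fun p : M => TangentSpace 𝓘(ℝ, E) p) (E₂ := fun p : M => TangentSpace 𝓘(ℝ, E) p)
    (S.contMDiff_φ.contMDiffAt (x := p)) hX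

theorem contMDiffAt_η {X : ∀ p : M, TangentSpace 𝓘(ℝ, E) p} {p : M}
    (hX : CMDiffAt ∞ (T% X) p) : CMDiffAt ∞ (fun q => S.η q (X q)) p := by
  have e : (fun q => S.η q (X q)) = fun q => S.g.inner q (S.ξ q) (X q) := by
    ext q; rw [S.inner_ξ_left]
  rw [e]
  exact contMDiffAt_inner S.g (S.contMDiff_ξ.contMDiffAt p) hX

theorem mdiffAt_η {X : ∀ p : M, TangentSpace 𝓘(ℝ, E) p} {p : M}
    (hX : MDiffAt (T% X) p) : MDiffAt (fun q => S.η q (X q)) p := by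
  have e : (fun q => S.η q (X q)) = fun q => S.g.inner q (S.ξ q) (X q) := by
    ext q; rw [S.inner_ξ_left]
  rw [e]
  exact mdiffAt_inner S.g (S.contMDiff_ξ.mdiffAt p) hX

theorem isSmoothField_φ {X : ∀ p : M, TangentSpace 𝓘(ℝ, E) p} (hX : IsSmoothField X) :
    IsSmoothField (fun q => S.φ q (X q)) := fun p => S.contMDiffAt_φ (hX p)

variable {S} in
theorem IsAlmostKenmotsu.η_lie_ξ (hS : S.IsAlmostKenmotsu)
    {X : ∀ p : M, TangentSpace 𝓘(ℝ, E) p} (hX : IsSmoothField X) (p : M) :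
    S.η p (mlieBracket 𝓘(ℝ, E) S.ξ X p)
      = mvfderiv 𝓘(ℝ, E) (fun q => S.η q (X q)) p (S.ξ p) := by
  have := hS.1 S.ξ X S.contMDiff_ξ hX p
  have e : (fun q => S.η q (S.ξ q)) = fun _ => (1 : ℝ) := by ext q; exact S.η_ξ q
  rw [extDerivOne, e, mvfderiv_const] at this
  simp at this
  linarith

variable [FiniteDimensional ℝ E]

theorem contMDiffAt_lie {X Y : ∀ p : M, TangentSpace 𝓘(ℝ, E) p} {p : M}
    (hX : CMDiffAt ∞ (T% X) p) (hY : CMDiffAt ∞ (T% Y) p) :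
    CMDiffAt ∞ (T% (mlieBracket 𝓘(ℝ, E) X Y)) p :=
  haveI : CompleteSpace E := FiniteDimensional.complete ℝ E
  haveI : IsManifold 𝓘(ℝ, E) (minSmoothness ℝ 3) M := by
    rw [minSmoothness_of_isRCLikeNormedField]
    infer_instance
  haveI : IsManifold 𝓘(ℝ, E) (((⊤ : ℕ∞) : ℕ∞ω) + 1) M := inferInstanceAs (IsManifold 𝓘(ℝ, E) ∞ M)
  ContMDiffAt.mlieBracket_vectorField (m := ⊤) (n := ⊤) hX hY (by simp)

theorem contMDiffAt_h {X : ∀ p : M, TangentSpace 𝓘(ℝ, E) p} {p : M}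
    (hX : CMDiffAt ∞ (T% X) p) : CMDiffAt ∞ (T% (fun q => S.h q (X q))) p := by
  have hξ := S.contMDiff_ξ.contMDiffAt p
  have h1 : CMDiffAt ∞ (T% ((1 / 2 : ℝ) • (mlieBracket 𝓘(ℝ, E) S.ξ (fun q => S.φ q (X q))
      - fun q => S.φ q (mlieBracket 𝓘(ℝ, E) S.ξ X q)))) p :=
    ContMDiffAt.const_smul_section ((contMDiffAt_lie hξ (S.contMDiffAt_φ hX)).sub_section
      (S.contMDiffAt_φ (contMDiffAt_lie hξ hX)))
  refine h1.congr_of_eventuallyEq ?_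
  -- The bracket formula for `h` is valid only where `X` is differentiable; class `C¹` at `p`
  -- spreads to a neighbourhood.
  have h2 : CMDiffAt 1 (T% X) p := hX.of_le (by simp)
  filter_upwards [(contMDiffAt_iff_contMDiffAt_nhds (by simp)).1 h2] with q hq
  rw [S.h_apply (hq.mdifferentiableAt (by simp))]
  rfl

theorem contMDiffAt_h' {X : ∀ p : M, TangentSpace 𝓘(ℝ, E) p} {p : M}
    (hX : CMDiffAt ∞ (T% X) p) : CMDiffAt ∞ (T% (fun q => S.h' q (X q))) p :=
  S.contMDiffAt_h (S.contMDiffAt_φ hX)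

theorem isSmoothField_h' {X : ∀ p : M, TangentSpace 𝓘(ℝ, E) p} (hX : IsSmoothField X) :
    IsSmoothField (fun q => S.h' q (X q)) := fun p => S.contMDiffAt_h' (hX p)

theorem isDiffEndo_h' : IsDiffEndo S.h' :=
  isDiffEndo_of_contMDiffAt fun _ _ hX => (S.contMDiffAt_h' hX).mdifferentiableAt (by simp)

theorem h_ξ (p : M) : S.h p (S.ξ p) = 0 := by
  rw [S.h_apply (S.contMDiff_ξ.mdiffAt p)]
  have e : (fun q => S.φ q (S.ξ q)) = 0 := by ext q; simp [S.φ_ξ]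
  rw [e]
  simp

theorem h'_ξ (p : M) : S.h' p (S.ξ p) = 0 := by simp [h', S.φ_ξ]

variable {S}

/-- `dη = 0` gives `η([ξ, φX]) = ξ(η(φX))`, and `η ∘ φ = 0`. -/
theorem IsAlmostKenmotsu.η_h [T2Space M] (hS : S.IsAlmostKenmotsu) (p : M)
    (v : TangentSpace 𝓘(ℝ, E) p) :
    S.η p (S.h p v) = 0 := by
  obtain ⟨X, hX, rfl⟩ := exists_isSmoothField p v
  rw [S.h_apply (hX.mdiffAt p), map_smul, map_sub, S.η_φ, hS.η_lie_ξ (S.isSmoothField_φ hX)]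
  have e : (fun q => S.η q (S.φ q (X q))) = fun _ => (0 : ℝ) := by ext q; exact S.η_φ q _
  rw [e, mvfderiv_const]
  simp

theorem IsAlmostKenmotsu.η_h' [T2Space M] (hS : S.IsAlmostKenmotsu) (p : M)
    (v : TangentSpace 𝓘(ℝ, E) p) :
    S.η p (S.h' p v) = 0 := hS.η_h p _

theorem lie_ξ_φ_φ {X : ∀ p : M, TangentSpace 𝓘(ℝ, E) p} (hX : IsSmoothField X) (p : M) :
    mlieBracket 𝓘(ℝ, E) S.ξ (fun q => S.φ q (S.φ q (X q))) p
      = - mlieBracket 𝓘(ℝ, E) S.ξ X p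
        + mvfderiv 𝓘(ℝ, E) (fun q => S.η q (X q)) p (S.ξ p) • S.ξ p := by
  have : CompleteSpace E := FiniteDimensional.complete ℝ E
  have e : (fun q => S.φ q (S.φ q (X q))) = (-1 : ℝ) • X + (fun q => S.η q (X q)) • S.ξ := by
    ext q; simp [S.φ_sq]
  have hξ := S.contMDiff_ξ.mdiffAt p
  have hη := S.mdiffAt_η (hX.mdiffAt p)
  have hX' : MDiffAt (T% ((-1 : ℝ) • X)) p :=
    (ContMDiffAt.const_smul_section (hX.contMDiffAt p)).mdifferentiableAt (by simp)
  rw [e, mlieBracket_add_right hX' (hη.smul_section hξ),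
    mlieBracket_const_smul_right (hX.mdiffAt p), mlieBracket_smul_right hη hξ]
  simp

/-- This is `𝓛_ξ` applied to `φ² = -I + η ⊗ ξ`: the right side has zero derivative because `𝓛_ξ η =
0` and `[ξ, ξ] = 0`. -/
theorem IsAlmostKenmotsu.h_φ [T2Space M] (hS : S.IsAlmostKenmotsu) (p : M)
    (v : TangentSpace 𝓘(ℝ, E) p) :
    S.h p (S.φ p v) = - S.φ p (S.h p v) := by
  obtain ⟨X, hX, rfl⟩ := exists_isSmoothField p v
  rw [S.h_apply (hX.mdiffAt p), S.h_apply (X := fun q => S.φ q (X q))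
    ((S.isSmoothField_φ hX).mdiffAt p), lie_ξ_φ_φ hX, map_smul, map_sub, S.φ_sq, hS.η_lie_ξ hX]
  module

theorem IsAlmostKenmotsu.h'_φ [T2Space M] (hS : S.IsAlmostKenmotsu) (p : M)
    (v : TangentSpace 𝓘(ℝ, E) p) :
    S.h' p (S.φ p v) = - S.φ p (S.h' p v) := hS.h_φ p _

/-- `𝓛_ξ g = 2 (g - η ⊗ η + g(·, h' ·))`. -/
theorem IsAlmostKenmotsu.lie_ξ_inner (hS : S.IsAlmostKenmotsu)
    {Y Z : ∀ p : M, TangentSpace 𝓘(ℝ, E) p} (hY : IsSmoothField Y) (hZ : IsSmoothField Z) (p : M) :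
    mvfderiv 𝓘(ℝ, E) (fun q => S.g.inner q (Y q) (Z q)) p (S.ξ p)
      - S.g.inner p (mlieBracket 𝓘(ℝ, E) S.ξ Y p) (Z p)
      - S.g.inner p (mlieBracket 𝓘(ℝ, E) S.ξ Z p) (Y p)
      = 2 * S.g.inner p (Y p) (Z p) - 2 * (S.η p (Y p) * S.η p (Z p))
        + 2 * S.g.inner p (S.h' p (Z p)) (Y p) := by
  have hφZ := S.isSmoothField_φ hZ
  -- With `φZ` as third argument, `Φ(Y, φZ) = -g(Y, Z) + η(Y)η(Z)`, so `dΦ = 2η ∧ Φ` becomes a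
  -- statement about the derivative of the metric along `ξ`.
  have h1 := hS.2 S.ξ Y (fun q => S.φ q (Z q)) S.contMDiff_ξ hY hφZ p
  have e1 : (fun q => S.Φ q (S.ξ q) (S.φ q (Z q))) = fun _ => (0 : ℝ) := by
    ext q; simp [Φ, S.inner_ξ_left, S.η_φ]
  have e2 : (fun q => S.Φ q (S.ξ q) (Y q)) = fun _ => (0 : ℝ) := by
    ext q; simp [Φ, S.inner_ξ_left, S.η_φ]
  have e3 : (fun q => S.Φ q (Y q) (S.φ q (Z q)))
      = -(fun q => S.g.inner q (Y q) (Z q)) + (fun q => S.η q (Y q)) * fun q => S.η q (Z q) := by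
    ext q; simp [Φ, S.φ_sq, S.inner_ξ_right, mul_comm]
  have h2 : S.φ p (mlieBracket 𝓘(ℝ, E) S.ξ (fun q => S.φ q (Z q)) p)
      = - mlieBracket 𝓘(ℝ, E) S.ξ Z p
        + mvfderiv 𝓘(ℝ, E) (fun q => S.η q (Z q)) p (S.ξ p) • S.ξ p
        - (2 : ℝ) • S.h' p (Z p) := by
    have := S.h_apply (X := fun q => S.φ q (Z q)) (hφZ.mdiffAt p)
    rw [lie_ξ_φ_φ hZ] at this
    change S.h' p (Z p) = _ at this
    rw [this]
    module
  have h3 : S.Φ p (mlieBracket 𝓘(ℝ, E) S.ξ (fun q => S.φ q (Z q)) p) (Y p)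
      = S.g.inner p (mlieBracket 𝓘(ℝ, E) S.ξ Z p) (Y p)
        - mvfderiv 𝓘(ℝ, E) (fun q => S.η q (Z q)) p (S.ξ p) * S.η p (Y p)
        + 2 * S.g.inner p (S.h' p (Z p)) (Y p) := by
    have : S.Φ p (mlieBracket 𝓘(ℝ, E) S.ξ (fun q => S.φ q (Z q)) p) (Y p)
      = - S.g.inner p (S.φ p (mlieBracket 𝓘(ℝ, E) S.ξ (fun q => S.φ q (Z q)) p)) (Y p) := by
      rw [S.inner_φ_left, neg_neg, Φ]
    rw [this, h2]
    simp [S.inner_ξ_left]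
    ring
  have h4 := hS.η_lie_ξ hY p
  rw [extDerivTwo, e1, e2, e3, mvfderiv_add (mdiffAt_inner S.g (hY.mdiffAt p)
    (hZ.mdiffAt p)).neg ((S.mdiffAt_η (hY.mdiffAt p)).mul (S.mdiffAt_η (hZ.mdiffAt p))),
    mvfderiv_neg, mvfderiv_mul (S.mdiffAt_η (hY.mdiffAt p)) (S.mdiffAt_η (hZ.mdiffAt p)),
    mvfderiv_const, h3] at h1
  simp [Φ, S.φ_sq, S.inner_ξ_left, S.inner_ξ_right, S.φ_ξ, S.η_φ, S.η_ξ, h4] at h1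
  linarith

/-- All other terms in the formula for `𝓛_ξ g` are symmetric in the two fields. -/
theorem IsAlmostKenmotsu.inner_h' [T2Space M] (hS : S.IsAlmostKenmotsu) (p : M)
    (v w : TangentSpace 𝓘(ℝ, E) p) :
    S.g.inner p (S.h' p v) w = S.g.inner p v (S.h' p w) := by
  obtain ⟨Y, hY, rfl⟩ := exists_isSmoothField p v
  obtain ⟨Z, hZ, rfl⟩ := exists_isSmoothField p w
  have h1 := hS.lie_ξ_inner hY hZ p
  have h2 := hS.lie_ξ_inner hZ hY p
  have e : (fun q => S.g.inner q (Z q) (Y q)) = fun q => S.g.inner q (Y q) (Z q) := by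
    ext q; exact S.g.symm q _ _
  rw [e, S.g.symm p (Z p) (Y p)] at h2
  rw [S.g.symm p (Y p) (S.h' p (Z p))]
  linarith

/-- `∇ξ = I - η ⊗ ξ + h'`. -/
theorem IsAlmostKenmotsu.leviCivita_ξ [T2Space M] (hS : S.IsAlmostKenmotsu) (p : M)
    (v : TangentSpace 𝓘(ℝ, E) p) :
    leviCivita S.g S.ξ p v = v - S.η p v • S.ξ p + S.h' p v := by
  obtain ⟨Y, hY, rfl⟩ := exists_isSmoothField p v
  apply eq_of_forall_inner S.g
  intro u
  obtain ⟨Z, hZ, rfl⟩ := exists_isSmoothField p u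
  -- The Koszul formula here reads `2 g(∇_Y ξ, Z) = (𝓛_ξ g)(Y, Z) + dη(Y, Z)`.
  have h0 := leviCivita_koszul S.g (hY.mdiffAt p) (S.contMDiff_ξ.mdiffAt p) (hZ.mdiffAt p)
  have h1 := hS.lie_ξ_inner hY hZ p
  have h2 := hS.1 Y Z hY hZ p
  have e1 : (fun q => S.g.inner q (S.ξ q) (Z q)) = fun q => S.η q (Z q) := by
    ext q; exact S.inner_ξ_left q _
  have e2 : (fun q => S.g.inner q (Y q) (S.ξ q)) = fun q => S.η q (Y q) := by
    ext q; exact S.inner_ξ_right q _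
  rw [koszul, e1, e2, mlieBracket_swap_apply (V := Y) (W := S.ξ), S.inner_ξ_right] at h0
  rw [extDerivOne] at h2
  rw [hS.inner_h', S.g.symm] at h1
  simp only [map_neg, neg_apply] at h0
  simp only [map_add, map_sub, map_smul, add_apply, sub_apply, smul_apply, S.inner_ξ_left,
    smul_eq_mul]
  rw [hS.inner_h']
  rw [← hS.inner_h', S.g.symm, hS.inner_h', S.g.symm p (Z p), hS.inner_h'] at h1
  linarith

end AlmostContactMetric

namespace AlmostContactMetric

/-! ### The curvature `R_{XY}ξ` and the consequences of the nullity condition for `h'` and `k`. -/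

section Curvature

variable {E : Type*} [NormedAddCommGroup E] [NormedSpace ℝ E] [FiniteDimensional ℝ E]
  {M : Type*} [TopologicalSpace M] [ChartedSpace E M] [IsManifold 𝓘(ℝ, E) ∞ M]
  (S : AlmostContactMetric E M)

/-- The covariant derivative `(∇_v h') w`, written `S.covDeriv_h' p w v`. -/
def covDeriv_h' (p : M) :
    TangentSpace 𝓘(ℝ, E) p →L[ℝ] TangentSpace 𝓘(ℝ, E) p →L[ℝ] TangentSpace 𝓘(ℝ, E) p :=
  covDerivEndo S.g S.isDiffEndo_h' p

theorem covDeriv_h'_apply {Y : ∀ p : M, TangentSpace 𝓘(ℝ, E) p} {p : M} (hY : MDiffAt (T% Y) p)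
    (v : TangentSpace 𝓘(ℝ, E) p) :
    S.covDeriv_h' p (Y p) v
      = leviCivita S.g (fun q => S.h' q (Y q)) p v - S.h' p (leviCivita S.g Y p v) :=
  covDerivEndo_apply S.g S.isDiffEndo_h' hY v

variable {S} [T2Space M]

namespace IsAlmostKenmotsu

theorem leviCivita_leviCivita_ξ (hS : S.IsAlmostKenmotsu)
    {Y : ∀ p : M, TangentSpace 𝓘(ℝ, E) p} {p : M} (hY : MDiffAt (T% Y) p)
    (v : TangentSpace 𝓘(ℝ, E) p) :
    leviCivita S.g (fun q => leviCivita S.g S.ξ q (Y q)) p v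
      = leviCivita S.g Y p v - S.η p (Y p) • leviCivita S.g S.ξ p v
        - mvfderiv 𝓘(ℝ, E) (fun q => S.η q (Y q)) p v • S.ξ p
        + leviCivita S.g (fun q => S.h' q (Y q)) p v := by
  have e : (fun q => leviCivita S.g S.ξ q (Y q))
      = Y + (-(fun q => S.η q (Y q))) • S.ξ + fun q => S.h' q (Y q) := by
    ext q
    simp [hS.leviCivita_ξ, sub_eq_add_neg]
  have hξ := S.contMDiff_ξ.mdiffAt p
  have hη : MDiffAt (-(fun q => S.η q (Y q))) p := (S.mdiffAt_η hY).neg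
  have h1 : MDiffAt (T% ((-(fun q => S.η q (Y q))) • S.ξ)) p := hη.smul_section hξ
  rw [e, leviCivita_add S.g (mdifferentiableAt_add_section hY h1) (S.isDiffEndo_h' hY),
    leviCivita_add S.g hY h1, add_apply, add_apply, leviCivita_smul S.g hη hξ, mvfderiv_neg]
  simp only [Pi.neg_apply, neg_apply]
  module

/-- On substituting the formula for `∇ξ`, the terms in `∇_X Y - ∇_Y X` cancel with `[X, Y]`, and the
derivatives of `η(X)` and `η(Y)` cancel by `dη = 0`. Only the skew part of `∇h'` keeps derivatives.
-/
theorem curvature_ξ (hS : S.IsAlmostKenmotsu) {X Y : ∀ p : M, TangentSpace 𝓘(ℝ, E) p}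
    (hX : IsSmoothField X) (hY : IsSmoothField Y) (p : M) :
    curvature S.g X Y S.ξ p
      = S.η p (X p) • (Y p + S.h' p (Y p)) - S.η p (Y p) • (X p + S.h' p (X p))
        + (S.covDeriv_h' p (Y p) (X p) - S.covDeriv_h' p (X p) (Y p)) := by
  have h1 := hS.1 X Y hX hY p
  have hb := mlieBracket_eq_leviCivita S.g (hX.mdiffAt p) (hY.mdiffAt p)
  rw [curvature, hS.leviCivita_leviCivita_ξ (hX.mdiffAt p),
    hS.leviCivita_leviCivita_ξ (hY.mdiffAt p), S.covDeriv_h'_apply (hX.mdiffAt p),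
    S.covDeriv_h'_apply (hY.mdiffAt p), hS.leviCivita_ξ, hS.leviCivita_ξ, hS.leviCivita_ξ]
  rw [extDerivOne] at h1
  have h2 : S.η p (mlieBracket 𝓘(ℝ, E) X Y p) = mvfderiv 𝓘(ℝ, E) (fun q => S.η q (Y q)) p (X p)
    - mvfderiv 𝓘(ℝ, E) (fun q => S.η q (X q)) p (Y p) := by linarith
  rw [h2, hb, map_sub (S.h' p)]
  module

/-- The nullity condition as a condition on the covariant derivative of `h'`. -/
theorem generalizedNullity'_iff (hS : S.IsAlmostKenmotsu) (k μ : M → ℝ) :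
    S.GeneralizedNullity' k μ ↔ ∀ (p : M) (v w : TangentSpace 𝓘(ℝ, E) p),
      S.covDeriv_h' p w v - S.covDeriv_h' p v w
        = (k p + 1) • (S.η p w • v - S.η p v • w)
          + (μ p + 1) • (S.η p w • S.h' p v - S.η p v • S.h' p w) := by
  constructor
  · intro h p v w
    obtain ⟨X, hX, rfl⟩ := exists_isSmoothField p v
    obtain ⟨Y, hY, rfl⟩ := exists_isSmoothField p w
    have h1 := h X Y hX hY p
    rw [hS.curvature_ξ hX hY] at h1
    rw [← eq_sub_iff_add_eq'] at h1
    rw [h1]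
    module
  · intro h X Y hX hY p
    rw [hS.curvature_ξ hX hY, h]
    module

theorem leviCivita_ξ_ξ (hS : S.IsAlmostKenmotsu) (p : M) :
    leviCivita S.g S.ξ p (S.ξ p) = 0 := by
  rw [hS.leviCivita_ξ, S.η_ξ, S.h'_ξ]
  simp

theorem lie_ξ (hS : S.IsAlmostKenmotsu) {X : ∀ p : M, TangentSpace 𝓘(ℝ, E) p} {p : M}
    (hX : MDiffAt (T% X) p) :
    mlieBracket 𝓘(ℝ, E) S.ξ X p
      = leviCivita S.g X p (S.ξ p) - (X p - S.η p (X p) • S.ξ p + S.h' p (X p)) := by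
  rw [mlieBracket_eq_leviCivita S.g (S.contMDiff_ξ.mdiffAt p) hX, hS.leviCivita_ξ]

theorem φ_h' (hS : S.IsAlmostKenmotsu) (p : M) (v : TangentSpace 𝓘(ℝ, E) p) :
    S.φ p (S.h' p v) = S.h p v := by
  have h1 : S.h' p (S.φ p v) = - S.h p v := by
    change S.h p (S.φ p (S.φ p v)) = _
    simp [S.φ_sq, S.h_ξ]
  rw [hS.h'_φ] at h1
  exact neg_injective h1

/-- `∇_ξ φ = 0`. -/
theorem leviCivita_φ_ξ (hS : S.IsAlmostKenmotsu) {X : ∀ p : M, TangentSpace 𝓘(ℝ, E) p} {p : M}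
    (hX : MDiffAt (T% X) p) :
    leviCivita S.g (fun q => S.φ q (X q)) p (S.ξ p) = S.φ p (leviCivita S.g X p (S.ξ p)) := by
  have h1 := S.h_apply hX
  -- Written with `∇`, the bracket expression `[ξ, φX] - φ[ξ, X]` is `(∇_ξ φ)X + 2φh'X`, and `φh' =
  -- h` already accounts for all of `2hX`.
  rw [hS.lie_ξ hX, hS.lie_ξ (S.mdiffAt_φ hX), hS.h'_φ, S.η_φ] at h1
  simp only [map_sub, map_add, map_smul, S.φ_ξ, hS.φ_h'] at h1
  have h2 : (1 / 2 : ℝ) • (leviCivita S.g (fun q => S.φ q (X q)) p (S.ξ p)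
      - S.φ p (leviCivita S.g X p (S.ξ p))) = 0 := by
    rw [← sub_eq_zero] at h1
    rw [← neg_eq_zero, ← h1]
    module
  rw [smul_eq_zero, sub_eq_zero] at h2
  exact h2.resolve_left (by norm_num)

/-- As `φ` is parallel along `ξ`, the relation `h'φ = -φh'` passes to `∇_ξ h'`. -/
theorem covDeriv_h'_φ_ξ (hS : S.IsAlmostKenmotsu) (p : M) (v : TangentSpace 𝓘(ℝ, E) p) :
    S.covDeriv_h' p (S.φ p v) (S.ξ p) = - S.φ p (S.covDeriv_h' p v (S.ξ p)) := by
  obtain ⟨X, hX, rfl⟩ := exists_isSmoothField p v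
  have hX' := hX.mdiffAt p
  have e : (fun q => S.h' q (S.φ q (X q))) = (-1 : ℝ) • fun q => S.φ q (S.h' q (X q)) := by
    ext q
    simp [hS.h'_φ]
  rw [S.covDeriv_h'_apply hX', S.covDeriv_h'_apply (Y := fun q => S.φ q (X q)) (S.mdiffAt_φ hX'),
    e, (leviCivita S.g).isCovariantDerivativeOnUniv.smul_const _
      (S.mdiffAt_φ (S.isDiffEndo_h' hX')), smul_apply, hS.leviCivita_φ_ξ hX',
    hS.leviCivita_φ_ξ (S.isDiffEndo_h' hX'), hS.h'_φ, map_sub]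
  module

/-- Differentiate `h'ξ = 0`: what remains is `-h'(∇_v ξ)`. -/
theorem covDeriv_h'_ξ (hS : S.IsAlmostKenmotsu) (p : M) (v : TangentSpace 𝓘(ℝ, E) p) :
    S.covDeriv_h' p (S.ξ p) v = - S.h' p v - S.h' p (S.h' p v) := by
  have e : (fun q => S.h' q (S.ξ q)) = 0 := by ext q; simp [S.h'_ξ]
  rw [S.covDeriv_h'_apply (S.contMDiff_ξ.mdiffAt p), e, hS.leviCivita_ξ]
  simp [S.h'_ξ]
  abel

section Nullity

variable {k μ : M → ℝ}

/-- The nullity condition with one argument `ξ` expresses `∇_ξ h'` by `I - η ⊗ ξ`, `h'` and `h'²`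
(`key`). Both `∇_ξ h'` and `h'` anticommute with `φ`, while the other two terms commute with it. So
the commuting part `(k+1)(I - η ⊗ ξ) + h'²` vanishes. -/
theorem h'_h' (hS : S.IsAlmostKenmotsu) (hN : S.GeneralizedNullity' k μ) (p : M)
    (v : TangentSpace 𝓘(ℝ, E) p) :
    S.h' p (S.h' p v) = -(k p + 1) • (v - S.η p v • S.ξ p) := by
  have key : ∀ u : TangentSpace 𝓘(ℝ, E) p, S.covDeriv_h' p u (S.ξ p)
      = -((k p + 1) • (u - S.η p u • S.ξ p)) - (μ p + 2) • S.h' p u - S.h' p (S.h' p u) := by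
    intro u
    have := (hS.generalizedNullity'_iff k μ).1 hN p u (S.ξ p)
    rw [hS.covDeriv_h'_ξ, S.η_ξ, S.h'_ξ] at this
    linear_combination (norm := module) (-1 : ℝ) • this
  have h1 := key (S.φ p v)
  rw [hS.covDeriv_h'_φ_ξ, key v, hS.h'_φ, map_neg (S.h' p), hS.h'_φ, S.η_φ] at h1
  simp only [map_sub, map_neg, map_smul, S.φ_ξ] at h1
  have h2 : (k p + 1) • S.φ p v + S.φ p (S.h' p (S.h' p v)) = 0 := by
    linear_combination (norm := module) (1 / 2 : ℝ) • h1
  have h3 := congrArg (S.φ p) h2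
  rw [map_add, map_smul, S.φ_sq, S.φ_sq, hS.η_h', map_zero] at h3
  linear_combination (norm := module) (-1 : ℝ) • h3

theorem covDeriv_h'_apply_ξ (hS : S.IsAlmostKenmotsu) (hN : S.GeneralizedNullity' k μ) (p : M)
    (v : TangentSpace 𝓘(ℝ, E) p) :
    S.covDeriv_h' p v (S.ξ p) = -(μ p + 2) • S.h' p v := by
  have := (hS.generalizedNullity'_iff k μ).1 hN p v (S.ξ p)
  rw [hS.covDeriv_h'_ξ, S.η_ξ, S.h'_ξ, hS.h'_h' hN] at this
  linear_combination (norm := module) (-1 : ℝ) • this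

theorem inner_h'_h' (hS : S.IsAlmostKenmotsu) (hN : S.GeneralizedNullity' k μ) (p : M)
    (v : TangentSpace 𝓘(ℝ, E) p) :
    S.g.inner p (S.h' p v) (S.h' p v)
      = -(k p + 1) * (S.g.inner p v v - S.η p v * S.η p v) := by
  rw [hS.inner_h', hS.h'_h' hN]
  simp [S.inner_ξ_right]

/-- Differentiate `h'² = -(k+1)(I - η ⊗ ξ)` along `ξ` with `∇_ξ h' = -(μ+2)h'`, and pair the result
with a nonzero vector of `ker η`; the dimension bound provides that vector. -/
theorem mvfderiv_k_ξ (hS : S.IsAlmostKenmotsu) (hN : S.GeneralizedNullity' k μ) {p : M}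
    (hk : MDiffAt k p) (hE : 1 < Module.finrank ℝ E) :
    mvfderiv 𝓘(ℝ, E) k p (S.ξ p) = -2 * (μ p + 2) * (k p + 1) := by
  have : FiniteDimensional ℝ (TangentSpace 𝓘(ℝ, E) p) := inferInstanceAs (FiniteDimensional ℝ E)
  obtain ⟨v, hv, hv0⟩ : ∃ v : TangentSpace 𝓘(ℝ, E) p, S.η p v = 0 ∧ v ≠ 0 := by
    have hne : LinearMap.ker (S.η p).toLinearMap ≠ ⊥ :=
      LinearMap.ker_ne_bot_of_finrank_lt (by rw [Module.finrank_self]; exact hE)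
    exact (Submodule.ne_bot_iff _).1 hne
  obtain ⟨X, hX, rfl⟩ := exists_isSmoothField p v
  have hX' := hX.mdiffAt p
  have hξ := S.contMDiff_ξ.mdiffAt p
  have hk' : MDiffAt (-(k + 1)) p := (hk.add mdifferentiableAt_const).neg
  have hη : MDiffAt (-(fun q => S.η q (X q))) p := (S.mdiffAt_η hX').neg
  have e : (fun q => S.h' q (S.h' q (X q)))
      = (-(k + 1)) • (X + (-(fun q => S.η q (X q))) • S.ξ) := by
    ext q
    simp [hS.h'_h' hN, sub_eq_add_neg]
  have h1 := S.covDeriv_h'_apply (S.isDiffEndo_h' hX') (S.ξ p)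
  have h2 := S.covDeriv_h'_apply hX' (S.ξ p)
  have h3 : MDiffAt (T% ((-(fun q => S.η q (X q))) • S.ξ)) p := hη.smul_section hξ
  have h4 : mvfderiv 𝓘(ℝ, E) (-(k + 1)) p (S.ξ p) = - mvfderiv 𝓘(ℝ, E) k p (S.ξ p) := by
    have h1 : MDiffAt (fun _ : M => (1 : ℝ)) p := mdifferentiableAt_const
    change mvfderiv 𝓘(ℝ, E) (-(k + fun _ => (1 : ℝ))) p (S.ξ p) = _
    rw [mvfderiv_neg, mvfderiv_add hk h1, mvfderiv_const]
    simp
  rw [hS.covDeriv_h'_apply_ξ hN, e, leviCivita_smul S.g hk' (mdifferentiableAt_add_section hX' h3),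
    leviCivita_add S.g hX' h3, add_apply, leviCivita_smul S.g hη hξ, hS.leviCivita_ξ_ξ,
    h4] at h1
  rw [hS.covDeriv_h'_apply_ξ hN] at h2
  have h5 := congrArg (S.h' p) h2
  rw [map_sub, map_smul, hS.h'_h' hN, hS.h'_h' hN] at h5
  rw [hS.h'_h' hN] at h1
  have h6 := congrArg (fun w => S.g.inner p w (X p)) h1
  have h7 := congrArg (fun w => S.g.inner p w (X p)) h5
  have hpos := S.g.pos p (X p) hv0
  simp [S.inner_ξ_left, hv] at h6 h7
  have h8 : S.g.inner p (X p) (X p) * (mvfderiv 𝓘(ℝ, E) k p (S.ξ p)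
      - (-2 * (μ p + 2) * (k p + 1))) = 0 := by linarith
  exact sub_eq_zero.1 ((mul_eq_zero.1 h8).resolve_left hpos.ne')

end Nullity

end IsAlmostKenmotsu

end Curvature

end AlmostContactMetric

/-! ### Constant fields in a chart and local primitives of closed `1`-forms. -/

section Charts

variable {E : Type*} [NormedAddCommGroup E] [NormedSpace ℝ E]
  {M : Type*} [TopologicalSpace M] [ChartedSpace E M]
  {e : OpenPartialHomeomorph M E}

/-- The vector field on the domain of the chart `e` which is the constant field `v` in the
coordinates given by `e`. -/
def coordField (e : OpenPartialHomeomorph M E) (v : E) (p : M) : TangentSpace 𝓘(ℝ, E) p :=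
  mpullback 𝓘(ℝ, E) 𝓘(ℝ, E) e (fun _ => v) p

theorem mdifferentiable_of_mem_maximalAtlas (he : e ∈ IsManifold.maximalAtlas 𝓘(ℝ, E) ∞ M) :
    e.MDifferentiable 𝓘(ℝ, E) 𝓘(ℝ, E) :=
  ⟨(contMDiffOn_of_mem_maximalAtlas he).mdifferentiableOn (by simp),
    (contMDiffOn_symm_of_mem_maximalAtlas he).mdifferentiableOn (by simp)⟩

theorem mvfderiv_congr {F G : M → ℝ} {q : M} (h : F =ᶠ[𝓝 q] G) :
    mvfderiv 𝓘(ℝ, E) F q = mvfderiv 𝓘(ℝ, E) G q := by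
  ext w
  change mfderiv 𝓘(ℝ, E) 𝓘(ℝ, ℝ) F q w = mfderiv 𝓘(ℝ, E) 𝓘(ℝ, ℝ) G q w
  rw [h.mfderiv_eq]
  rfl

theorem contDiffOn_comp_symm (he : e ∈ IsManifold.maximalAtlas 𝓘(ℝ, E) ∞ M) {U : Set M}
    {F : M → ℝ} (hF : ∀ q ∈ U, CMDiffAt ∞ F q) :
    ContDiffOn ℝ ∞ (F ∘ e.symm) (e.target ∩ e.symm ⁻¹' U) := by
  intro x hx
  have h1 : CMDiffAt ∞ (F ∘ e.symm) x :=
    ContMDiffAt.comp x (hF _ hx.2) (contMDiffAt_symm_of_mem_maximalAtlas he hx.1)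
  exact h1.contDiffAt.contDiffWithinAt

theorem isInvertible_mfderiv_chart (he : e ∈ IsManifold.maximalAtlas 𝓘(ℝ, E) ∞ M) {q : M}
    (hq : q ∈ e.source) : (mfderiv 𝓘(ℝ, E) 𝓘(ℝ, E) e q).IsInvertible :=
  ⟨(mdifferentiable_of_mem_maximalAtlas he).mfderiv hq, rfl⟩

theorem mfderiv_coordField (he : e ∈ IsManifold.maximalAtlas 𝓘(ℝ, E) ∞ M) {q : M}
    (hq : q ∈ e.source) (v : E) :
    mfderiv 𝓘(ℝ, E) 𝓘(ℝ, E) e q (coordField e v q) = v :=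
  (isInvertible_mfderiv_chart he hq).self_apply_inverse v

theorem coordField_mfderiv (he : e ∈ IsManifold.maximalAtlas 𝓘(ℝ, E) ∞ M) {q : M}
    (hq : q ∈ e.source) (w : TangentSpace 𝓘(ℝ, E) q) :
    coordField e (mfderiv 𝓘(ℝ, E) 𝓘(ℝ, E) e q w) q = w :=
  (isInvertible_mfderiv_chart he hq).inverse_apply_self w

theorem differentiableAt_comp_symm (he : e ∈ IsManifold.maximalAtlas 𝓘(ℝ, E) ∞ M) {q : M}
    (hq : q ∈ e.source) {F : M → ℝ} (hF : MDiffAt F q) :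
    DifferentiableAt ℝ (F ∘ e.symm) (e q) := by
  have h1 : MDiffAt e.symm (e q) :=
    (mdifferentiable_of_mem_maximalAtlas he).mdifferentiableAt_symm (e.map_source hq)
  have h2 : MDiffAt (F ∘ e.symm) (e q) :=
    MDifferentiableAt.comp (e q) (by rwa [e.left_inv hq]) h1
  exact h2.differentiableAt

theorem mvfderiv_comp_chart (he : e ∈ IsManifold.maximalAtlas 𝓘(ℝ, E) ∞ M) {q : M}
    (hq : q ∈ e.source) {G : E → ℝ} (hG : DifferentiableAt ℝ G (e q))
    (w : TangentSpace 𝓘(ℝ, E) q) :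
    mvfderiv 𝓘(ℝ, E) (G ∘ e) q w = fderiv ℝ G (e q) (mfderiv 𝓘(ℝ, E) 𝓘(ℝ, E) e q w) := by
  rw [mvfderiv_comp_apply q hG.mdifferentiableAt
    ((mdifferentiable_of_mem_maximalAtlas he).mdifferentiableAt hq)]
  change mfderiv 𝓘(ℝ, E) 𝓘(ℝ, ℝ) G (e q) _ = _
  rw [mfderiv_eq_fderiv]
  rfl

theorem fderiv_comp_symm (he : e ∈ IsManifold.maximalAtlas 𝓘(ℝ, E) ∞ M) {q : M}
    (hq : q ∈ e.source) {F : M → ℝ} (hF : MDiffAt F q) (v : E) :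
    fderiv ℝ (F ∘ e.symm) (e q) v = mvfderiv 𝓘(ℝ, E) F q (coordField e v q) := by
  have h1 := mvfderiv_comp_chart he hq (differentiableAt_comp_symm he hq hF) (coordField e v q)
  rw [mfderiv_coordField he hq] at h1
  rw [← h1]
  congr 1
  apply mvfderiv_congr
  filter_upwards [e.open_source.mem_nhds hq] with y hy
  simp [e.left_inv hy]

variable [IsManifold 𝓘(ℝ, E) ∞ M]

variable (g : ContMDiffRiemannianMetric 𝓘(ℝ, E) ∞ E (fun p : M => TangentSpace 𝓘(ℝ, E) p))

/-- The `1`-form `c g(X, ·)` in the coordinates given by `e`. -/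
def chartForm (e : OpenPartialHomeomorph M E) (c : M → ℝ)
    (X : ∀ p : M, TangentSpace 𝓘(ℝ, E) p) (x : E) : E →L[ℝ] ℝ :=
  c (e.symm x) • (g.inner (e.symm x) (X (e.symm x))).comp
    (mfderiv 𝓘(ℝ, E) 𝓘(ℝ, E) e (e.symm x)).inverse

theorem chartForm_apply_mfderiv (he : e ∈ IsManifold.maximalAtlas 𝓘(ℝ, E) ∞ M) {q : M}
    (hq : q ∈ e.source) (c : M → ℝ) (X : ∀ p : M, TangentSpace 𝓘(ℝ, E) p)
    (w : TangentSpace 𝓘(ℝ, E) q) :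
    chartForm g e c X (e q) (mfderiv 𝓘(ℝ, E) 𝓘(ℝ, E) e q w) = c q * g.inner q (X q) w := by
  have h1 : chartForm g e c X (e q) (mfderiv 𝓘(ℝ, E) 𝓘(ℝ, E) e q w)
      = c (e.symm (e q)) * g.inner (e.symm (e q)) (X (e.symm (e q)))
        (coordField e (mfderiv 𝓘(ℝ, E) 𝓘(ℝ, E) e q w) (e.symm (e q))) := rfl
  rw [h1, e.left_inv hq, coordField_mfderiv he hq]

variable [FiniteDimensional ℝ E]

theorem contMDiffAt_coordField (he : e ∈ IsManifold.maximalAtlas 𝓘(ℝ, E) ∞ M) {q : M}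
    (hq : q ∈ e.source) (v : E) : CMDiffAt ∞ (T% (coordField e v)) q := by
  have : CompleteSpace E := FiniteDimensional.complete ℝ E
  refine ContMDiffAt.mpullback_vectorField_preimage (n := ∞) ?_
    (contMDiffAt_of_mem_maximalAtlas he hq) (isInvertible_mfderiv_chart he hq) (by simp)
  exact contMDiffAt_vectorSpace_iff_contDiffAt.2 contDiffAt_const

theorem mdiffAt_coordField (he : e ∈ IsManifold.maximalAtlas 𝓘(ℝ, E) ∞ M) {q : M}
    (hq : q ∈ e.source) (v : E) : MDiffAt (T% (coordField e v)) q :=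
  (contMDiffAt_coordField he hq v).mdifferentiableAt (by simp)

theorem mlieBracket_coordField (he : e ∈ IsManifold.maximalAtlas 𝓘(ℝ, E) ∞ M) {q : M}
    (hq : q ∈ e.source) (v w : E) :
    mlieBracket 𝓘(ℝ, E) (coordField e v) (coordField e w) q = 0 := by
  have : CompleteSpace E := FiniteDimensional.complete ℝ E
  have : IsManifold 𝓘(ℝ, E) (minSmoothness ℝ 2) M := by
    rw [minSmoothness_of_isRCLikeNormedField]
    infer_instance
  have hc : ∀ u : E, MDifferentiableAt 𝓘(ℝ, E) 𝓘(ℝ, E).tangent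
      (fun x : E => (TotalSpace.mk' E x u : TangentBundle 𝓘(ℝ, E) E)) (e q) := fun u =>
    (contMDiffAt_vectorSpace_iff_contDiffAt (V := fun _ => u)).2
      (contDiffAt_const (n := 1)) |>.mdifferentiableAt (by simp)
  have := mpullback_mlieBracket (hc v) (hc w) (contMDiffAt_of_mem_maximalAtlas he hq)
    (by rw [minSmoothness_of_isRCLikeNormedField]; exact ENat.LEInfty.out)
  change _ = mlieBracket 𝓘(ℝ, E) (coordField e v) (coordField e w) q at this
  rw [← this, mpullback_apply]
  have h0 : mlieBracket 𝓘(ℝ, E) (fun x : E => (v : TangentSpace 𝓘(ℝ, E) x))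
      (fun x : E => (w : TangentSpace 𝓘(ℝ, E) x)) (e q) = 0 := by
    have h : ∀ V W : ∀ x : E, TangentSpace 𝓘(ℝ, E) x,
        mlieBracket 𝓘(ℝ, E) V W = lieBracket ℝ V W := fun V W => by
      rw [← mlieBracketWithin_univ, mlieBracketWithin_eq_lieBracketWithin]
      exact lieBracketWithin_univ
    refine (congrFun (h _ _) (e q)).trans ?_
    simp [lieBracket]
    rfl
  rw [h0, map_zero]

theorem contDiffOn_chartForm (he : e ∈ IsManifold.maximalAtlas 𝓘(ℝ, E) ∞ M) {U : Set M}
    {c : M → ℝ} {X : ∀ p : M, TangentSpace 𝓘(ℝ, E) p} (hc : ∀ q ∈ U, CMDiffAt ∞ c q)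
    (hX : ∀ q ∈ U, CMDiffAt ∞ (T% X) q) :
    ContDiffOn ℝ ∞ (chartForm g e c X) (e.target ∩ e.symm ⁻¹' U) := by
  rw [contDiffOn_clm_apply]
  intro v
  have h1 : ∀ q ∈ U ∩ e.source, CMDiffAt ∞
      (fun q => c q * g.inner q (X q) (coordField e v q)) q := fun q hq =>
    (hc q hq.1).mul (contMDiffAt_inner g (hX q hq.1) (contMDiffAt_coordField he hq.2 v))
  refine (contDiffOn_comp_symm he h1).mono ?_
  rintro x ⟨hx, hxU⟩
  exact ⟨hx, hxU, e.map_target hx⟩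

/-- The last term is symmetric in `v` and `w` because coordinate fields commute. Hence this
derivative is symmetric exactly when the remaining terms are, which is the closedness hypothesis of
`exists_primitive`. -/
theorem fderiv_chartForm (he : e ∈ IsManifold.maximalAtlas 𝓘(ℝ, E) ∞ M) {U : Set M}
    (hU : IsOpen U) {c : M → ℝ} {X : ∀ p : M, TangentSpace 𝓘(ℝ, E) p}
    (hc : ∀ q ∈ U, CMDiffAt ∞ c q) (hX : ∀ q ∈ U, CMDiffAt ∞ (T% X) q) {q : M} (hq : q ∈ e.source)
    (hqU : q ∈ U) (v w : E) :
    fderiv ℝ (chartForm g e c X) (e q) v w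
      = mvfderiv 𝓘(ℝ, E) c q (coordField e v q) * g.inner q (X q) (coordField e w q)
        + c q * (g.inner q (leviCivita g X q (coordField e v q)) (coordField e w q)
          + g.inner q (X q) (leviCivita g (coordField e w) q (coordField e v q))) := by
  have hxt : e q ∈ e.target ∩ e.symm ⁻¹' U := ⟨e.map_source hq, by simpa [e.left_inv hq]⟩
  have hop : IsOpen (e.target ∩ e.symm ⁻¹' U) := e.symm.isOpen_inter_preimage hU
  have h1 : DifferentiableAt ℝ (chartForm g e c X) (e q) :=
    ((contDiffOn_chartForm g he hc hX).contDiffAt (hop.mem_nhds hxt)).differentiableAt (by simp)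
  have hXq : MDiffAt (T% X) q := (hX q hqU).mdifferentiableAt (by simp)
  have hcq : MDiffAt c q := (hc q hqU).mdifferentiableAt (by simp)
  have hZ := mdiffAt_coordField he hq w
  have hi := mdiffAt_inner g hXq hZ
  have h2 : fderiv ℝ (chartForm g e c X) (e q) v w
      = fderiv ℝ (fun y => chartForm g e c X y w) (e q) v := by
    rw [fderiv_clm_apply h1 (differentiableAt_const w)]
    simp
  rw [h2]
  have h3 := fderiv_comp_symm he hq (F := c * fun q => g.inner q (X q) (coordField e w q))
    (hcq.mul hi) v
  rw [mvfderiv_mul hcq hi, add_apply, smul_apply, smul_apply, mvfderiv_inner g hXq hZ] at h3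
  refine Eq.trans ?_ (h3.trans ?_)
  · rfl
  · simp only [smul_eq_mul]
    ring

/-- A closed `1`-form `c g(X, ·)` has a primitive near each point. -/
theorem exists_primitive {U : Set M} (hU : IsOpen U) {p : M} (hp : p ∈ U) {c : M → ℝ}
    {X : ∀ p : M, TangentSpace 𝓘(ℝ, E) p} (hc : ∀ q ∈ U, CMDiffAt ∞ c q)
    (hX : ∀ q ∈ U, CMDiffAt ∞ (T% X) q)
    (hcl : ∀ q ∈ U, ∀ v w : TangentSpace 𝓘(ℝ, E) q,
      mvfderiv 𝓘(ℝ, E) c q v * g.inner q (X q) w + c q * g.inner q (leviCivita g X q v) w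
        = mvfderiv 𝓘(ℝ, E) c q w * g.inner q (X q) v
          + c q * g.inner q (leviCivita g X q w) v) :
    ∃ V ⊆ U, IsOpen V ∧ p ∈ V ∧ ∃ F : M → ℝ, ∀ q ∈ V, CMDiffAt ∞ F q ∧
      ∀ v : TangentSpace 𝓘(ℝ, E) q, mvfderiv 𝓘(ℝ, E) F q v = c q * g.inner q (X q) v := by
  let e := chartAt E p
  have he : e ∈ IsManifold.maximalAtlas 𝓘(ℝ, E) ∞ M := IsManifold.chart_mem_maximalAtlas p
  have hpe : p ∈ e.source := mem_chart_source E p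
  have hop : IsOpen (e.target ∩ e.symm ⁻¹' U) := e.symm.isOpen_inter_preimage hU
  obtain ⟨r, hr, hball⟩ := Metric.isOpen_iff.1 hop (e p) ⟨e.map_source hpe, by simpa [e.left_inv hpe]⟩
  have hsm : ContDiffOn ℝ ∞ (chartForm g e c X) (Metric.ball (e p) r) :=
    (contDiffOn_chartForm g he hc hX).mono hball
  -- The Poincaré lemma on a ball of the chart; the vanishing bracket of coordinate fields
  -- identifies the two `∇`-terms of the fields themselves.
  obtain ⟨G, hG⟩ := (convex_ball (e p) r).exists_forall_hasFDerivAt_of_fderiv_symmetric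
    Metric.isOpen_ball (hsm.differentiableOn (by simp)) (by
      intro x hx v w
      have hxt := hball hx
      have hq := e.map_target hxt.1
      have h1 := fderiv_chartForm g he hU hc hX hq hxt.2 v w
      have h2 := fderiv_chartForm g he hU hc hX hq hxt.2 w v
      have h3 := hcl _ hxt.2 (coordField e v (e.symm x)) (coordField e w (e.symm x))
      have h4 := mlieBracket_eq_leviCivita g (mdiffAt_coordField he hq v)
        (mdiffAt_coordField he hq w)
      rw [mlieBracket_coordField he hq, eq_comm, sub_eq_zero] at h4
      rw [e.right_inv hxt.1] at h1 h2
      rw [h1, h2, h4]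
      linarith)
  have hGsm : ContDiffOn ℝ ∞ G (Metric.ball (e p) r) := by
    rw [contDiffOn_infty_iff_fderiv_of_isOpen Metric.isOpen_ball]
    refine ⟨fun x hx => (hG x hx).differentiableAt.differentiableWithinAt, ?_⟩
    exact hsm.congr fun x hx => (hG x hx).fderiv
  refine ⟨e.source ∩ e ⁻¹' Metric.ball (e p) r, ?_, e.isOpen_inter_preimage Metric.isOpen_ball,
    ⟨hpe, Metric.mem_ball_self hr⟩, G ∘ e, ?_⟩
  · rintro q ⟨hq, hqb⟩
    have := (hball hqb).2
    rwa [mem_preimage, e.left_inv hq] at this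
  · rintro q ⟨hq, hqb⟩
    have h1 := hG (e q) hqb
    refine ⟨?_, fun v => ?_⟩
    · exact ContMDiffAt.comp q (hGsm.contDiffAt (Metric.isOpen_ball.mem_nhds hqb)).contMDiffAt
        (contMDiffAt_of_mem_maximalAtlas he hq)
    · rw [mvfderiv_comp_chart he hq h1.differentiableAt, h1.fderiv,
        chartForm_apply_mfderiv g he hq]

end Charts

/-! ### The sign of `k + 1` and the global potential of `(μ + 2)η`. -/

section Potential

variable {E : Type*} [NormedAddCommGroup E] [NormedSpace ℝ E]
  {M : Type*} [TopologicalSpace M] [ChartedSpace E M]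

theorem mvfderiv_comp_real {G : ℝ → ℝ} {G' : ℝ} {F : M → ℝ} {p : M} (hG : HasDerivAt G G' (F p))
    (hF : MDiffAt F p) (v : TangentSpace 𝓘(ℝ, E) p) :
    mvfderiv 𝓘(ℝ, E) (fun q => G (F q)) p v = G' * mvfderiv 𝓘(ℝ, E) F p v := by
  have h1 : HasMFDerivAt 𝓘(ℝ, E) 𝓘(ℝ, ℝ) (G ∘ F) p _ :=
    hG.hasFDerivAt.hasMFDerivAt.comp p hF.hasMFDerivAt
  change mfderiv 𝓘(ℝ, E) 𝓘(ℝ, ℝ) (G ∘ F) p v = _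
  rw [h1.mfderiv]
  exact mul_comm (mvfderiv 𝓘(ℝ, E) F p v) G'

variable [IsManifold 𝓘(ℝ, E) ∞ M] [FiniteDimensional ℝ E]

/-- A solution of `dK = K c g(X, ·)` on a connected manifold vanishes everywhere or nowhere. -/
theorem ne_zero_of_mvfderiv_eq_mul [ConnectedSpace M]
    (g : ContMDiffRiemannianMetric 𝓘(ℝ, E) ∞ E (fun p : M => TangentSpace 𝓘(ℝ, E) p))
    {K c : M → ℝ} {X : ∀ p : M, TangentSpace 𝓘(ℝ, E) p} (hK : CMDiff ∞ K) (hc : CMDiff ∞ c)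
    (hX : IsSmoothField X)
    (hd : ∀ (q : M) (v : TangentSpace 𝓘(ℝ, E) q),
      mvfderiv 𝓘(ℝ, E) K q v = K q * (c q * g.inner q (X q) v))
    {p₀ : M} (h0 : K p₀ ≠ 0) (p : M) : K p ≠ 0 := by
  have hclopen : IsClopen {q | K q = 0} := by
    refine ⟨isClosed_eq hK.continuous continuous_const, ?_⟩
    rw [isOpen_iff_mem_nhds]
    intro q (hq0 : K q = 0)
    let e := chartAt E q
    have he : e ∈ IsManifold.maximalAtlas 𝓘(ℝ, E) ∞ M := IsManifold.chart_mem_maximalAtlas q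
    have hq : q ∈ e.source := mem_chart_source E q
    have hform : ContDiffOn ℝ ∞ (chartForm g e c X) e.target :=
      (contDiffOn_chartForm g he (U := univ) (fun q _ => hc q) (fun q _ => hX q)).mono
        (by simp)
    have hcont : ContinuousAt (chartForm g e c X) (e q) :=
      hform.continuousOn.continuousAt (e.open_target.mem_nhds (e.map_source hq))
    -- On this ball the form is bounded by its norm at the centre plus one; the bound serves as
    -- Grönwall constant on every segment from the centre.
    obtain ⟨r, hr, hball⟩ := Metric.mem_nhds_iff.1 (inter_mem
      (e.open_target.mem_nhds (e.map_source hq))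
      (hcont.norm.eventually (gt_mem_nhds (lt_add_one ‖chartForm g e c X (e q)‖))))
    filter_upwards [(e.isOpen_inter_preimage Metric.isOpen_ball).mem_nhds
      (show q ∈ e.source ∩ e ⁻¹' Metric.ball (e q) r from ⟨hq, Metric.mem_ball_self hr⟩)]
      with y hy
    let γ : ℝ → E := fun s => e q + s • (e y - e q)
    have hγ : ∀ s ∈ Icc (0 : ℝ) 1, γ s ∈ Metric.ball (e q) r := fun s hs =>
      (convex_ball (e q) r).add_smul_sub_mem (Metric.mem_ball_self hr) hy.2 hs
    have hder : ∀ s ∈ Icc (0 : ℝ) 1, HasDerivAt (fun s => (K ∘ e.symm) (γ s))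
        ((K ∘ e.symm) (γ s) * chartForm g e c X (γ s) (e y - e q)) s := by
      intro s hs
      have hmem := (hball (hγ s hs)).1
      have hmem' := e.map_target hmem
      have hKd : MDiffAt K (e.symm (γ s)) := hK.mdifferentiableAt (by simp)
      have h1 := differentiableAt_comp_symm he hmem' hKd
      have h2 := fderiv_comp_symm he hmem' hKd (e y - e q)
      rw [e.right_inv hmem] at h1 h2
      have h3 : HasDerivAt γ (e y - e q) s := by
        have h := ((hasDerivAt_id s).smul_const (e y - e q)).const_add (e q)
        rwa [one_smul] at h
      have h4 := h1.hasFDerivAt.comp_hasDerivAt s h3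
      rw [h2, hd] at h4
      exact h4
    -- Along the segment `K` solves a linear homogeneous equation with initial value zero, so it
    -- stays zero; the zero set is therefore open.
    have hzero := eq_zero_of_abs_deriv_le_mul_abs_self_of_eq_zero_right
      (K := (‖chartForm g e c X (e q)‖ + 1) * ‖e y - e q‖)
      (fun s hs => (hder s hs).continuousAt.continuousWithinAt)
      (fun s hs => (hder s ⟨hs.1, hs.2.le⟩).hasDerivWithinAt)
      (by simp [γ, e.left_inv hq, hq0]) (by
        intro s hs
        rw [norm_mul, mul_comm]
        refine mul_le_mul_of_nonneg_right ?_ (norm_nonneg _)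
        refine (ContinuousLinearMap.le_opNorm _ _).trans ?_
        exact mul_le_mul_of_nonneg_right (hball (hγ s ⟨hs.1, hs.2.le⟩)).2.le (norm_nonneg _))
      1 ⟨zero_le_one, le_rfl⟩
    simpa [γ, e.left_inv hy.1] using hzero
  rcases isClopen_iff.1 hclopen with h | h
  · exact fun hp => (h ▸ (show p ∈ {q | K q = 0} from hp) : p ∈ (∅ : Set M))
  · exact absurd (show p₀ ∈ {q | K q = 0} from h ▸ mem_univ _) h0

namespace AlmostContactMetric.IsAlmostKenmotsu

variable [T2Space M] {S : AlmostContactMetric E M} {k μ : M → ℝ}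

theorem mvfderiv_k (hS : S.IsAlmostKenmotsu) (hN : S.GeneralizedNullity' k μ)
    (hE : 1 < Module.finrank ℝ E) (hk : CMDiff ∞ k)
    (hdk : ∀ (p : M) (v w : TangentSpace 𝓘(ℝ, E) p),
      mvfderiv 𝓘(ℝ, E) k p v * S.η p w - mvfderiv 𝓘(ℝ, E) k p w * S.η p v = 0)
    (p : M) (v : TangentSpace 𝓘(ℝ, E) p) :
    mvfderiv 𝓘(ℝ, E) k p v = -2 * (μ p + 2) * (k p + 1) * S.η p v := by
  have h1 := hdk p v (S.ξ p)
  rw [S.η_ξ, hS.mvfderiv_k_ξ hN (hk.mdifferentiableAt (by simp)) hE] at h1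
  linarith

/-- By symmetry of `h'`, `-(k+1)` is the ratio of `|h'v|²` to `|v|²` for nonzero `v` in `ker η`, so
`k + 1 ≤ 0`. A zero of `k + 1` makes `h'`, and hence `h = φh'`, vanish there. The linear equation
`d(k+1) = -2(μ+2)(k+1)η` then carries non-vanishing from one point to all of the connected manifold.
-/
theorem k_add_one_neg [ConnectedSpace M] (hS : S.IsAlmostKenmotsu)
    (hN : S.GeneralizedNullity' k μ) (hE : 1 < Module.finrank ℝ E) (hk : CMDiff ∞ k)
    (hμ : CMDiff ∞ μ)
    (hdk : ∀ (p : M) (v w : TangentSpace 𝓘(ℝ, E) p),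
      mvfderiv 𝓘(ℝ, E) k p v * S.η p w - mvfderiv 𝓘(ℝ, E) k p w * S.η p v = 0)
    (hh : ∃ p, S.h p ≠ 0) (p : M) : k p + 1 < 0 := by
  have hle : ∀ q, k q + 1 ≤ 0 := by
    intro q
    have : FiniteDimensional ℝ (TangentSpace 𝓘(ℝ, E) q) :=
      inferInstanceAs (FiniteDimensional ℝ E)
    obtain ⟨v, hv, hv0⟩ : ∃ v : TangentSpace 𝓘(ℝ, E) q, S.η q v = 0 ∧ v ≠ 0 := by
      have hne : LinearMap.ker (S.η q).toLinearMap ≠ ⊥ :=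
        LinearMap.ker_ne_bot_of_finrank_lt (by rw [Module.finrank_self]; exact hE)
      exact (Submodule.ne_bot_iff _).1 hne
    have h1 := hS.inner_h'_h' hN q v
    have h2 : 0 ≤ S.g.inner q (S.h' q v) (S.h' q v) := by
      by_cases h : S.h' q v = 0
      · simp [h]
      · exact (S.g.pos q _ h).le
    have h3 := S.g.pos q v hv0
    rw [h1, hv] at h2
    nlinarith
  obtain ⟨p₀, hp₀⟩ := hh
  have hne : (k + 1) p₀ ≠ 0 := by
    intro h0
    apply hp₀
    ext v
    have h1 := hS.inner_h'_h' hN p₀ v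
    rw [show k p₀ + 1 = 0 from h0] at h1
    have h2 : S.h' p₀ v = 0 := by
      by_contra hc
      have := S.g.pos p₀ _ hc
      rw [h1] at this
      simp at this
    rw [← hS.φ_h', h2]
    simp
  have hk1 : CMDiff ∞ (k + 1) := hk.add contMDiff_const
  have hc : CMDiff ∞ (fun q => -2 * (μ q + 2)) :=
    contMDiff_const.mul (hμ.add contMDiff_const)
  have hd : ∀ (q : M) (v : TangentSpace 𝓘(ℝ, E) q), mvfderiv 𝓘(ℝ, E) (k + 1) q v
      = (k + 1) q * (-2 * (μ q + 2) * S.g.inner q (S.ξ q) v) := by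
    intro q v
    have h1 : MDiffAt (fun _ : M => (1 : ℝ)) q := mdifferentiableAt_const
    change mvfderiv 𝓘(ℝ, E) (k + fun _ => (1 : ℝ)) q v = _
    rw [mvfderiv_add (hk.mdifferentiableAt (by simp)) h1, mvfderiv_const, add_zero,
      hS.mvfderiv_k hN hE hk hdk, S.inner_ξ_left]
    simp
    ring
  exact lt_of_le_of_ne (hle p)
    (ne_zero_of_mvfderiv_eq_mul S.g hk1 hc S.contMDiff_ξ hd hne p)

/-- A potential `F` of `(μ + 2) η` with `k = -1 - exp (-2F)`. -/
theorem exists_potential [ConnectedSpace M] (hS : S.IsAlmostKenmotsu)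
    (hN : S.GeneralizedNullity' k μ) (hE : 1 < Module.finrank ℝ E) (hk : CMDiff ∞ k)
    (hμ : CMDiff ∞ μ)
    (hdk : ∀ (p : M) (v w : TangentSpace 𝓘(ℝ, E) p),
      mvfderiv 𝓘(ℝ, E) k p v * S.η p w - mvfderiv 𝓘(ℝ, E) k p w * S.η p v = 0)
    (hh : ∃ p, S.h p ≠ 0) :
    ∃ F : M → ℝ, CMDiff ∞ F ∧ (∀ p, k p = -1 - Real.exp (-2 * F p)) ∧
      ∀ (p : M) (v : TangentSpace 𝓘(ℝ, E) p),
        mvfderiv 𝓘(ℝ, E) F p v = (μ p + 2) * S.η p v := by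
  have hneg := hS.k_add_one_neg hN hE hk hμ hdk hh
  refine ⟨fun p => -(1 / 2) * Real.log (-(k p + 1)), ?_, ?_, ?_⟩
  · intro p
    have h1 : ContDiffAt ℝ ∞ (fun s => -(1 / 2) * Real.log (-(s + 1))) (k p) := by
      have hlog : ContDiffAt ℝ ∞ (fun s : ℝ => Real.log (-(s + 1))) (k p) :=
        ContDiffAt.log (by fun_prop) (by linarith [hneg p])
      exact contDiffAt_const.mul hlog
    exact h1.contMDiffAt.comp p (hk p)
  · intro p
    rw [show -2 * (-(1 / 2) * Real.log (-(k p + 1))) = Real.log (-(k p + 1)) by ring,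
      Real.exp_log (by linarith [hneg p])]
    ring
  · intro p v
    have hp := hneg p
    have h1 : HasDerivAt (fun s => -(1 / 2) * Real.log (-(s + 1)))
        (-(1 / 2) * (-1 / (-(k p + 1)))) (k p) :=
      ((((hasDerivAt_id (k p)).add_const 1).neg).log (by simpa using by linarith)).const_mul _
    rw [mvfderiv_comp_real h1 (hk.mdifferentiableAt (by simp)), hS.mvfderiv_k hN hE hk hdk]
    have hp' := hp.ne
    field_simp

end AlmostContactMetric.IsAlmostKenmotsu

end Potential

/-! ### The orthonormal eigenframe of `h'` and its covariant derivatives. -/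

/-- This allows division by the norm of a field that may have zeros: `(χ(|W|²))^{-1/2}` is smooth
everywhere and is `1/|W|` where `|W|²` is at least `a`. The function `χ` interpolates between the
constant `1` and the identity. -/
theorem exists_contDiff_pos_eq_self {a : ℝ} (ha : 0 < a) :
    ∃ χ : ℝ → ℝ, ContDiff ℝ ∞ χ ∧ (∀ s, 0 < χ s) ∧ ∀ s, a ≤ s → χ s = s := by
  let T : ℝ → ℝ := fun s => Real.smoothTransition (s / a)
  have hT : ContDiff ℝ ∞ T := Real.smoothTransition.contDiff.comp (contDiff_id.div_const a)
  refine ⟨fun s => T s * s + (1 - T s), (hT.mul contDiff_id).add (contDiff_const.sub hT), ?_, ?_⟩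
  · intro s
    have h0 : 0 ≤ T s := Real.smoothTransition.nonneg _
    have h1 : T s ≤ 1 := Real.smoothTransition.le_one _
    rcases le_or_gt s 0 with hs | hs
    · have : T s = 0 := Real.smoothTransition.zero_of_nonpos (div_nonpos_of_nonpos_of_nonneg hs ha.le)
      simp [this]
    · rcases eq_or_lt_of_le h0 with h | h
      · simp [← h]
      · have := mul_pos h hs
        linarith
  · intro s hs
    have : T s = 1 := Real.smoothTransition.one_of_one_le (by rwa [le_div_iff₀ ha, one_mul])
    simp [this]

namespace AlmostContactMetric.IsAlmostKenmotsu

variable {E : Type*} [NormedAddCommGroup E] [NormedSpace ℝ E]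
  {M : Type*} [TopologicalSpace M] [ChartedSpace E M] [IsManifold 𝓘(ℝ, E) ∞ M]
  {S : AlmostContactMetric E M} {k μ F : M → ℝ}

theorem mvfderiv_exp_neg (hFs : CMDiff ∞ F)
    (hdF : ∀ (p : M) (v : TangentSpace 𝓘(ℝ, E) p),
      mvfderiv 𝓘(ℝ, E) F p v = (μ p + 2) * S.η p v) (p : M) (v : TangentSpace 𝓘(ℝ, E) p) :
    mvfderiv 𝓘(ℝ, E) (fun q => Real.exp (-F q)) p v
      = -(μ p + 2) * Real.exp (-F p) * S.η p v := by
  rw [mvfderiv_comp_real (G := fun s => Real.exp (-s)) ((hasDerivAt_neg (F p)).exp)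
    (hFs.mdifferentiableAt (by simp)), hdF]
  ring

variable [FiniteDimensional ℝ E]

/-- In dimension three, a unit vector `x` in `ker η` gives the orthonormal frame `x, φ x, ξ`. -/
theorem eq_of_inner_frame (hE : Module.finrank ℝ E = 3) {p : M}
    {x : TangentSpace 𝓘(ℝ, E) p} (hη : S.η p x = 0) (hx : S.g.inner p x x = 1) :
    LinearIndependent ℝ ![x, S.φ p x, S.ξ p] ∧
    ∀ v : TangentSpace 𝓘(ℝ, E) p,
      v = S.g.inner p x v • x + S.g.inner p (S.φ p x) v • S.φ p x + S.η p v • S.ξ p := by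
  have : FiniteDimensional ℝ (TangentSpace 𝓘(ℝ, E) p) := inferInstanceAs (FiniteDimensional ℝ E)
  have hE' : Module.finrank ℝ (TangentSpace 𝓘(ℝ, E) p) = 3 := hE
  have h1 : S.g.inner p x (S.φ p x) = 0 := by
    have := S.inner_φ_left p x x
    rw [S.g.symm p (S.φ p x)] at this
    linarith
  have h2 : S.g.inner p (S.φ p x) x = 0 := by rw [S.g.symm, h1]
  have h3 : S.g.inner p (S.φ p x) (S.φ p x) = 1 := by rw [S.compatible, hx, hη]; simp
  have hli : LinearIndependent ℝ ![x, S.φ p x, S.ξ p] := by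
    rw [Fintype.linearIndependent_iff]
    intro a ha
    simp only [Fin.sum_univ_three, Matrix.cons_val_zero, Matrix.cons_val_one,
      Matrix.cons_val] at ha
    have e0 := congrArg (fun w => S.g.inner p w x) ha
    have e1 := congrArg (fun w => S.g.inner p w (S.φ p x)) ha
    have e2 := congrArg (fun w => S.g.inner p w (S.ξ p)) ha
    simp [hx, h1, h2, h3, S.inner_ξ_left, S.inner_ξ_right, hη, S.η_φ, S.η_ξ] at e0 e1 e2
    intro i
    fin_cases i <;> assumption
  have hspan := hli.span_eq_top_of_card_eq_finrank (by simp [hE'])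
  refine ⟨hli, fun v => ?_⟩
  have hv : v ∈ Submodule.span ℝ (Set.range ![x, S.φ p x, S.ξ p]) := by rw [hspan]; trivial
  obtain ⟨a, ha⟩ := (Submodule.mem_span_range_iff_exists_fun ℝ).1 hv
  simp only [Fin.sum_univ_three, Matrix.cons_val_zero, Matrix.cons_val_one, Matrix.cons_val] at ha
  rw [← ha]
  simp [hx, h1, h2, h3, S.inner_ξ_right, hη, S.η_φ, S.η_ξ]

variable [T2Space M]

theorem h'_h'_of_potential (hS : S.IsAlmostKenmotsu) (hN : S.GeneralizedNullity' k μ)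
    (hF : ∀ p, k p = -1 - Real.exp (-2 * F p)) {p : M} {v : TangentSpace 𝓘(ℝ, E) p}
    (hv : S.η p v = 0) : S.h' p (S.h' p v) = Real.exp (-F p) ^ 2 • v := by
  rw [hS.h'_h' hN, hv, hF, ← Real.exp_nat_mul]
  simp

/-- Near every point there is a smooth unit vector field in `ker η` with `h' X = exp (-F) X`;
it extends to a global smooth vector field of eigenvectors. -/
theorem exists_eigenField (hS : S.IsAlmostKenmotsu) (hN : S.GeneralizedNullity' k μ)
    (hE : 1 < Module.finrank ℝ E) (hFs : CMDiff ∞ F)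
    (hF : ∀ p, k p = -1 - Real.exp (-2 * F p)) (p : M) :
    ∃ X : ∀ p : M, TangentSpace 𝓘(ℝ, E) p, IsSmoothField X ∧ (∀ q, S.η q (X q) = 0) ∧
      (∀ q, S.h' q (X q) = Real.exp (-F q) • X q) ∧
      ∃ U, IsOpen U ∧ p ∈ U ∧ ∀ q ∈ U, S.g.inner q (X q) (X q) = 1 := by
  have : FiniteDimensional ℝ (TangentSpace 𝓘(ℝ, E) p) := inferInstanceAs (FiniteDimensional ℝ E)
  set l : M → ℝ := fun q => Real.exp (-F q) with hl
  have hls : CMDiff ∞ l := Real.contDiff_exp.contMDiff.comp hFs.neg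
  -- Because `h'² = λ²` on `ker η`, the operator `h' + λ` maps `ker η` to the `λ`-eigenspace, so it
  -- suffices that it does not kill `u`. If it kills `v`, then `φv` is a `λ`-eigenvector and `u =
  -- φv` works.
  obtain ⟨u, hu, hu0⟩ : ∃ u : TangentSpace 𝓘(ℝ, E) p, S.η p u = 0 ∧ S.h' p u + l p • u ≠ 0 := by
    obtain ⟨v, hv, hv0⟩ : ∃ v : TangentSpace 𝓘(ℝ, E) p, S.η p v = 0 ∧ v ≠ 0 := by
      have hne : LinearMap.ker (S.η p).toLinearMap ≠ ⊥ :=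
        LinearMap.ker_ne_bot_of_finrank_lt (by rw [Module.finrank_self]; exact hE)
      exact (Submodule.ne_bot_iff _).1 hne
    by_cases h : S.h' p v + l p • v = 0
    · refine ⟨S.φ p v, S.η_φ p v, fun h' => ?_⟩
      rw [hS.h'_φ, eq_neg_of_add_eq_zero_left h, map_neg, neg_neg, map_smul, ← two_smul ℝ,
        smul_smul, smul_eq_zero] at h'
      rcases h' with h' | h'
      · have : 0 < l p := Real.exp_pos _
        linarith
      · have h2 := S.φ_sq p v
        rw [h', hv, map_zero, zero_smul, add_zero, eq_comm, neg_eq_zero] at h2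
        exact hv0 h2
    · exact ⟨v, hv, h⟩
  obtain ⟨V, hV, rfl⟩ := exists_isSmoothField p u
  -- Projection to `ker η`, followed by `h' + λ`, makes the eigenvector equation hold at all points
  -- and not only at `p`.
  let W₀ : ∀ p : M, TangentSpace 𝓘(ℝ, E) p := V - (fun q => S.η q (V q)) • S.ξ
  have hW₀ : IsSmoothField W₀ := fun q => (hV q).sub_section
    ((S.contMDiffAt_η (hV q)).smul_section (S.contMDiff_ξ q))
  have hηW₀ : ∀ q, S.η q (W₀ q) = 0 := fun q => by simp [W₀, S.η_ξ]
  let W : ∀ p : M, TangentSpace 𝓘(ℝ, E) p := (fun q => S.h' q (W₀ q)) + l • W₀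
  have hW : IsSmoothField W := fun q => (S.isSmoothField_h' hW₀ q).add_section
    ((hls q).smul_section (hW₀ q))
  have hηW : ∀ q, S.η q (W q) = 0 := fun q => by simp [W, hηW₀, hS.η_h']
  have hhW : ∀ q, S.h' q (W q) = l q • W q := fun q => by
    simp only [W, Pi.add_apply, Pi.smul_apply', map_add, map_smul,
      hS.h'_h'_of_potential hN hF (hηW₀ q), hl]
    module
  have hWp : W p ≠ 0 := by simpa [W, W₀, hu] using hu0
  let n : M → ℝ := fun q => S.g.inner q (W q) (W q)
  have hn : CMDiff ∞ n := fun q => contMDiffAt_inner S.g (hW q) (hW q)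
  have hnp : 0 < n p := S.g.pos p _ hWp
  obtain ⟨χ, hχ, hχpos, hχeq⟩ := exists_contDiff_pos_eq_self (half_pos hnp)
  have hc : CMDiff ∞ (fun q => (Real.sqrt (χ (n q)))⁻¹) := by
    have h1 : ContDiff ℝ ∞ (fun s => (Real.sqrt (χ s))⁻¹) :=
      (hχ.sqrt fun s => (hχpos s).ne').inv fun s => (Real.sqrt_pos.2 (hχpos s)).ne'
    exact h1.contMDiff.comp hn
  refine ⟨(fun q => (Real.sqrt (χ (n q)))⁻¹) • W, fun q => (hc q).smul_section (hW q),
    fun q => by simp [hηW], fun q => ?_, {q | n p / 2 < n q},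
    isOpen_lt continuous_const hn.continuous, half_lt_self hnp, fun q hq => ?_⟩
  · simp only [Pi.smul_apply', map_smul, hhW]
    module
  · have hq' : n p / 2 < n q := hq
    have hnq : 0 < n q := (half_pos hnp).trans hq'
    have h1 : S.g.inner q (W q) (W q) = n q := rfl
    simp only [Pi.smul_apply', map_smul, smul_apply, smul_eq_mul, h1, hχeq _ hq'.le]
    rw [← mul_assoc, ← mul_inv, Real.mul_self_sqrt hnq.le, inv_mul_cancel₀ hnq.ne']

/-- The covariant derivative of `h'` between eigenvectors. -/
theorem inner_covDeriv_h' (hS : S.IsAlmostKenmotsu)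
    {X Z : ∀ p : M, TangentSpace 𝓘(ℝ, E) p} {a b : M → ℝ} {p : M} (hX : MDiffAt (T% X) p)
    (ha : MDiffAt a p) (hhX : ∀ q, S.h' q (X q) = a q • X q)
    (hhZ : S.h' p (Z p) = b p • Z p) (v : TangentSpace 𝓘(ℝ, E) p) :
    S.g.inner p (S.covDeriv_h' p (X p) v) (Z p)
      = mvfderiv 𝓘(ℝ, E) a p v * S.g.inner p (X p) (Z p)
        + (a p - b p) * S.g.inner p (leviCivita S.g X p v) (Z p) := by
  have e : (fun q => S.h' q (X q)) = a • X := funext hhX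
  rw [S.covDeriv_h'_apply hX, e, leviCivita_smul S.g ha hX, map_sub, sub_apply, hS.inner_h', hhZ]
  simp
  ring

/-- The covariant derivatives of the frame of eigenvectors of `h'`. -/
theorem leviCivita_eigenField (hS : S.IsAlmostKenmotsu) (hN : S.GeneralizedNullity' k μ)
    (hE : Module.finrank ℝ E = 3) (hFs : CMDiff ∞ F)
    (hdF : ∀ (p : M) (v : TangentSpace 𝓘(ℝ, E) p),
      mvfderiv 𝓘(ℝ, E) F p v = (μ p + 2) * S.η p v)
    {X : ∀ p : M, TangentSpace 𝓘(ℝ, E) p} (hX : IsSmoothField X) (hη : ∀ q, S.η q (X q) = 0)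
    (hh : ∀ q, S.h' q (X q) = Real.exp (-F q) • X q) {U : Set M} (hU : IsOpen U)
    (hnorm : ∀ q ∈ U, S.g.inner q (X q) (X q) = 1) {q : M} (hq : q ∈ U)
    (v : TangentSpace 𝓘(ℝ, E) q) :
    leviCivita S.g X q v = -((1 + Real.exp (-F q)) * S.g.inner q (X q) v) • S.ξ q ∧
    leviCivita S.g (fun q => S.φ q (X q)) q v
      = -((1 - Real.exp (-F q)) * S.g.inner q (S.φ q (X q)) v) • S.ξ q := by
  set l : M → ℝ := fun q => Real.exp (-F q) with hl
  have hlpos : 0 < l q := Real.exp_pos _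
  have hls : MDiffAt l q := ((Real.contDiff_exp.contMDiff.comp hFs.neg) q).mdifferentiableAt
    (by simp)
  have hdl : ∀ v : TangentSpace 𝓘(ℝ, E) q, mvfderiv 𝓘(ℝ, E) l q v
      = -(μ q + 2) * l q * S.η q v := mvfderiv_exp_neg hFs hdF q
  have hdl' : ∀ v : TangentSpace 𝓘(ℝ, E) q, mvfderiv 𝓘(ℝ, E) (-l) q v
      = (μ q + 2) * l q * S.η q v := fun v => by rw [mvfderiv_neg, neg_apply, hdl]; ring
  set Y : ∀ p : M, TangentSpace 𝓘(ℝ, E) p := fun q => S.φ q (X q) with hY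
  have hXq := hX.mdiffAt q
  have hYq : MDiffAt (T% Y) q := S.mdiffAt_φ hXq
  have hξq := S.contMDiff_ξ.mdiffAt q
  have hhY : ∀ q, S.h' q (Y q) = (-l) q • Y q := fun q => by
    simp [hY, hS.h'_φ, hh, hl]
  have hηY : ∀ q, S.η q (Y q) = 0 := fun q => S.η_φ q _
  have hXY : ∀ q, S.g.inner q (X q) (Y q) = 0 := fun q => by
    have := S.inner_φ_left q (X q) (X q)
    rw [S.g.symm q (S.φ q (X q))] at this
    change S.g.inner q (X q) (S.φ q (X q)) = 0
    linarith
  have hYX : S.g.inner q (Y q) (X q) = 0 := by rw [S.g.symm, hXY]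
  have hXX := hnorm q hq
  have hYnorm : ∀ q ∈ U, S.g.inner q (Y q) (Y q) = 1 := fun q hq => by
    rw [S.compatible, hnorm q hq, hη]; simp
  have hYY := hYnorm q hq
  have hexp := (eq_of_inner_frame (S := S) hE (hη q) hXX).2
  -- For `X` and `Y = φX` in `ker η` the right side vanishes. Pairing with `X` and with `Y` gives
  -- `g(∇_X Y, X) = 0` and `g(∇_Y X, Y) = 0`, since the eigenvalues differ by `2λ ≠ 0` and `dλ` is a
  -- multiple of `η`. The third relation comes from `∇_ξ h' = -(μ+2)h'` and gives `g(∇_ξ X, Y) = 0`.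
  have hnul := (hS.generalizedNullity'_iff k μ).1 hN q (X q) (Y q)
  rw [hη, hηY] at hnul
  simp only [zero_smul, sub_zero, smul_zero, add_zero] at hnul
  have n1 := congrArg (fun w => S.g.inner q w (X q)) hnul
  have n2 := congrArg (fun w => S.g.inner q w (Y q)) hnul
  have n3 := congrArg (fun w => S.g.inner q w (Y q)) (hS.covDeriv_h'_apply_ξ hN q (X q))
  simp only [map_sub, sub_apply, map_zero, zero_apply] at n1 n2
  rw [hS.inner_covDeriv_h' (a := -l) (b := l) hYq hls.neg hhY (hh q),
    hS.inner_covDeriv_h' (a := l) (b := l) hXq hls hh (hh q), hdl, hηY, hYX] at n1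
  rw [hS.inner_covDeriv_h' (a := -l) (b := -l) hYq hls.neg hhY (hhY q),
    hS.inner_covDeriv_h' (a := l) (b := -l) hXq hls hh (hhY q), hdl', hη, hXY] at n2
  rw [hS.inner_covDeriv_h' (a := l) (b := -l) hXq hls hh (hhY q), hh, hXY] at n3
  have hl2 : -l q - l q ≠ 0 := by linarith
  have hl2' : l q - -l q ≠ 0 := by linarith
  have m1 : S.g.inner q (leviCivita S.g Y q (X q)) (X q) = 0 := by
    refine (mul_eq_zero.1 (?_ : (-l q - l q) * _ = 0)).resolve_left hl2
    simpa using n1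
  have m2 : S.g.inner q (leviCivita S.g X q (Y q)) (Y q) = 0 := by
    refine (mul_eq_zero.1 (?_ : (l q - -l q) * _ = 0)).resolve_left hl2'
    simpa using n2
  have m3 : S.g.inner q (leviCivita S.g X q (S.ξ q)) (Y q) = 0 := by
    refine (mul_eq_zero.1 (?_ : (l q - -l q) * _ = 0)).resolve_left hl2'
    simpa [hXY] using n3
  have dconst : ∀ {A B : ∀ p : M, TangentSpace 𝓘(ℝ, E) p} {r : ℝ}, MDiffAt (T% A) q →
      MDiffAt (T% B) q → (∀ q ∈ U, S.g.inner q (A q) (B q) = r) →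
      ∀ v, S.g.inner q (leviCivita S.g A q v) (B q) + S.g.inner q (A q) (leviCivita S.g B q v)
        = 0 := by
    intro A B r hA hB hAB v
    rw [← mvfderiv_inner S.g hA hB, mvfderiv_congr (G := fun _ => r)
      (by filter_upwards [hU.mem_nhds hq] with y hy using hAB y hy), mvfderiv_const, zero_apply]
  have dXX := dconst hXq hXq hnorm
  have dYY := dconst hYq hYq hYnorm
  have dXY := dconst hXq hYq (fun q _ => hXY q)
  have dXξ := dconst hXq hξq (r := 0) (fun q _ => by rw [S.inner_ξ_right, hη])
  have dYξ := dconst hYq hξq (r := 0) (fun q _ => by rw [S.inner_ξ_right, hηY])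
  -- By linearity it is enough to take `v = X, Y, ξ`; for `v = X` the derivative is moved from `X`
  -- to `Y` by orthogonality.
  have cXY : ∀ v, S.g.inner q (leviCivita S.g X q v) (Y q) = 0 := by
    intro v
    have h0 := dXY (X q)
    rw [S.g.symm q (X q), m1, add_zero] at h0
    rw [hexp v]
    simp only [map_add, map_smul, add_apply, smul_apply]
    change _ • _ + _ • S.g.inner q (leviCivita S.g X q (Y q)) (Y q) + _ = _
    rw [h0, m2, m3]
    simp
  have cYX : S.g.inner q (X q) (leviCivita S.g Y q v) = 0 := by
    have := dXY v
    rwa [cXY, zero_add] at this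
  constructor
  -- Only the `ξ`-component survives. Differentiating `g(X, ξ) = 0` gives it as `-g(X, ∇_v ξ)`,
  -- where `h'` contributes the eigenvalue; for `Y` the eigenvalue is `-λ`.
  · rw [hexp (leviCivita S.g X q v)]
    have h1 := dXX v
    have h2 := dXξ v
    have h3 := cXY v
    rw [S.g.symm q (X q)] at h1
    rw [S.g.symm] at h3
    rw [S.inner_ξ_right, hS.leviCivita_ξ, map_add, map_sub, map_smul, S.inner_ξ_right, hη,
      ← hS.inner_h', hh, map_smul, smul_apply] at h2
    simp only [smul_eq_mul] at h2
    have h4 : S.g.inner q (X q) (leviCivita S.g X q v) = 0 := by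
      rw [S.g.symm]; linarith
    have h5 : S.η q (leviCivita S.g X q v) = -((1 + l q) * S.g.inner q (X q) v) := by
      rw [hl]
      linarith
    rw [h4, h3, h5, zero_smul, zero_smul, zero_add, zero_add]
  · rw [hexp (leviCivita S.g Y q v)]
    have h1 := dYY v
    have h2 := dYξ v
    rw [S.g.symm q (Y q)] at h1
    rw [S.inner_ξ_right, hS.leviCivita_ξ, map_add, map_sub, map_smul, S.inner_ξ_right, hηY,
      ← hS.inner_h', hhY, map_smul, smul_apply] at h2
    simp only [smul_eq_mul, Pi.neg_apply] at h2
    have h4 : S.g.inner q (S.φ q (X q)) (leviCivita S.g Y q v) = 0 := by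
      rw [S.g.symm]
      change S.g.inner q (leviCivita S.g Y q v) (Y q) = 0
      linarith
    have h5 : S.η q (leviCivita S.g Y q v) = -((1 - l q) * S.g.inner q (S.φ q (X q)) v) := by
      change _ = -((1 - l q) * S.g.inner q (Y q) v)
      linarith
    rw [cYX, h4, h5, zero_smul, zero_smul, zero_add, zero_add]

end AlmostContactMetric.IsAlmostKenmotsu

/-! ### Charts from functions with independent differentials, and functions of one coordinate. -/

section ChartOfFunctions

variable {E : Type*} [NormedAddCommGroup E] [NormedSpace ℝ E] [CompleteSpace E]
  {M : Type*} [TopologicalSpace M] [ChartedSpace E M] [IsManifold 𝓘(ℝ, E) ∞ M]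

/-- A smooth map to the model space with invertible differential is a chart near each point. -/
theorem exists_chart_of_isInvertible_mfderiv {V : Set M} (hV : IsOpen V) {p : M} (hp : p ∈ V)
    {x : M → E} (hx : ∀ q ∈ V, ContMDiffAt 𝓘(ℝ, E) 𝓘(ℝ, E) ∞ x q)
    (hinv : ∀ q ∈ V, (mfderiv 𝓘(ℝ, E) 𝓘(ℝ, E) x q).IsInvertible) :
    ∃ e ∈ IsManifold.maximalAtlas 𝓘(ℝ, E) ∞ M, p ∈ e.source ∧ e.source ⊆ V ∧
      (∃ r, e.target = Metric.ball (e p) r) ∧ ∀ q ∈ e.source, e q = x q := by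
  let c := chartAt E p
  have hc : c ∈ IsManifold.maximalAtlas 𝓘(ℝ, E) ∞ M := IsManifold.chart_mem_maximalAtlas p
  have hcd := mdifferentiable_of_mem_maximalAtlas hc
  have hpc : p ∈ c.source := mem_chart_source E p
  let G : E → E := x ∘ c.symm
  have hG : ∀ q ∈ V, q ∈ c.source → ContDiffAt ℝ ∞ G (c q) := fun q hq hqc => by
    have h1 : ContMDiffAt 𝓘(ℝ, E) 𝓘(ℝ, E) ∞ G (c q) := ContMDiffAt.comp (c q)
      (by rw [c.left_inv hqc]; exact hx q hq)
      (contMDiffAt_symm_of_mem_maximalAtlas hc (c.map_source hqc))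
    exact h1.contDiffAt
  have hG' : ∀ q ∈ V, q ∈ c.source → ∃ L : E ≃L[ℝ] E, HasFDerivAt G (L : E →L[ℝ] E) (c q) := by
    intro q hq hqc
    obtain ⟨A, hA⟩ := hinv q hq
    let D : E ≃L[ℝ] E := hcd.mfderiv hqc
    refine ⟨D.symm.trans A, ?_⟩
    have h1 : HasMFDerivAt 𝓘(ℝ, E) 𝓘(ℝ, E) x (c.symm (c q)) (mfderiv 𝓘(ℝ, E) 𝓘(ℝ, E) x q) := by
      rw [c.left_inv hqc]
      exact ((hx q hq).mdifferentiableAt (by simp)).hasMFDerivAt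
    have h2 := h1.comp (c q) (hcd.mdifferentiableAt_symm (c.map_source hqc)).hasMFDerivAt
    refine h2.hasFDerivAt.congr_fderiv ?_
    rw [← hA]
    have h4 := hcd.comp_symm_deriv (c.map_source hqc)
    ext v
    have h5 := DFunLike.congr_fun h4 v
    rw [c.left_inv hqc] at h5
    exact congrArg A (D.injective (h5.trans (D.apply_symm_apply v).symm))
  obtain ⟨L, hL⟩ := hG' p hp hpc
  -- The inverse function theorem for the map read in the chart `c`.
  let T := (hG p hp hpc).toOpenPartialHomeomorph G hL (by simp)
  have hTc : (T : E → E) = G := rfl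
  have hTp : c p ∈ T.source := ContDiffAt.mem_toOpenPartialHomeomorph_source _ _ _
  let e₁ := (c.trans T).restrOpen V hV
  have hp₁ : p ∈ e₁.source := ⟨⟨hpc, hTp⟩, hp⟩
  obtain ⟨r, hr, hball⟩ := Metric.isOpen_iff.1 e₁.open_target (e₁ p) (e₁.map_source hp₁)
  -- Shrinking the target to a ball makes it convex and lets a function with differential a multiple
  -- of `dxⁱ` depend on `xⁱ` alone on the whole domain.
  let e := e₁.trans (OpenPartialHomeomorph.ofSet (Metric.ball (e₁ p) r) Metric.isOpen_ball)
  have hesub : ∀ q ∈ e.source, (q ∈ c.source ∧ c q ∈ T.source) ∧ q ∈ V := fun q hq => hq.1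
  have hex : ∀ q ∈ e.source, e q = x q := fun q hq => by
    change G (c q) = x q
    simp [G, c.left_inv (hesub q hq).1.1]
  refine ⟨e, OpenPartialHomeomorph.mem_maximalAtlas_of_contMDiffOn _ ?_ ?_, ?_, ?_, ⟨r, ?_⟩, hex⟩
  · intro q hq
    refine ContMDiffAt.contMDiffWithinAt ?_
    refine (hx q (hesub q hq).2).congr_of_eventuallyEq ?_
    filter_upwards [e.open_source.mem_nhds hq] with y hy using hex y hy
  · intro y hy
    refine ContMDiffAt.contMDiffWithinAt ?_
    have hq := e.map_target hy
    set q := e.symm y with hqdef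
    obtain ⟨⟨hqc, hqT⟩, hqV⟩ := hesub q hq
    have hyT : y = T (c q) := (e.right_inv hy).symm
    have hyt : y ∈ T.target := by rw [hyT]; exact T.map_source hqT
    have hTs : T.symm y = c q := by rw [hyT, T.left_inv hqT]
    -- Smoothness of the inverse away from the image of `p` uses the invertible differential at the
    -- point concerned.
    obtain ⟨L', hL'⟩ := hG' q hqV hqc
    have h1 : ContDiffAt ℝ ∞ T.symm y :=
      T.contDiffAt_symm hyt (f₀' := L') (by rw [hTs]; exact hL') (by rw [hTs]; exact hG q hqV hqc)
    exact ContMDiffAt.comp (g := c.symm) (f := T.symm) y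
      (contMDiffAt_symm_of_mem_maximalAtlas hc (by rw [hTs]; exact c.map_source hqc)) h1.contMDiffAt
  · exact ⟨hp₁, Metric.mem_ball_self hr⟩
  · exact fun q hq => (hesub q hq).2
  · ext y
    exact ⟨fun h => h.1, fun h => ⟨h, hball h⟩⟩

end ChartOfFunctions

section EuclideanCoordinates

variable {ι : Type*} [Fintype ι]
  {M : Type*} [TopologicalSpace M] [ChartedSpace (EuclideanSpace ℝ ι) M]

theorem mvfderiv_coord {x : M → EuclideanSpace ℝ ι} {q : M}
    (hx : MDifferentiableAt 𝓘(ℝ, EuclideanSpace ℝ ι) 𝓘(ℝ, EuclideanSpace ℝ ι) x q) (i : ι)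
    (w : TangentSpace 𝓘(ℝ, EuclideanSpace ℝ ι) q) :
    mvfderiv 𝓘(ℝ, EuclideanSpace ℝ ι) (fun q => x q i) q w
      = (show EuclideanSpace ℝ ι from
          mfderiv 𝓘(ℝ, EuclideanSpace ℝ ι) 𝓘(ℝ, EuclideanSpace ℝ ι) x q w) i := by
  have h := mvfderiv_comp_apply (I := 𝓘(ℝ, EuclideanSpace ℝ ι)) (I' := 𝓘(ℝ, EuclideanSpace ℝ ι))
    (f := x) (g := (EuclideanSpace.proj i : EuclideanSpace ℝ ι →L[ℝ] ℝ)) (v := w) q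
    (EuclideanSpace.proj i : EuclideanSpace ℝ ι →L[ℝ] ℝ).differentiableAt.mdifferentiableAt hx
  refine h.trans ?_
  change mfderiv 𝓘(ℝ, EuclideanSpace ℝ ι) 𝓘(ℝ, ℝ)
    (EuclideanSpace.proj i : EuclideanSpace ℝ ι →L[ℝ] ℝ) (x q) _ = _
  rw [mfderiv_eq_fderiv, ContinuousLinearMap.fderiv]
  rfl

variable [DecidableEq ι]

/-- A function on a ball whose differential is a multiple of that of a coordinate is a function
of this coordinate. -/
theorem exists_eq_comp_coord_of_hasFDerivAt {x₀ : EuclideanSpace ℝ ι} {r : ℝ} (i : ι)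
    {F c : EuclideanSpace ℝ ι → ℝ}
    (hF : ∀ y ∈ Metric.ball x₀ r,
      HasFDerivAt F (c y • (EuclideanSpace.proj i : EuclideanSpace ℝ ι →L[ℝ] ℝ)) y) :
    ∃ G : ℝ → ℝ, ∀ y ∈ Metric.ball x₀ r, F y = G (y i) ∧ HasDerivAt G (c y) (y i) := by
  -- `P s` is the point with `i`-th coordinate `s` on the axis through the centre. It stays in the
  -- ball because `|yᵢ - x₀ᵢ| ≤ ‖y - x₀‖`.
  let P : ℝ → EuclideanSpace ℝ ι := fun s => x₀ + (s - x₀ i) • EuclideanSpace.single i 1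
  have hPi : ∀ s, (P s) i = s := fun s => by simp [P]
  have hP : ∀ y ∈ Metric.ball x₀ r, P (y i) ∈ Metric.ball x₀ r := by
    intro y hy
    rw [mem_ball_iff_norm] at hy ⊢
    refine lt_of_le_of_lt ?_ hy
    have h1 := PiLp.norm_apply_le (y - x₀) i
    simpa [P, norm_smul] using h1
  have heq : ∀ y ∈ Metric.ball x₀ r, F y = F (P (y i)) := by
    intro y hy
    let γ : ℝ → EuclideanSpace ℝ ι := fun τ => y + τ • (P (y i) - y)
    have hγ : ∀ τ ∈ Icc (0 : ℝ) 1, γ τ ∈ Metric.ball x₀ r := fun τ hτ =>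
      (convex_ball x₀ r).add_smul_sub_mem hy (hP y hy) hτ
    have hd : ∀ τ ∈ Icc (0 : ℝ) 1, HasDerivAt (F ∘ γ) 0 τ := by
      intro τ hτ
      have h1 : HasDerivAt γ (P (y i) - y) τ := by
        have := ((hasDerivAt_id τ).smul_const (P (y i) - y)).const_add y
        rwa [one_smul] at this
      refine ((hF _ (hγ τ hτ)).comp_hasDerivAt τ h1).congr_deriv ?_
      simp [hPi]
    have h3 := constant_of_has_deriv_right_zero (f := F ∘ γ) (a := 0) (b := 1)
      (fun τ hτ => (hd τ hτ).continuousAt.continuousWithinAt)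
      (fun τ hτ => (hd τ ⟨hτ.1, hτ.2.le⟩).hasDerivWithinAt) 1 (by simp)
    simpa [γ] using h3.symm
  refine ⟨F ∘ P, fun y hy => ⟨heq y hy, ?_⟩⟩
  -- Differentiating `F ∘ P` directly would give `c (P (y i))`. Near `y i` it agrees with `F` on the
  -- line through `y` itself, and this gives `c y`.
  let Q : ℝ → EuclideanSpace ℝ ι := fun s => y + (s - y i) • EuclideanSpace.single i 1
  have hQi : ∀ s, (Q s) i = s := fun s => by simp [Q]
  have hQy : Q (y i) = y := by simp [Q]
  have hQ : HasDerivAt Q (EuclideanSpace.single i 1) (y i) := by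
    have := (((hasDerivAt_id (y i)).sub_const (y i)).smul_const
      (EuclideanSpace.single i (1 : ℝ))).const_add y
    rwa [one_smul] at this
  have h1 : HasDerivAt (F ∘ Q) (c y) (y i) := by
    have h2 := HasFDerivAt.comp_hasDerivAt (y i) (l := F) (by rw [hQy]; exact hF y hy) hQ
    refine h2.congr_deriv ?_
    simp
  refine h1.congr_of_eventuallyEq ?_
  have h3 : ∀ᶠ s in 𝓝 (y i), Q s ∈ Metric.ball x₀ r :=
    hQ.continuousAt (Metric.isOpen_ball.mem_nhds (by rwa [hQy]))
  filter_upwards [h3] with s hs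
  have := heq _ hs
  rw [hQi] at this
  exact this.symm

/-- Smooth functions with independent differentials are the coordinates of a chart near each
point. -/
theorem exists_chart_of_injective [IsManifold 𝓘(ℝ, EuclideanSpace ℝ ι) ∞ M] {V : Set M}
    (hV : IsOpen V) {p : M} (hp : p ∈ V) {x : ι → M → ℝ}
    (hx : ∀ i, ∀ q ∈ V, ContMDiffAt 𝓘(ℝ, EuclideanSpace ℝ ι) 𝓘(ℝ, ℝ) ∞ (x i) q)
    (hinj : ∀ q ∈ V, ∀ w, (∀ i, mvfderiv 𝓘(ℝ, EuclideanSpace ℝ ι) (x i) q w = 0) → w = 0) :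
    ∃ e ∈ IsManifold.maximalAtlas 𝓘(ℝ, EuclideanSpace ℝ ι) ∞ M, p ∈ e.source ∧ e.source ⊆ V ∧
      (∃ r, e.target = Metric.ball (e p) r) ∧ ∀ q ∈ e.source, ∀ i, e q i = x i q := by
  let X : M → EuclideanSpace ℝ ι := fun q => ∑ i, x i q • EuclideanSpace.single i (1 : ℝ)
  have hXi : ∀ q i, X q i = x i q := fun q i => by simp [X, Pi.single_apply]
  have hX : ∀ q ∈ V, ContMDiffAt 𝓘(ℝ, EuclideanSpace ℝ ι) 𝓘(ℝ, EuclideanSpace ℝ ι) ∞ X q :=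
    fun q hq => contMDiffAt_finsetSum fun i _ => (hx i q hq).smul contMDiffAt_const
  obtain ⟨e, he, h1, h2, h3, h4⟩ := exists_chart_of_isInvertible_mfderiv hV hp hX (by
    intro q hq
    let D : EuclideanSpace ℝ ι →L[ℝ] EuclideanSpace ℝ ι :=
      mfderiv 𝓘(ℝ, EuclideanSpace ℝ ι) 𝓘(ℝ, EuclideanSpace ℝ ι) X q
    have hD : Function.Injective D := by
      rw [injective_iff_map_eq_zero]
      intro w hw
      refine hinj q hq w fun i => ?_
      have h5 := mvfderiv_coord ((hX q hq).mdifferentiableAt (by simp)) i w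
      simp only [hXi] at h5
      rw [h5]
      change (D w) i = 0
      rw [hw]
      rfl
    exact ⟨(LinearEquiv.ofInjectiveEndo D.toLinearMap hD).toContinuousLinearEquiv, by ext v; rfl⟩)
  exact ⟨e, he, h1, h2, h3, fun q hq i => by rw [h4 q hq, hXi]⟩

end EuclideanCoordinates

/-! ### The coordinate frame and coframe of a chart. -/

section CoordinateFrame

variable {M : Type*} [TopologicalSpace M] [ChartedSpace (EuclideanSpace ℝ (Fin 3)) M]
  {e : OpenPartialHomeomorph M (EuclideanSpace ℝ (Fin 3))}

theorem coordDiff_apply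
    (he : e ∈ IsManifold.maximalAtlas 𝓘(ℝ, EuclideanSpace ℝ (Fin 3)) ∞ M) {q : M}
    (hq : q ∈ e.source) (i : Fin 3) (w : TangentSpace 𝓘(ℝ, EuclideanSpace ℝ (Fin 3)) q) :
    coordDiff e i q w = (show EuclideanSpace ℝ (Fin 3) from
      mfderiv 𝓘(ℝ, EuclideanSpace ℝ (Fin 3)) 𝓘(ℝ, EuclideanSpace ℝ (Fin 3)) e q w) i :=
  mvfderiv_coord ((mdifferentiable_of_mem_maximalAtlas he).mdifferentiableAt hq) i w

theorem coordDiff_coordField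
    (he : e ∈ IsManifold.maximalAtlas 𝓘(ℝ, EuclideanSpace ℝ (Fin 3)) ∞ M) {q : M}
    (hq : q ∈ e.source) (i : Fin 3) (v : EuclideanSpace ℝ (Fin 3)) :
    coordDiff e i q (coordField e v q) = v i := by
  rw [coordDiff_apply he hq, mfderiv_coordField he hq]

theorem coordDiff_coordVec
    (he : e ∈ IsManifold.maximalAtlas 𝓘(ℝ, EuclideanSpace ℝ (Fin 3)) ∞ M) {q : M}
    (hq : q ∈ e.source) (i j : Fin 3) :
    coordDiff e i q (coordVec e j q) = if i = j then 1 else 0 := by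
  refine (coordDiff_coordField he hq i _).trans ?_
  simp

theorem coordField_eq_sum (v : EuclideanSpace ℝ (Fin 3)) (q : M) :
    coordField e v q
      = v 0 • coordVec e 0 q + v 1 • coordVec e 1 q + v 2 • coordVec e 2 q := by
  have hv : v = v 0 • EuclideanSpace.single 0 (1 : ℝ) + v 1 • EuclideanSpace.single 1 (1 : ℝ)
      + v 2 • EuclideanSpace.single 2 (1 : ℝ) := by
    ext i
    fin_cases i <;> simp
  set L : EuclideanSpace ℝ (Fin 3) →L[ℝ] TangentSpace 𝓘(ℝ, EuclideanSpace ℝ (Fin 3)) q :=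
    (mfderiv 𝓘(ℝ, EuclideanSpace ℝ (Fin 3)) 𝓘(ℝ, EuclideanSpace ℝ (Fin 3)) e q).inverse
  change L v = v 0 • L _ + v 1 • L _ + v 2 • L _
  conv_lhs => rw [hv]
  simp only [map_add, map_smul]

theorem eq_sum_coordVec
    (he : e ∈ IsManifold.maximalAtlas 𝓘(ℝ, EuclideanSpace ℝ (Fin 3)) ∞ M) {q : M}
    (hq : q ∈ e.source) (w : TangentSpace 𝓘(ℝ, EuclideanSpace ℝ (Fin 3)) q) :
    w = coordDiff e 0 q w • coordVec e 0 q + coordDiff e 1 q w • coordVec e 1 q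
      + coordDiff e 2 q w • coordVec e 2 q := by
  have h := coordField_eq_sum (e := e) (show EuclideanSpace ℝ (Fin 3) from
    mfderiv 𝓘(ℝ, EuclideanSpace ℝ (Fin 3)) 𝓘(ℝ, EuclideanSpace ℝ (Fin 3)) e q w) q
  rw [← coordDiff_apply he hq, ← coordDiff_apply he hq, ← coordDiff_apply he hq] at h
  rw [← h]
  exact (coordField_mfderiv he hq w).symm

/-- A function whose differential is a multiple of `dxⁱ` is a function of the coordinate `xⁱ`. -/
theorem exists_eq_comp_coord
    (he : e ∈ IsManifold.maximalAtlas 𝓘(ℝ, EuclideanSpace ℝ (Fin 3)) ∞ M)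
    {x₀ : EuclideanSpace ℝ (Fin 3)} {r : ℝ} (ht : e.target = Metric.ball x₀ r) (i : Fin 3)
    {F c : M → ℝ} (hF : ∀ q ∈ e.source,
      MDifferentiableAt 𝓘(ℝ, EuclideanSpace ℝ (Fin 3)) 𝓘(ℝ, ℝ) F q ∧
      ∀ v, mvfderiv 𝓘(ℝ, EuclideanSpace ℝ (Fin 3)) F q v = c q * coordDiff e i q v) :
    ∃ G : ℝ → ℝ, ∀ q ∈ e.source, F q = G (e q i) ∧ HasDerivAt G (c q) (e q i) := by
  obtain ⟨G, hG⟩ := exists_eq_comp_coord_of_hasFDerivAt (x₀ := x₀) (r := r) i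
    (F := F ∘ e.symm) (c := c ∘ e.symm) (by
      intro y hy
      rw [← ht] at hy
      have hq := e.map_target hy
      obtain ⟨h1, h2⟩ := hF _ hq
      have h3 := (differentiableAt_comp_symm he hq h1).hasFDerivAt
      rw [e.right_inv hy] at h3
      refine h3.congr_fderiv ?_
      ext v
      have h4 := fderiv_comp_symm he hq h1 v
      rw [e.right_inv hy, h2, coordDiff_coordField he hq] at h4
      exact h4)
  refine ⟨G, fun q hq => ?_⟩
  have h := hG (e q) (by rw [← ht]; exact e.map_source hq)
  simpa [e.left_inv hq] using h

theorem eq_coordEndo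
    (he : e ∈ IsManifold.maximalAtlas 𝓘(ℝ, EuclideanSpace ℝ (Fin 3)) ∞ M) {q : M}
    (hq : q ∈ e.source)
    (L : TangentSpace 𝓘(ℝ, EuclideanSpace ℝ (Fin 3)) q →L[ℝ]
      TangentSpace 𝓘(ℝ, EuclideanSpace ℝ (Fin 3)) q) (A : Matrix (Fin 2) (Fin 2) ℝ)
    (h0 : L (coordVec e 0 q) = A 0 0 • coordVec e 0 q + A 1 0 • coordVec e 1 q)
    (h1 : L (coordVec e 1 q) = A 0 1 • coordVec e 0 q + A 1 1 • coordVec e 1 q)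
    (h2 : L (coordVec e 2 q) = 0) (v : TangentSpace 𝓘(ℝ, EuclideanSpace ℝ (Fin 3)) q) :
    L v = coordEndo e A q v := by
  conv_lhs => rw [eq_sum_coordVec he hq v]
  simp only [map_add, map_smul, h0, h1, h2, coordEndo, Fin.sum_univ_two, Fin.castSucc_zero,
    Fin.castSucc_one]
  module

end CoordinateFrame

/-! ### Closed multiples of the eigencoframe and the adapted coordinates. -/

namespace AlmostContactMetric.IsAlmostKenmotsu

section Primitives

variable {E : Type*} [NormedAddCommGroup E] [NormedSpace ℝ E] [FiniteDimensional ℝ E]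
  {M : Type*} [TopologicalSpace M] [ChartedSpace E M] [IsManifold 𝓘(ℝ, E) ∞ M]
  {S : AlmostContactMetric E M}

/-- The form `c g(X, ·)` has a primitive if `∇X = -a g(X, ·) ξ` and `dc = -a c η`. -/
theorem exists_primitive_of_leviCivita {U : Set M} (hU : IsOpen U) {p : M}
    (hp : p ∈ U) {c a : M → ℝ} {X : ∀ p : M, TangentSpace 𝓘(ℝ, E) p} (hX : IsSmoothField X)
    (hc : ∀ q ∈ U, CMDiffAt ∞ c q)
    (hdc : ∀ q ∈ U, ∀ v, mvfderiv 𝓘(ℝ, E) c q v = -(a q * c q) * S.η q v)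
    (hdX : ∀ q ∈ U, ∀ v, leviCivita S.g X q v = -(a q * S.g.inner q (X q) v) • S.ξ q) :
    ∃ V ⊆ U, IsOpen V ∧ p ∈ V ∧ ∃ x : M → ℝ, ∀ q ∈ V, CMDiffAt ∞ x q ∧
      ∀ v, mvfderiv 𝓘(ℝ, E) x q v = c q * S.g.inner q (X q) v :=
  -- Both sides of the closedness condition equal `-ac(η(v)g(X,w) + η(w)g(X,v))`.
  exists_primitive S.g hU hp hc (fun q _ => hX q) (by
    intro q hq v w
    simp only [hdc q hq, hdX q hq, map_smul, smul_apply, smul_eq_mul, S.inner_ξ_left]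
    ring)

variable [T2Space M]

/-- The form `c η` has a primitive if `dc` is a multiple of `η`. -/
theorem exists_primitive_η (hS : S.IsAlmostKenmotsu) {U : Set M} (hU : IsOpen U) {p : M}
    (hp : p ∈ U) {c a : M → ℝ} (hc : ∀ q ∈ U, CMDiffAt ∞ c q)
    (hdc : ∀ q ∈ U, ∀ v, mvfderiv 𝓘(ℝ, E) c q v = a q * S.η q v) :
    ∃ V ⊆ U, IsOpen V ∧ p ∈ V ∧ ∃ t : M → ℝ, ∀ q ∈ V, CMDiffAt ∞ t q ∧
      ∀ v, mvfderiv 𝓘(ℝ, E) t q v = c q * S.η q v := by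
  -- Closedness holds because `∇ξ` is symmetric and `dc` is proportional to `η`.
  obtain ⟨V, hVU, hV, hpV, t, ht⟩ := exists_primitive S.g hU hp hc
    (fun q _ => S.contMDiff_ξ q) (by
      intro q hq v w
      simp only [hdc q hq, S.inner_ξ_left, hS.leviCivita_ξ, map_add, map_sub, map_smul, add_apply,
        sub_apply, smul_apply, smul_eq_mul]
      rw [hS.inner_h', S.g.symm q v w, S.g.symm q v (S.h' q w)]
      ring)
  exact ⟨V, hVU, hV, hpV, t, fun q hq => ⟨(ht q hq).1, fun v => by
    rw [(ht q hq).2, S.inner_ξ_left]⟩⟩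

end Primitives

variable {M : Type*} [TopologicalSpace M] [ChartedSpace (EuclideanSpace ℝ (Fin 3)) M]
  [IsManifold 𝓘(ℝ, EuclideanSpace ℝ (Fin 3)) ∞ M] [T2Space M]
  {S : AlmostContactMetric (EuclideanSpace ℝ (Fin 3)) M} {k μ F : M → ℝ}

/-- Coordinates whose coordinate fields are multiples of `φ X`, `X` and `ξ`, for a unit
eigenvector field `X` of `h'`. -/
theorem exists_adapted_chart (hS : S.IsAlmostKenmotsu) (hN : S.GeneralizedNullity' k μ)
    (hFs : ContMDiff 𝓘(ℝ, EuclideanSpace ℝ (Fin 3)) 𝓘(ℝ, ℝ) ∞ F)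
    (hF : ∀ p, k p = -1 - Real.exp (-2 * F p))
    (hdF : ∀ (p : M) (v : TangentSpace 𝓘(ℝ, EuclideanSpace ℝ (Fin 3)) p),
      mvfderiv 𝓘(ℝ, EuclideanSpace ℝ (Fin 3)) F p v = (μ p + 2) * S.η p v) (p : M) :
    ∃ e ∈ IsManifold.maximalAtlas 𝓘(ℝ, EuclideanSpace ℝ (Fin 3)) ∞ M, p ∈ e.source ∧
      ∃ (f u : ℝ → ℝ) (X : ∀ p : M, TangentSpace 𝓘(ℝ, EuclideanSpace ℝ (Fin 3)) p),
        ∀ q ∈ e.source,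
          F q = f (e q 2) ∧ HasDerivAt f (μ q + 2) (e q 2) ∧
          HasDerivAt u (1 + Real.exp (-f (e q 2))) (e q 2) ∧
          S.η q (X q) = 0 ∧ S.g.inner q (X q) (X q) = 1 ∧
          S.h' q (X q) = Real.exp (-f (e q 2)) • X q ∧
          S.ξ q = coordVec e 2 q ∧ S.η q = coordDiff e 2 q ∧
          coordVec e 1 q = Real.exp (u (e q 2)) • X q ∧
          coordVec e 0 q = Real.exp (2 * e q 2 - u (e q 2)) • S.φ q (X q) := by
  have hE : Module.finrank ℝ (EuclideanSpace ℝ (Fin 3)) = 3 := by simp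
  obtain ⟨X, hX, hηX, hhX, U, hU, hpU, hXX⟩ := hS.exists_eigenField hN (by simp) hFs hF p
  have hframe := fun q hq => eq_of_inner_frame (S := S) hE (hηX q) (hXX q hq)
  have hder := fun q (hq : q ∈ U) => hS.leviCivita_eigenField hN hE hFs hdF hX hηX hhX hU hXX hq
  obtain ⟨V₁, hV₁, hV₁o, hp₁, t, ht⟩ := hS.exists_primitive_η hU hpU (c := fun _ => 1)
    (a := fun _ => 0) (fun q _ => contMDiffAt_const) (fun q _ v => by
      rw [mvfderiv_const, zero_apply, zero_mul])
  have hexp : ∀ {x : M → ℝ} {q : M}, ContMDiffAt 𝓘(ℝ, EuclideanSpace ℝ (Fin 3)) 𝓘(ℝ, ℝ) ∞ x q →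
      ContMDiffAt 𝓘(ℝ, EuclideanSpace ℝ (Fin 3)) 𝓘(ℝ, ℝ) ∞ (fun q => Real.exp (x q)) q :=
    fun {x q} hx => Real.contDiff_exp.contMDiff.contMDiffAt.comp q hx
  have hdexp : ∀ {x : M → ℝ} {q : M}, ContMDiffAt 𝓘(ℝ, EuclideanSpace ℝ (Fin 3)) 𝓘(ℝ, ℝ) ∞ x q →
      ∀ v,
      mvfderiv 𝓘(ℝ, EuclideanSpace ℝ (Fin 3)) (fun q => Real.exp (x q)) q v
        = Real.exp (x q) * mvfderiv 𝓘(ℝ, EuclideanSpace ℝ (Fin 3)) x q v := fun {x q} hx v =>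
    mvfderiv_comp_real (Real.hasDerivAt_exp _) (hx.mdifferentiableAt (by simp)) v
  -- `du = (1+λ)η` is chosen so that `c = e^{-u}` satisfies `dc = -(1+λ)cη`, the equation that
  -- closes `c g(X,·)`.
  obtain ⟨V₂, hV₂, hV₂o, hp₂, u, hu⟩ := hS.exists_primitive_η hV₁o hp₁
    (c := (fun _ => 1) + fun q => Real.exp (-F q)) (a := fun q => -(μ q + 2) * Real.exp (-F q))
    (fun q _ => contMDiffAt_const.add (hexp (hFs q).neg)) (fun q _ v => by
      rw [mvfderiv_add mdifferentiableAt_const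
        ((hexp (hFs q).neg).mdifferentiableAt (by simp)), mvfderiv_const, zero_add,
        mvfderiv_exp_neg hFs hdF])
  have hdu : ∀ q ∈ V₂, ∀ v, mvfderiv 𝓘(ℝ, EuclideanSpace ℝ (Fin 3)) u q v
      = (1 + Real.exp (-F q)) * S.η q v := fun q hq => (hu q hq).2
  have hdt : ∀ q ∈ V₂, ∀ v, mvfderiv 𝓘(ℝ, EuclideanSpace ℝ (Fin 3)) t q v = S.η q v :=
    fun q hq v => by rw [(ht q (hV₂ hq)).2, one_mul]
  obtain ⟨V₃, hV₃, hV₃o, hp₃, x₁, hx₁⟩ := exists_primitive_of_leviCivita (S := S) hV₂o hp₂ hX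
    (c := fun q => Real.exp (-u q)) (a := fun q => 1 + Real.exp (-F q))
    (fun q hq => hexp (hu q hq).1.neg) (fun q hq v => by
      rw [hdexp (hu q hq).1.neg]
      change _ * mvfderiv 𝓘(ℝ, EuclideanSpace ℝ (Fin 3)) (-u) q v = _
      rw [mvfderiv_neg, neg_apply, hdu q hq]
      ring) (fun q hq v => (hder q (hV₁ (hV₂ hq)) v).1)
  have hw : ∀ q ∈ V₂, ContMDiffAt 𝓘(ℝ, EuclideanSpace ℝ (Fin 3)) 𝓘(ℝ, ℝ) ∞
      (fun q => u q - 2 * t q) q := fun q hq =>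
    (hu q hq).1.sub (contMDiffAt_const.mul (ht q (hV₂ hq)).1)
  -- Here `d(u - 2t) = -(1-λ)η` matches the covariant derivative of `φX`. The two integrating
  -- factors have product `e^{-2t}`, the reciprocal of `Φ₁₂`.
  obtain ⟨V, hV, hVo, hpV, x₀, hx₀⟩ := exists_primitive_of_leviCivita (S := S) hV₃o hp₃
    (S.isSmoothField_φ hX)
    (c := fun q => Real.exp (u q - 2 * t q)) (a := fun q => 1 - Real.exp (-F q))
    (fun q hq => hexp (hw q (hV₃ hq))) (fun q hq v => by
      have h1 := (hu q (hV₃ hq)).1.mdifferentiableAt (by simp)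
      have h2 := (ht q (hV₂ (hV₃ hq))).1.mdifferentiableAt (by simp)
      rw [hdexp (hw q (hV₃ hq))]
      change _ * mvfderiv 𝓘(ℝ, EuclideanSpace ℝ (Fin 3)) (u - fun q => 2 * t q) q v = _
      have h3 := mvfderiv_comp_real (((hasDerivAt_id (t q)).const_mul 2)) h2 v
      simp only [id] at h3
      have h4 : MDifferentiableAt 𝓘(ℝ, EuclideanSpace ℝ (Fin 3)) 𝓘(ℝ, ℝ) (fun q => 2 * t q) q :=
        mdifferentiableAt_const.mul h2
      rw [mvfderiv_sub h1 h4, sub_apply, h3,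
        hdu q (hV₃ hq), hdt q (hV₃ hq)]
      ring) (fun q hq v => (hder q (hV₁ (hV₂ (hV₃ hq))) v).2)
  have hVU : ∀ {q}, q ∈ V → q ∈ U := fun hq => hV₁ (hV₂ (hV₃ (hV hq)))
  have hV2 : ∀ {q}, q ∈ V → q ∈ V₂ := fun hq => hV₃ (hV hq)
  obtain ⟨e, he, hpe, heV, ⟨r, hr⟩, hex⟩ := exists_chart_of_injective hVo hpV (x := ![x₀, x₁, t])
    (by
      intro i q hq
      fin_cases i
      · exact (hx₀ q hq).1
      · exact (hx₁ q (hV hq)).1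
      · exact (ht q (hV₂ (hV2 hq))).1)
    (by
      intro q hq w h
      have h0 := h 0
      have h1 := h 1
      have h2 := h 2
      simp only [Matrix.cons_val_zero, Matrix.cons_val_one, Matrix.cons_val] at h0 h1 h2
      rw [(hx₀ q hq).2] at h0
      rw [(hx₁ q (hV hq)).2] at h1
      rw [hdt q (hV2 hq)] at h2
      have h0' := (mul_eq_zero.1 h0).resolve_left (Real.exp_pos _).ne'
      have h1' := (mul_eq_zero.1 h1).resolve_left (Real.exp_pos _).ne'
      rw [(hframe q (hVU hq)).2 w, h0', h1', h2]
      simp)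
  have hcd : ∀ i, ∀ q ∈ e.source, coordDiff e i q
      = mvfderiv 𝓘(ℝ, EuclideanSpace ℝ (Fin 3)) ((![x₀, x₁, t] : Fin 3 → M → ℝ) i) q := by
    intro i q hq
    apply mvfderiv_congr
    filter_upwards [e.open_source.mem_nhds hq] with y hy using hex y hy i
  have hc2 : ∀ q ∈ e.source, S.η q = coordDiff e 2 q := fun q hq => by
    rw [hcd 2 q hq]
    ext v
    exact (hdt q (hV2 (heV hq)) v).symm
  obtain ⟨f, hf⟩ := exists_eq_comp_coord he hr 2 (F := F) (c := fun q => μ q + 2)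
    (fun q hq => ⟨(hFs q).mdifferentiableAt (by simp), fun v => by rw [← hc2 q hq, hdF]⟩)
  obtain ⟨u', hu'⟩ := exists_eq_comp_coord he hr 2 (F := u) (c := fun q => 1 + Real.exp (-F q))
    (fun q hq => ⟨(hu q (hV2 (heV hq))).1.mdifferentiableAt (by simp), fun v => by
      rw [← hc2 q hq, hdu q (hV2 (heV hq))]⟩)
  refine ⟨e, he, hpe, f, u', X, fun q hq => ?_⟩
  have hqV := heV hq
  obtain ⟨hf1, hf2⟩ := hf q hq
  obtain ⟨hu1, hu2⟩ := hu' q hq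
  have he2 : e q 2 = t q := hex q hq 2
  have hc1 : ∀ v, S.g.inner q (X q) v = Real.exp (u q) * coordDiff e 1 q v := fun v => by
    have : coordDiff e 1 q v = Real.exp (-u q) * S.g.inner q (X q) v := by
      rw [hcd 1 q hq]
      exact (hx₁ q (hV hqV)).2 v
    rw [this, ← mul_assoc, ← Real.exp_add]
    simp
  have hc0 : ∀ v, S.g.inner q (S.φ q (X q)) v
      = Real.exp (2 * t q - u q) * coordDiff e 0 q v := fun v => by
    have : coordDiff e 0 q v = Real.exp (u q - 2 * t q) * S.g.inner q (S.φ q (X q)) v := by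
      rw [hcd 0 q hq]
      exact (hx₀ q hqV).2 v
    rw [this, ← mul_assoc, ← Real.exp_add]
    simp
  -- The differentials are multiples of the coframe dual to `X, φX, ξ`, so the coordinate fields are
  -- the inverse multiples of this frame.
  have hvec : ∀ j, coordVec e j q
      = (Real.exp (u q) * if (1 : Fin 3) = j then 1 else 0) • X q
        + (Real.exp (2 * t q - u q) * if (0 : Fin 3) = j then 1 else 0) • S.φ q (X q)
        + (if (2 : Fin 3) = j then (1 : ℝ) else 0) • S.ξ q := fun j => by
    have h := (hframe q (hVU hqV)).2 (coordVec e j q)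
    rwa [hc1, hc0, hc2 q hq, coordDiff_coordVec he hq, coordDiff_coordVec he hq,
      coordDiff_coordVec he hq] at h
  rw [← hf1, ← hu1, he2]
  rw [he2] at hf2 hu2
  refine ⟨rfl, hf2, hu2, hηX q, hXX q (hVU hqV), hhX q, ?_, hc2 q hq, ?_, ?_⟩
  · rw [hvec 2]; simp
  · rw [hvec 1]; simp
  · rw [hvec 0]; simp

end AlmostContactMetric.IsAlmostKenmotsu

/-! ### The normal form in adapted coordinates. -/

namespace AlmostContactMetric

section AdaptedCharts

variable {M : Type*} [TopologicalSpace M] [ChartedSpace (EuclideanSpace ℝ (Fin 3)) M]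
  [IsManifold 𝓘(ℝ, EuclideanSpace ℝ (Fin 3)) ∞ M]

/-- The structure has the normal form of generalized `(k, μ)'`-spaces in the chart `e`. -/
def IsNormalFormIn (S : AlmostContactMetric (EuclideanSpace ℝ (Fin 3)) M) (k μ : M → ℝ)
    (e : OpenPartialHomeomorph M (EuclideanSpace ℝ (Fin 3))) (m f : ℝ → ℝ)
    (φ g h B : ℝ → Matrix (Fin 2) (Fin 2) ℝ) : Prop :=
  ∀ q ∈ e.source, ∀ t : ℝ, t = e q 2 →
    μ q = m t ∧
    HasDerivAt f (m t + 2) t ∧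
    k q = -1 - Real.exp (-2 * f t) ∧
    (∀ v, S.φ q v = coordEndo e (φ t) q v) ∧
    S.ξ q = coordVec e 2 q ∧
    S.η q = coordDiff e 2 q ∧
    (∀ v w, S.g.inner q v w =
      coordDiff e 2 q v * coordDiff e 2 q w
        + ∑ i : Fin 2, ∑ j : Fin 2,
            g t i j * (coordDiff e i.castSucc q v * coordDiff e j.castSucc q w)) ∧
    S.Φ q (coordVec e 0 q) (coordVec e 1 q) = Real.exp (2 * t) ∧
    S.Φ q (coordVec e 0 q) (coordVec e 2 q) = 0 ∧
    S.Φ q (coordVec e 1 q) (coordVec e 2 q) = 0 ∧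
    (∀ v, S.h q v = coordEndo e (h t) q v) ∧
    (∀ v, S.h' q v = coordEndo e (B t) q v) ∧
    B t * B t = Real.exp (-2 * f t) • (1 : Matrix (Fin 2) (Fin 2) ℝ) ∧
    (∀ i j, HasDerivAt (fun s => φ s i j) (2 * h t i j) t) ∧
    (∀ i j, HasDerivAt (fun s => B s i j) (-(m t + 2) * B t i j) t) ∧
    (∀ i j, HasDerivAt (fun s => h s i j)
      (2 * Real.exp (-f t) ^ 2 * φ t i j - (m t + 2) * h t i j) t)

variable {S : AlmostContactMetric (EuclideanSpace ℝ (Fin 3)) M} {k μ F : M → ℝ}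

/-- A generalized `(k, μ)'`-structure has its normal form in an adapted chart. -/
theorem IsAlmostKenmotsu.isNormalFormIn [T2Space M] (hS : S.IsAlmostKenmotsu)
    {e : OpenPartialHomeomorph M (EuclideanSpace ℝ (Fin 3))}
    (he : e ∈ IsManifold.maximalAtlas 𝓘(ℝ, EuclideanSpace ℝ (Fin 3)) ∞ M)
    (hF : ∀ p, k p = -1 - Real.exp (-2 * F p)) {f u : ℝ → ℝ}
    {X : ∀ p : M, TangentSpace 𝓘(ℝ, EuclideanSpace ℝ (Fin 3)) p}
    (hX : ∀ q ∈ e.source,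
      F q = f (e q 2) ∧ HasDerivAt f (μ q + 2) (e q 2) ∧
      HasDerivAt u (1 + Real.exp (-f (e q 2))) (e q 2) ∧
      S.η q (X q) = 0 ∧ S.g.inner q (X q) (X q) = 1 ∧
      S.h' q (X q) = Real.exp (-f (e q 2)) • X q ∧
      S.ξ q = coordVec e 2 q ∧ S.η q = coordDiff e 2 q ∧
      coordVec e 1 q = Real.exp (u (e q 2)) • X q ∧
      coordVec e 0 q = Real.exp (2 * e q 2 - u (e q 2)) • S.φ q (X q)) :
    -- The matrices are read off from `∂₀ = e^{2t-u}φX` and `∂₁ = e^u X`, with `h' = λ` on `X` and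
    -- `-λ` on `φX`; for instance `φ∂₁ = e^u φX = e^{2u-2t}∂₀`. The function `m` is recovered from
    -- `f' = μ + 2`.
    S.IsNormalFormIn k μ e (fun s => deriv f s - 2) f
      (fun s => !![0, Real.exp (2 * u s - 2 * s); -Real.exp (2 * s - 2 * u s), 0])
      (fun s => !![Real.exp (4 * s - 2 * u s), 0; 0, Real.exp (2 * u s)])
      (fun s => Real.exp (-f s) •
        !![0, Real.exp (2 * u s - 2 * s); Real.exp (2 * s - 2 * u s), 0])
      (fun s => !![-Real.exp (-f s), 0; 0, Real.exp (-f s)]) := by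
  rintro q hq t rfl
  obtain ⟨hf, hdf, hdu, hηX, hXX, hhX, hξ, hη, hc1, hc0⟩ := hX q hq
  set t := e q 2 with ht
  have hm : deriv f t - 2 + 2 = μ q + 2 := by rw [hdf.deriv]; ring
  have hYX : S.g.inner q (S.φ q (X q)) (X q) = 0 := by
    have := S.inner_φ_left q (X q) (X q)
    rw [S.g.symm q (X q)] at this
    linarith
  have hYY : S.g.inner q (S.φ q (X q)) (S.φ q (X q)) = 1 := by
    rw [S.compatible, hXX, hηX]; ring
  have hφY : S.φ q (S.φ q (X q)) = -X q := by rw [S.φ_sq, hηX]; simp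
  have hhY : S.h' q (S.φ q (X q)) = -(Real.exp (-f t) • S.φ q (X q)) := by
    rw [hS.h'_φ, hhX, map_smul]
  have hE : ∀ {a b : ℝ} {v : TangentSpace 𝓘(ℝ, EuclideanSpace ℝ (Fin 3)) q},
      Real.exp a • Real.exp b • v = Real.exp (a + b) • v := fun {a b v} => by
    rw [smul_smul, Real.exp_add]
  have hg : ∀ v w, S.g.inner q v w = coordDiff e 2 q v * coordDiff e 2 q w
      + (Real.exp (4 * t - 2 * u t) * (coordDiff e 0 q v * coordDiff e 0 q w)
        + Real.exp (2 * u t) * (coordDiff e 1 q v * coordDiff e 1 q w)) := by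
    intro v w
    conv_lhs => rw [eq_sum_coordVec he hq v, eq_sum_coordVec he hq w]
    have hXY : S.g.inner q (X q) (S.φ q (X q)) = 0 := by rw [S.g.symm, hYX]
    simp only [hc0, hc1, ← hξ, map_add, map_smul, add_apply, smul_apply, smul_eq_mul, hXX, hYX,
      hYY, hXY, S.inner_ξ_left, S.inner_ξ_right, hηX, S.η_φ, S.η_ξ]
    rw [show 4 * t - 2 * u t = (2 * t - u t) + (2 * t - u t) by ring,
      show 2 * u t = u t + u t by ring, Real.exp_add, Real.exp_add]
    ring
  -- As `u' = 1 + λ`, the exponent `2u - 2t` has derivative `2λ`; this is the origin of `φ' = 2h`.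
  have h2 : HasDerivAt (fun s => 2 * u s - 2 * s) (2 * Real.exp (-f t)) t := by
    refine ((hdu.const_mul 2).sub ((hasDerivAt_id t).const_mul 2)).congr_deriv ?_
    ring
  have h2' : HasDerivAt (fun s => 2 * s - 2 * u s) (-(2 * Real.exp (-f t))) t := by
    refine (((hasDerivAt_id t).const_mul 2).sub (hdu.const_mul 2)).congr_deriv ?_
    ring
  have hl : HasDerivAt (fun s => Real.exp (-f s)) (Real.exp (-f t) * -(μ q + 2)) t := hdf.neg.exp
  refine ⟨?_, ?_, ?_, ?_, hξ, hη, ?_, ?_, ?_, ?_, ?_, ?_, ?_, ?_, ?_, ?_⟩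
  · linarith
  · exact hm ▸ hdf
  · rw [hF, hf]
  · apply eq_coordEndo he hq
    · simp only [Matrix.of_apply, Matrix.cons_val_zero, Matrix.cons_val_one,
        Matrix.cons_val', Matrix.cons_val_fin_one]
      rw [hc0, hc1, map_smul, hφY, neg_smul, hE, zero_smul, zero_add, smul_neg]
      ring_nf
    · simp only [Matrix.of_apply, Matrix.cons_val_zero, Matrix.cons_val_one,
        Matrix.cons_val', Matrix.cons_val_fin_one]
      rw [hc0, hc1, map_smul, hE, zero_smul, add_zero]
      ring_nf
    · rw [← hξ, S.φ_ξ]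
  · intro v w
    rw [hg]
    simp [Fin.sum_univ_two]
  · rw [Φ, hc0, hc1]
    simp only [map_smul, smul_apply, smul_eq_mul, hYY]
    rw [mul_one, ← Real.exp_add]
    ring_nf
  · rw [Φ, ← hξ, S.φ_ξ, map_zero]
  · rw [Φ, ← hξ, S.φ_ξ, map_zero]
  · apply eq_coordEndo he hq
    · simp only [Matrix.smul_apply, smul_eq_mul, Matrix.of_apply, Matrix.cons_val_zero,
        Matrix.cons_val_one, Matrix.cons_val', Matrix.cons_val_fin_one]
      rw [hc0, hc1, map_smul, ← hS.φ_h', hhY, map_neg, map_smul, hφY, mul_zero, zero_smul,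
        zero_add, ← Real.exp_add, hE, smul_neg, smul_neg, smul_neg, neg_neg, hE]
      ring_nf
    · simp only [Matrix.smul_apply, smul_eq_mul, Matrix.of_apply, Matrix.cons_val_zero,
        Matrix.cons_val_one, Matrix.cons_val', Matrix.cons_val_fin_one]
      rw [hc0, hc1, map_smul, ← hS.φ_h', hhX, map_smul, mul_zero, zero_smul,
        add_zero, ← Real.exp_add, hE, hE]
      ring_nf
    · rw [← hξ, S.h_ξ]
  · apply eq_coordEndo he hq
    · simp only [Matrix.of_apply, Matrix.cons_val_zero, Matrix.cons_val_one,
        Matrix.cons_val', Matrix.cons_val_fin_one]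
      rw [hc0, hc1, map_smul, hhY, zero_smul, add_zero]
      module
    · simp only [Matrix.of_apply, Matrix.cons_val_zero, Matrix.cons_val_one,
        Matrix.cons_val', Matrix.cons_val_fin_one]
      rw [hc0, hc1, map_smul, hhX, zero_smul, zero_add]
      module
    · rw [← hξ, S.h'_ξ]
  · have hee : Real.exp (-f t) * Real.exp (-f t) = Real.exp (-2 * f t) := by
      rw [← Real.exp_add]; ring_nf
    ext i j
    fin_cases i <;> fin_cases j <;> simp [Matrix.mul_apply, Fin.sum_univ_two, hee]
  · intro i j
    fin_cases i <;> fin_cases j <;> simp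
    · exact hasDerivAt_const _ _
    · exact h2.exp.congr_deriv (by ring)
    · exact h2'.exp.neg.congr_deriv (by ring)
    · exact hasDerivAt_const _ _
  · intro i j
    rw [hm]
    fin_cases i <;> fin_cases j <;> simp
    · exact hl.neg.congr_deriv (by ring)
    · exact hasDerivAt_const _ _
    · exact hasDerivAt_const _ _
    · exact hl.congr_deriv (by ring)
  · intro i j
    rw [hm]
    fin_cases i <;> fin_cases j <;> simp
    · exact hasDerivAt_const _ _
    · exact (hl.mul h2.exp).congr_deriv (by ring)
    · exact (hl.mul h2'.exp).congr_deriv (by ring)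
    · exact hasDerivAt_const _ _

end AdaptedCharts

end AlmostContactMetric

/-! ### The converse: the nullity condition from the normal form. -/

section FunctionsOfOneCoordinate

variable {M : Type*} [TopologicalSpace M] [ChartedSpace (EuclideanSpace ℝ (Fin 3)) M]
  {e : OpenPartialHomeomorph M (EuclideanSpace ℝ (Fin 3))}

theorem mvfderiv_coordVec_eq_zero
    (he : e ∈ IsManifold.maximalAtlas 𝓘(ℝ, EuclideanSpace ℝ (Fin 3)) ∞ M) {q : M}
    (hq : q ∈ e.source) {F : M → ℝ}
    (hF : MDifferentiableAt 𝓘(ℝ, EuclideanSpace ℝ (Fin 3)) 𝓘(ℝ, ℝ) F q) {G : ℝ → ℝ} {i j : Fin 3}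
    (hij : i ≠ j) (hFG : ∀ q ∈ e.source, F q = G (e q j)) :
    mvfderiv 𝓘(ℝ, EuclideanSpace ℝ (Fin 3)) F q (coordVec e i q) = 0 := by
  rw [show coordVec e i q = coordField e (EuclideanSpace.single i 1) q from rfl,
    ← fderiv_comp_symm he hq hF]
  let γ : ℝ → EuclideanSpace ℝ (Fin 3) := fun s => e q + s • EuclideanSpace.single i (1 : ℝ)
  have hγ0 : γ 0 = e q := by simp [γ]
  have hγ : HasDerivAt γ (EuclideanSpace.single i (1 : ℝ)) 0 := by
    have := ((hasDerivAt_id (0 : ℝ)).smul_const (EuclideanSpace.single i (1 : ℝ))).const_add (e q)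
    rwa [one_smul] at this
  have h1 := HasFDerivAt.comp_hasDerivAt (0 : ℝ) (l := F ∘ e.symm)
    (by rw [hγ0]; exact (differentiableAt_comp_symm he hq hF).hasFDerivAt) hγ
  have h2 : (F ∘ e.symm) ∘ γ =ᶠ[𝓝 0] fun _ => G (e q j) := by
    have h3 : ∀ᶠ s in 𝓝 (0 : ℝ), γ s ∈ e.target :=
      hγ.continuousAt (e.open_target.mem_nhds (by rw [hγ0]; exact e.map_source hq))
    filter_upwards [h3] with s hs
    simp only [Function.comp_apply]
    rw [hFG _ (e.map_target hs), e.right_inv hs]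
    simp [γ, hij.symm]
  exact h1.unique ((hasDerivAt_const _ _).congr_of_eventuallyEq h2)

theorem coordEndo_coordVec
    (he : e ∈ IsManifold.maximalAtlas 𝓘(ℝ, EuclideanSpace ℝ (Fin 3)) ∞ M) {q : M}
    (hq : q ∈ e.source) (A : Matrix (Fin 2) (Fin 2) ℝ) (j : Fin 2) :
    coordEndo e A q (coordVec e j.castSucc q)
      = A 0 j • coordVec e 0 q + A 1 j • coordVec e 1 q := by
  simp only [coordEndo, coordDiff_coordVec he hq]
  fin_cases j <;> simp [Fin.sum_univ_two]

end FunctionsOfOneCoordinate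

namespace AlmostContactMetric.IsAlmostKenmotsu

variable {M : Type*} [TopologicalSpace M] [ChartedSpace (EuclideanSpace ℝ (Fin 3)) M]
  [IsManifold 𝓘(ℝ, EuclideanSpace ℝ (Fin 3)) ∞ M]
  {S : AlmostContactMetric (EuclideanSpace ℝ (Fin 3)) M} {k μ : M → ℝ}
  {e : OpenPartialHomeomorph M (EuclideanSpace ℝ (Fin 3))} {m f : ℝ → ℝ}
  {φ g h B : ℝ → Matrix (Fin 2) (Fin 2) ℝ}

/-- Since `ξ = ∂₂` commutes with `∂ᵢ`, this derivative equals `∇_{∂ᵢ}ξ`. -/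
theorem leviCivita_coordVec_ξ [T2Space M] (hS : S.IsAlmostKenmotsu)
    (he : e ∈ IsManifold.maximalAtlas 𝓘(ℝ, EuclideanSpace ℝ (Fin 3)) ∞ M)
    (hξ : ∀ q ∈ e.source, S.ξ q = coordVec e 2 q) (hη : ∀ q ∈ e.source, S.η q = coordDiff e 2 q)
    {q : M} (hq : q ∈ e.source) (i : Fin 2) :
    leviCivita S.g (coordVec e i.castSucc) q (S.ξ q)
      = coordVec e i.castSucc q + S.h' q (coordVec e i.castSucc q) := by
  have h1 := mlieBracket_eq_leviCivita S.g
    (mdiffAt_coordField he hq (EuclideanSpace.single (2 : Fin 3) (1 : ℝ)))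
    (mdiffAt_coordField he hq (EuclideanSpace.single i.castSucc (1 : ℝ)))
  rw [mlieBracket_coordField he hq] at h1
  have h2 : leviCivita S.g S.ξ q = leviCivita S.g (coordVec e 2) q :=
    leviCivita_congr S.g (S.contMDiff_ξ.mdiffAt q) (mdiffAt_coordField he hq _)
      (by filter_upwards [e.open_source.mem_nhds hq] with y hy using hξ y hy)
  have h3 : leviCivita S.g (coordVec e i.castSucc) q (coordVec e 2 q)
      = leviCivita S.g (coordVec e 2) q (coordVec e i.castSucc q) := (sub_eq_zero.1 h1.symm)
  rw [hξ q hq, h3, ← h2, hS.leviCivita_ξ, hη q hq, coordDiff_coordVec he hq,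
    if_neg (by fin_cases i <;> decide)]
  simp

/-- If the metric coefficients depend only on `x²`, then the Levi-Civita derivatives of the
coordinate fields `∂/∂x⁰`, `∂/∂x¹` along each other are multiples of `ξ`. -/
theorem leviCivita_coordVec_coordVec [T2Space M] (hS : S.IsAlmostKenmotsu)
    (he : e ∈ IsManifold.maximalAtlas 𝓘(ℝ, EuclideanSpace ℝ (Fin 3)) ∞ M)
    (hξ : ∀ q ∈ e.source, S.ξ q = coordVec e 2 q) (hη : ∀ q ∈ e.source, S.η q = coordDiff e 2 q)
    (hg : ∀ q ∈ e.source, ∀ i j : Fin 2,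
      S.g.inner q (coordVec e i.castSucc q) (coordVec e j.castSucc q) = g (e q 2) i j)
    {q : M} (hq : q ∈ e.source) (i j : Fin 2) :
    leviCivita S.g (coordVec e j.castSucc) q (coordVec e i.castSucc q)
      = -S.g.inner q (coordVec e j.castSucc q)
          (coordVec e i.castSucc q + S.h' q (coordVec e i.castSucc q)) • S.ξ q := by
  have hne : ∀ i : Fin 2, i.castSucc ≠ (2 : Fin 3) := fun i => by fin_cases i <;> decide
  have hηc : ∀ i : Fin 2, ∀ q ∈ e.source, S.η q (coordVec e i.castSucc q) = 0 := fun i q hq => by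
    rw [hη q hq, coordDiff_coordVec he hq, if_neg (hne i).symm]
  have hd : ∀ i : Fin 3, _ := fun i =>
    mdiffAt_coordField he hq (EuclideanSpace.single i (1 : ℝ))
  have hξq := S.contMDiff_ξ.mdiffAt q
  -- All six Koszul terms vanish: coordinate fields commute, and the metric coefficients are
  -- constant in the directions `∂₀` and `∂₁`.
  have htan : ∀ l : Fin 2, S.g.inner q
      (leviCivita S.g (coordVec e j.castSucc) q (coordVec e i.castSucc q))
      (coordVec e l.castSucc q) = 0 := by
    intro l
    have h0 : ∀ a b c : Fin 2, mvfderiv 𝓘(ℝ, EuclideanSpace ℝ (Fin 3))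
        (fun q => S.g.inner q (coordVec e a.castSucc q) (coordVec e b.castSucc q)) q
        (coordVec e c.castSucc q) = 0 := fun a b c =>
      mvfderiv_coordVec_eq_zero he hq (mdiffAt_inner S.g (hd a.castSucc) (hd b.castSucc)) (hne c)
        (G := fun t => g t a b) (fun q hq => hg q hq a b)
    have hb : ∀ a b : Fin 2, mlieBracket 𝓘(ℝ, EuclideanSpace ℝ (Fin 3)) (coordVec e a.castSucc)
        (coordVec e b.castSucc) q = 0 := fun a b => mlieBracket_coordField he hq _ _
    have h1 : 2 * S.g.inner q
        (leviCivita S.g (coordVec e j.castSucc) q (coordVec e i.castSucc q))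
        (coordVec e l.castSucc q)
        = koszul S.g (coordVec e i.castSucc) (coordVec e j.castSucc) (coordVec e l.castSucc) q :=
      leviCivita_koszul S.g (hd i.castSucc) (hd j.castSucc) (hd l.castSucc)
    rw [koszul, h0, h0, h0, hb, hb, hb] at h1
    simpa using h1
  -- Differentiating `g(∂ⱼ, ξ) = 0` moves the derivative to `ξ`.
  have hnor : S.η q (leviCivita S.g (coordVec e j.castSucc) q (coordVec e i.castSucc q))
      = -S.g.inner q (coordVec e j.castSucc q)
          (coordVec e i.castSucc q + S.h' q (coordVec e i.castSucc q)) := by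
    have h1 : mvfderiv 𝓘(ℝ, EuclideanSpace ℝ (Fin 3))
        (fun q => S.g.inner q (coordVec e j.castSucc q) (S.ξ q)) q (coordVec e i.castSucc q)
        = S.g.inner q (leviCivita S.g (coordVec e j.castSucc) q (coordVec e i.castSucc q)) (S.ξ q)
          + S.g.inner q (coordVec e j.castSucc q)
            (leviCivita S.g S.ξ q (coordVec e i.castSucc q)) :=
      mvfderiv_inner S.g (hd j.castSucc) hξq _
    rw [mvfderiv_congr (G := fun _ => 0) (by
      filter_upwards [e.open_source.mem_nhds hq] with y hy
      rw [S.inner_ξ_right, hηc j y hy]), mvfderiv_const, zero_apply, S.inner_ξ_right,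
      hS.leviCivita_ξ, hηc i q hq, zero_smul, sub_zero] at h1
    linarith
  apply eq_of_forall_inner S.g
  intro w
  rw [eq_sum_coordVec he hq w, ← hξ q hq]
  have ht0 := htan 0
  have ht1 := htan 1
  have hc0 := hηc 0 q hq
  have hc1 := hηc 1 q hq
  simp only [Fin.castSucc_zero, Fin.castSucc_one] at ht0 ht1 hc0 hc1
  simp only [map_add, map_smul, smul_apply, smul_eq_mul, S.inner_ξ_left, S.inner_ξ_right, hnor,
    ht0, ht1, hc0, hc1, S.η_ξ]
  ring

/-- The Leibniz rule for `h'∂ⱼ = B⁰ⱼ∂₀ + B¹ⱼ∂₁`; the equation `B' = -cB` collects the derivatives of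
the coefficients into one multiple of `h'∂ⱼ`. -/
theorem covDeriv_h'_coordVec
    (he : e ∈ IsManifold.maximalAtlas 𝓘(ℝ, EuclideanSpace ℝ (Fin 3)) ∞ M)
    (hB : ∀ q ∈ e.source, ∀ j : Fin 2, S.h' q (coordVec e j.castSucc q)
      = B (e q 2) 0 j • coordVec e 0 q + B (e q 2) 1 j • coordVec e 1 q)
    {q : M} (hq : q ∈ e.source) {c : ℝ}
    (hdB : ∀ i j, HasDerivAt (fun s => B s i j) (-c * B (e q 2) i j) (e q 2)) (j : Fin 2)
    (v : TangentSpace 𝓘(ℝ, EuclideanSpace ℝ (Fin 3)) q) :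
    S.covDeriv_h' q (coordVec e j.castSucc q) v
      = B (e q 2) 0 j • leviCivita S.g (coordVec e 0) q v
        + B (e q 2) 1 j • leviCivita S.g (coordVec e 1) q v
        - (c * coordDiff e 2 q v) • S.h' q (coordVec e j.castSucc q)
        - S.h' q (leviCivita S.g (coordVec e j.castSucc) q v) := by
  have hd : ∀ i : Fin 3, _ := fun i =>
    mdiffAt_coordField he hq (EuclideanSpace.single i (1 : ℝ))
  have he2 : MDifferentiableAt 𝓘(ℝ, EuclideanSpace ℝ (Fin 3)) 𝓘(ℝ, ℝ) (fun q => e q 2) q :=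
    MDifferentiableAt.comp q
      (EuclideanSpace.proj (2 : Fin 3) : EuclideanSpace ℝ (Fin 3) →L[ℝ] ℝ).differentiableAt.mdifferentiableAt
      ((mdifferentiable_of_mem_maximalAtlas he).mdifferentiableAt hq)
  have hb : ∀ i, MDifferentiableAt 𝓘(ℝ, EuclideanSpace ℝ (Fin 3)) 𝓘(ℝ, ℝ)
      (fun q => B (e q 2) i j) q := fun i =>
    MDifferentiableAt.comp (g := fun s => B s i j) q
      (hdB i j).differentiableAt.mdifferentiableAt he2
  have hdb : ∀ i, mvfderiv 𝓘(ℝ, EuclideanSpace ℝ (Fin 3)) (fun q => B (e q 2) i j) q v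
      = -c * B (e q 2) i j * coordDiff e 2 q v := fun i =>
    mvfderiv_comp_real (F := fun q => e q 2) (hdB i j) he2 v
  have h0 : leviCivita S.g ((fun q => B (e q 2) 0 j) • coordVec e 0) q v
      = B (e q 2) 0 j • leviCivita S.g (coordVec e 0) q v
        + mvfderiv 𝓘(ℝ, EuclideanSpace ℝ (Fin 3)) (fun q => B (e q 2) 0 j) q v • coordVec e 0 q :=
    leviCivita_smul S.g (hb 0) (hd 0) v
  have h1 : leviCivita S.g ((fun q => B (e q 2) 1 j) • coordVec e 1) q v
      = B (e q 2) 1 j • leviCivita S.g (coordVec e 1) q v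
        + mvfderiv 𝓘(ℝ, EuclideanSpace ℝ (Fin 3)) (fun q => B (e q 2) 1 j) q v • coordVec e 1 q :=
    leviCivita_smul S.g (hb 1) (hd 1) v
  have hs0 := (hb 0).smul_section (hd 0)
  have hs1 := (hb 1).smul_section (hd 1)
  have h2 : leviCivita S.g (fun q => S.h' q (coordVec e j.castSucc q)) q
      = leviCivita S.g ((fun q => B (e q 2) 0 j) • coordVec e 0
        + (fun q => B (e q 2) 1 j) • coordVec e 1) q :=
    leviCivita_congr S.g (S.isDiffEndo_h' (hd j.castSucc)) (mdifferentiableAt_add_section hs0 hs1)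
      (by filter_upwards [e.open_source.mem_nhds hq] with y hy using hB y hy j)
  have h3 : leviCivita S.g ((fun q => B (e q 2) 0 j) • coordVec e 0
        + (fun q => B (e q 2) 1 j) • coordVec e 1) q
      = leviCivita S.g ((fun q => B (e q 2) 0 j) • coordVec e 0) q
        + leviCivita S.g ((fun q => B (e q 2) 1 j) • coordVec e 1) q :=
    leviCivita_add S.g hs0 hs1
  have h4 : S.covDeriv_h' q (coordVec e j.castSucc q) v
      = leviCivita S.g (fun q => S.h' q (coordVec e j.castSucc q)) q v
        - S.h' q (leviCivita S.g (coordVec e j.castSucc) q v) :=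
    S.covDeriv_h'_apply (hd j.castSucc) v
  rw [h4, h2, h3, add_apply, h0, h1, hdb, hdb, hB q hq j]
  module

/-- The normal form of the structure implies the nullity condition. -/
theorem generalizedNullity'_of_isNormalFormIn [T2Space M] (hS : S.IsAlmostKenmotsu)
    (H : ∀ p : M, ∃ e ∈ IsManifold.maximalAtlas 𝓘(ℝ, EuclideanSpace ℝ (Fin 3)) ∞ M,
      p ∈ e.source ∧ ∃ (m f : ℝ → ℝ) (φ g h B : ℝ → Matrix (Fin 2) (Fin 2) ℝ),
        S.IsNormalFormIn k μ e m f φ g h B) :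
    S.GeneralizedNullity' k μ := by
  rw [hS.generalizedNullity'_iff]
  intro q v w
  obtain ⟨e, he, hq, m, f, φ, g, h, B, H⟩ := H q
  have hξ : ∀ q ∈ e.source, S.ξ q = coordVec e 2 q := fun q hq => (H q hq _ rfl).2.2.2.2.1
  have hη : ∀ q ∈ e.source, S.η q = coordDiff e 2 q := fun q hq => (H q hq _ rfl).2.2.2.2.2.1
  have hne : ∀ i : Fin 2, i.castSucc ≠ (2 : Fin 3) := fun i => by fin_cases i <;> decide
  have hηc : ∀ i : Fin 2, S.η q (coordVec e i.castSucc q) = 0 := fun i => by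
    rw [hη q hq, coordDiff_coordVec he hq, if_neg (hne i).symm]
  have hg : ∀ q ∈ e.source, ∀ i j : Fin 2,
      S.g.inner q (coordVec e i.castSucc q) (coordVec e j.castSucc q) = g (e q 2) i j := by
    intro q hq i j
    rw [(H q hq _ rfl).2.2.2.2.2.2.1]
    simp only [coordDiff_coordVec he hq]
    fin_cases i <;> fin_cases j <;> simp [Fin.sum_univ_two]
  have hB : ∀ q ∈ e.source, ∀ j : Fin 2, S.h' q (coordVec e j.castSucc q)
      = B (e q 2) 0 j • coordVec e 0 q + B (e q 2) 1 j • coordVec e 1 q := fun q hq j => by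
    rw [(H q hq _ rfl).2.2.2.2.2.2.2.2.2.2.2.1, coordEndo_coordVec he hq]
  obtain ⟨hμ, -, hk, -, -, -, -, -, -, -, -, -, hBB, -, hdB, -⟩ := H q hq _ rfl
  rw [← hμ] at hdB
  set t := e q 2 with ht
  have hh : ∀ j : Fin 2, S.h' q (S.h' q (coordVec e j.castSucc q))
      = -(k q + 1) • coordVec e j.castSucc q := by
    intro j
    have hB0 : S.h' q (coordVec e 0 q) = B t 0 0 • coordVec e 0 q + B t 1 0 • coordVec e 1 q :=
      hB q hq 0
    have hB1 : S.h' q (coordVec e 1 q) = B t 0 1 • coordVec e 0 q + B t 1 1 • coordVec e 1 q :=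
      hB q hq 1
    have hm : ∀ i, B t i 0 * B t 0 j + B t i 1 * B t 1 j
        = if i = j then -(k q + 1) else 0 := fun i => by
      have := congrFun (congrFun hBB i) j
      simp only [Matrix.mul_apply, Fin.sum_univ_two, Matrix.smul_apply, Matrix.one_apply,
        smul_eq_mul] at this
      rw [this, hk]
      split_ifs <;> ring
    have hsum : S.h' q (S.h' q (coordVec e j.castSucc q))
        = (B t 0 0 * B t 0 j + B t 0 1 * B t 1 j) • coordVec e 0 q
          + (B t 1 0 * B t 0 j + B t 1 1 * B t 1 j) • coordVec e 1 q := by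
      rw [hB q hq j, map_add, map_smul, map_smul, hB0, hB1]
      module
    rw [hsum, hm, hm]
    fin_cases j <;> simp
  have hcov := fun j => covDeriv_h'_coordVec he hB hq hdB j
  have hLξ := fun i => hS.leviCivita_coordVec_ξ he hξ hη hq i
  have hL := fun i j => hS.leviCivita_coordVec_coordVec he hξ hη hg hq i j
  have htan : S.covDeriv_h' q (coordVec e 1 q) (coordVec e 0 q)
      - S.covDeriv_h' q (coordVec e 0 q) (coordVec e 1 q) = 0 := by
    -- The value is a multiple of `ξ`, which `h'` kills. Its coefficient is symmetric in `i` and `j`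
    -- because `h'` is self-adjoint, so the skew part is zero.
    have hval : ∀ i j : Fin 2, S.covDeriv_h' q (coordVec e j.castSucc q) (coordVec e i.castSucc q)
        = -S.g.inner q (S.h' q (coordVec e j.castSucc q))
          (coordVec e i.castSucc q + S.h' q (coordVec e i.castSucc q)) • S.ξ q := by
      intro i j
      have h0 := hL i 0
      have h1 := hL i 1
      simp only [Fin.castSucc_zero, Fin.castSucc_one] at h0 h1
      rw [hcov, hL i j, h0, h1, ← hη q hq, hηc, map_smul, S.h'_ξ]
      generalize coordVec e i.castSucc q + S.h' q (coordVec e i.castSucc q) = z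
      have hz : S.g.inner q (S.h' q (coordVec e j.castSucc q)) z
          = B (e q 2) 0 j * S.g.inner q (coordVec e 0 q) z
            + B (e q 2) 1 j * S.g.inner q (coordVec e 1 q) z := by
        rw [hB q hq j]
        simp only [map_add, map_smul, add_apply, smul_apply, smul_eq_mul]
      rw [hz]
      module
    have h1 := hval 0 1
    have h2 := hval 1 0
    simp only [Fin.castSucc_zero, Fin.castSucc_one] at h1 h2
    rw [h1, h2, map_add, map_add, hS.inner_h' q (coordVec e 0 q) (coordVec e 1 q),
      S.g.symm q (coordVec e 0 q), S.g.symm q (S.h' q (coordVec e 1 q)) (S.h' q (coordVec e 0 q))]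
    module
  -- The formula `∇_ξ ∂ᵢ = ∂ᵢ + h'∂ᵢ` makes the connection terms of `(∇_ξ h')∂ᵢ` cancel and leaves
  -- `-(μ+2)h'∂ᵢ`. Then `h'² = -(k+1)` on `∂ᵢ` gives the claim.
  have hnor : ∀ i : Fin 2, S.covDeriv_h' q (S.ξ q) (coordVec e i.castSucc q)
      - S.covDeriv_h' q (coordVec e i.castSucc q) (S.ξ q)
      = (k q + 1) • coordVec e i.castSucc q
        + (μ q + 1) • S.h' q (coordVec e i.castSucc q) := by
    intro i
    have h0 := hLξ 0
    have h1 := hLξ 1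
    simp only [Fin.castSucc_zero, Fin.castSucc_one] at h0 h1
    have hsum : S.h' q (S.h' q (coordVec e i.castSucc q))
        = B t 0 i • S.h' q (coordVec e 0 q) + B t 1 i • S.h' q (coordVec e 1 q) := by
      conv_lhs => rw [hB q hq i, map_add, map_smul, map_smul]
    rw [hS.covDeriv_h'_ξ, hcov, hLξ, h0, h1, ← hη q hq, S.η_ξ, map_add, hh]
    rw [hh] at hsum
    have hB' := hB q hq i
    linear_combination (norm := module) hB' + hsum
  have hn0 := hnor 0
  have hn1 := hnor 1
  have hc0 := hηc 0
  have hc1 := hηc 1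
  simp only [Fin.castSucc_zero, Fin.castSucc_one] at hn0 hn1 hc0 hc1
  -- Both sides are bilinear and skew in `v` and `w`, so the three pairs of coordinate fields
  -- suffice; the coefficients below are the `2 × 2` minors of the components.
  rw [eq_sum_coordVec he hq v, eq_sum_coordVec he hq w, ← hξ q hq]
  generalize coordDiff e 0 q v = v0
  generalize coordDiff e 1 q v = v1
  generalize coordDiff e 2 q v = v2
  generalize coordDiff e 0 q w = w0
  generalize coordDiff e 1 q w = w1
  generalize coordDiff e 2 q w = w2
  simp only [map_add, map_smul, add_apply, smul_apply, smul_eq_mul, hc0, hc1, S.η_ξ, S.h'_ξ]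
  linear_combination (norm := module) (v0 * w1 - v1 * w0) • htan + (v0 * w2 - v2 * w0) • hn0
    + (v1 * w2 - v2 * w1) • hn1

end AlmostContactMetric.IsAlmostKenmotsu

end AlmostKenmotsu

end

theorem theorem6p6
    {M : Type*} [TopologicalSpace M] [ChartedSpace (EuclideanSpace ℝ (Fin 3)) M]
    [IsManifold 𝓘(ℝ, EuclideanSpace ℝ (Fin 3)) ∞ M]
    [T2Space M] [SecondCountableTopology M] [ConnectedSpace M]
    (S : AlmostKenmotsu.AlmostContactMetric (EuclideanSpace ℝ (Fin 3)) M)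
    (hS : S.IsAlmostKenmotsu)
    (hh : ∃ p : M, S.h p ≠ 0)
    (k μ : M → ℝ)
    (hk : ContMDiff 𝓘(ℝ, EuclideanSpace ℝ (Fin 3)) 𝓘(ℝ, ℝ) ∞ k)
    (hμ : ContMDiff 𝓘(ℝ, EuclideanSpace ℝ (Fin 3)) 𝓘(ℝ, ℝ) ∞ μ)
    -- `dk ∧ η = 0`
    (hdk : ∀ (p : M) (v w : TangentSpace 𝓘(ℝ, EuclideanSpace ℝ (Fin 3)) p),
      mvfderiv 𝓘(ℝ, EuclideanSpace ℝ (Fin 3)) k p v * S.η p w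
        - mvfderiv 𝓘(ℝ, EuclideanSpace ℝ (Fin 3)) k p w * S.η p v = 0)
    (hμ2 : ∃ p : M, μ p ≠ -2) :
    S.GeneralizedNullity' k μ ↔
      ∀ p : M,
        ∃ e ∈ IsManifold.maximalAtlas 𝓘(ℝ, EuclideanSpace ℝ (Fin 3)) ∞ M, p ∈ e.source ∧
        ∃ (m f : ℝ → ℝ) (φ g h B : ℝ → Matrix (Fin 2) (Fin 2) ℝ),
          ∀ q ∈ e.source, ∀ t : ℝ, t = e q 2 →
            -- the functions `μ` and `k`, with `f` an antiderivative of `μ + 2`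
            μ q = m t ∧
            HasDerivAt f (m t + 2) t ∧
            k q = -1 - Real.exp (-2 * f t) ∧
            -- the structure tensors
            (∀ v, S.φ q v = AlmostKenmotsu.coordEndo e (φ t) q v) ∧
            S.ξ q = AlmostKenmotsu.coordVec e 2 q ∧
            S.η q = AlmostKenmotsu.coordDiff e 2 q ∧
            (∀ v w, S.g.inner q v w =
              AlmostKenmotsu.coordDiff e 2 q v * AlmostKenmotsu.coordDiff e 2 q w
                + ∑ i : Fin 2, ∑ j : Fin 2,
                    g t i j * (AlmostKenmotsu.coordDiff e i.castSucc q v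
                      * AlmostKenmotsu.coordDiff e j.castSucc q w)) ∧
            -- the components of the (skew-symmetric) fundamental 2-form
            S.Φ q (AlmostKenmotsu.coordVec e 0 q) (AlmostKenmotsu.coordVec e 1 q)
              = Real.exp (2 * t) ∧
            S.Φ q (AlmostKenmotsu.coordVec e 0 q) (AlmostKenmotsu.coordVec e 2 q) = 0 ∧
            S.Φ q (AlmostKenmotsu.coordVec e 1 q) (AlmostKenmotsu.coordVec e 2 q) = 0 ∧
            -- the tensors `h` and `h'`
            (∀ v, S.h q v = AlmostKenmotsu.coordEndo e (h t) q v) ∧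
            (∀ v, S.h' q v = AlmostKenmotsu.coordEndo e (B t) q v) ∧
            B t * B t = Real.exp (-2 * f t) • (1 : Matrix (Fin 2) (Fin 2) ℝ) ∧
            -- the differential equations, with `λ = exp (-f)`
            (∀ i j, HasDerivAt (fun s => φ s i j) (2 * h t i j) t) ∧
            (∀ i j, HasDerivAt (fun s => B s i j) (-(m t + 2) * B t i j) t) ∧
            (∀ i j, HasDerivAt (fun s => h s i j)
              (2 * Real.exp (-f t) ^ 2 * φ t i j - (m t + 2) * h t i j) t) := by
  constructor
  · intro hN p
    have hE : Module.finrank ℝ (EuclideanSpace ℝ (Fin 3)) = 3 := by simp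
    obtain ⟨F, hFs, hF, hdF⟩ := hS.exists_potential hN (by omega) hk hμ hdk hh
    obtain ⟨e, he, hp, f, u, X, hX⟩ := hS.exists_adapted_chart hN hFs hF hdF p
    exact ⟨e, he, hp, _, f, _, _, _, _, hS.isNormalFormIn he hF hX⟩
  · exact hS.generalizedNullity'_of_isNormalFormIn
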